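/- For $f:\mathbb C\to\mathbb C$ and $\varepsilon>0$ put $$B_\varepsilon f(z)=\int_{|w-z|>\varepsilon}\frac{f(w)}{(w-z)^2}\,dA(w),\qquad Bf(z)=\lim_{\varepsilon\to0^+}B_\varepsilon f(z),\qquad B^*f(z)=\sup_{\varepsilon>0}|B_\varepsilon f(z)|$$ ($B$ is the Beurling transform), put $$(B^2)^*f(z)=\sup_{\varepsilon>0}\left|\int_{|w-z|>\varepsilon}2\pi\,\frac{\overline{w-z}}{(w-z)^3}\,f(w)\,dA(w)\right|,$$ and let $Mf(z)=\sup_{r>0}\frac1{\pi r^2}\int_{D(z,r)}|f|\,dA$ be the Hardy–Littlewood maximal function. (0) For $1<p<\infty$ and $f\in L^p(\mathbb C)$, the limit defining $Bf$ exists almost everywhere, $Bf\in L^p(\mathbb C)$, and for almost every $z$ $$B(Bf)(z)=\lim_{\varepsilon\to0^+}\int_{|w-z|>\varepsilon}2\pi\,\frac{\overline{w-z}}{(w-z)^3}\,f(w)\,dA(w),$$ so that $(B^2)^*$ is the maximal singular integral of $B^2=B\circ B$. For the unit disc $D$, $$B^2(\chi_D)(z)=\pi^2\left(\frac{2\bar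 z}{z^3}-\frac{3}{z^4}\right)\chi_{\{|z|>1\}}(z)\quad\text{for almost every } z.$$ There is an absolute constant $C$ such that the following hold. (1) For every $f$ belonging to some $L^p(\mathbb C)$, $1<p<\infty$, and every $z\in\mathbb C$, $$B^*(Bf)(z)\le C\left((B^2)^*f(z)+Mf(z)\right).$$ (2) $B^*\circ B$ is of weak type $(1,1)$: for every $f$ in $L^1(\mathbb C)$ and in some $L^p(\mathbb C)$, $1<p<\infty$, and every $t>0$, $$|\{z\in\mathbb C: B^*(Bf)(z)>t\}|\le\frac Ct\int_{\mathbb C}|f|\,dA.$$ (3) For all $\varepsilon>0$ and $z\in\mathbb C$, the functional $g\mapsto B_\varepsilon(Bg)(z)$ on $L^1\cap\bigcup_{1<p<\infty}L^p$ extends continuously to $L^1(\mathbb C)$; with $B^*(Bf)(z)$ understood, for $f\in L^1(\mathbb C)$, as the supremum over $\varepsilon>0$ of the absolute values of these extensions at $f$, the inequalities of (1) and (2) hold for every $f\in L^1(\mathbb C)$, $z\in\mathbb C$ and $t>0$. (4) In contrast, for the Hilbert transform $Hf(x)=\mathrm{p.v.}\int_{\mathbb R}\frac{f(y)}{y-x}\,dy$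 and the maximal Hilbert transform $H^*f(x)=\sup_{\varepsilon>0}\left|\int_{|y-x|>\varepsilon}\frac{f(y)}{y-x}\,dy\right|$, the operator $H^*\circ H$ is not of weak type $(1,1)$: there is no constant $C$ such that $|\{x\in\mathbb R: H^*(Hf)(x)>t\}|\le\frac Ct\int_{\mathbb R}|f|\,dx$ for all real-valued $f\in L^1(\mathbb R)\cap L^\infty(\mathbb R)$ and all $t>0$. -/

import Mathlib

open MeasureTheory Filter Topology
open scoped ENNReal NNReal

/-- The truncation at level `ε` of the singular integral with kernel `K`:
`∫_{|y - x| > ε} f(y) K(y - x) dy`. -/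
noncomputable def truncation {E 𝕜 : Type*} [NormedAddCommGroup E] [MeasureSpace E] [RCLike 𝕜]
    (K : E → 𝕜) (ε : ℝ) (f : E → 𝕜) (x : E) : 𝕜 :=
  ∫ y in {y : E | ε < ‖y - x‖}, f y * K (y - x)

/-- The principal value singular integral with kernel `K`: the limit of the truncations as
`ε → 0⁺` (a junk value at the points where the limit does not exist). -/
noncomputable def principalValue {E 𝕜 : Type*} [NormedAddCommGroup E] [MeasureSpace E] [RCLike 𝕜]
    (K : E → 𝕜) (f : E → 𝕜) (x : E) : 𝕜 :=
  limUnder (𝓝[>] (0 : ℝ)) (fun ε => truncation K ε f x)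

/-- The maximal singular integral with kernel `K`: the supremum over `ε > 0` of the absolute
values of the truncations, with values in `[0, ∞]`. -/
noncomputable def maximalSingular {E 𝕜 : Type*} [NormedAddCommGroup E] [MeasureSpace E] [RCLike 𝕜]
    (K : E → 𝕜) (f : E → 𝕜) (x : E) : ℝ≥0∞ :=
  ⨆ (ε : ℝ) (_ : 0 < ε), ‖truncation K ε f x‖ₑ

/-- The Hardy-Littlewood maximal function on `ℂ` (over centred discs). -/
noncomputable def hardyLittlewood (f : ℂ → ℂ) (z : ℂ) : ℝ≥0∞ :=
  ⨆ (r : ℝ) (_ : 0 < r), (volume (Metric.ball z r))⁻¹ * ∫⁻ w in Metric.ball z r, ‖f w‖ₑ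

/-- The kernel `1 / ζ²` of the Beurling transform. -/
noncomputable def beurlingKernel (ζ : ℂ) : ℂ := 1 / ζ ^ 2

/-- The Beurling transform `B f(z) = p.v. ∫ f(w) / (w - z)² dA(w)`. -/
noncomputable def beurling (f : ℂ → ℂ) : ℂ → ℂ := principalValue beurlingKernel f

/-- The maximal Beurling transform `B*`. -/
noncomputable def beurlingMax (f : ℂ → ℂ) : ℂ → ℝ≥0∞ := maximalSingular beurlingKernel f

/-- The kernel `2π ζ̄ / ζ³` of the Calderón-Zygmund operator `B² = B ∘ B`. -/
noncomputable def beurlingSqKernel (ζ : ℂ) : ℂ := 2 * Real.pi * (starRingEnd ℂ ζ) / ζ ^ 3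

/-- The maximal singular integral `(B²)*` of `B² = B ∘ B`. -/
noncomputable def beurlingSqMax (f : ℂ → ℂ) : ℂ → ℝ≥0∞ := maximalSingular beurlingSqKernel f

/-- The Hilbert transform `H f(x) = p.v. ∫ f(y) / (y - x) dy`. -/
noncomputable def hilbert (f : ℝ → ℝ) : ℝ → ℝ := principalValue (fun x : ℝ => 1 / x) f

/-- The maximal Hilbert transform `H*`. -/
noncomputable def hilbertMax (f : ℝ → ℝ) : ℝ → ℝ≥0∞ := maximalSingular (fun x : ℝ => 1 / x) f

/-- `f` lies in `L^p(ℂ)` for some `1 < p < ∞`. -/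
def InSomeLp (f : ℂ → ℂ) : Prop :=
  ∃ p : ℝ≥0∞, 1 < p ∧ p < ∞ ∧ MemLp f p volume

/-- `T ε z` is the value at `f ∈ L¹` of the continuous extension to `L¹(ℂ)` of the linear
functional `g ↦ B_ε(B g)(z)`, where `B_ε` is the truncation of `B` at level `ε` and
`g` lies in `L¹` and in some `L^p`, `1 < p < ∞` (a dense subspace of `L¹`):
whenever such `g n` tend to `f` in `L¹`, the numbers `B_ε(B (g n))(z)` tend to `T ε z`. -/
def IsL1Extension (f : ℂ → ℂ) (T : ℝ → ℂ → ℂ) : Prop :=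
  ∀ g : ℕ → ℂ → ℂ,
    (∀ n, MemLp (g n) 1 volume ∧ InSomeLp (g n)) →
    Tendsto (fun n => ∫⁻ w, ‖g n w - f w‖ₑ) atTop (𝓝 0) →
    ∀ ε : ℝ, 0 < ε → ∀ z : ℂ,
      Tendsto (fun n => truncation beurlingKernel ε (beurling (g n)) z) atTop (𝓝 (T ε z))

/-!
The reason behind the positive results is an exact formula for the kernel of `B_ε ∘ B`. On the plane
the Beurling transform of `∂̄u` is `-π ∂u`, and the truncated kernel `ζ⁻² χ_{|ζ| > ε}` is `∂̄u` for
the Lipschitz function `u = ζ̄ / ζ² - ε² / ζ³` on `|ζ| ≥ ε`, extended by zero (`truncPrimitive`).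
Moving `B` from `f` to the kernel gives (`truncation_beurling_beurling`)
`B_ε (B f)(z) = π ∫_{|w - z| > ε} f(w) (2 ζ̄ / ζ³ - 3 ε² / ζ⁴) dA(w)`, with `ζ = w - z`.
The first term is the truncation of `B²` at the same level, and the second one is dominated by the
Hardy–Littlewood maximal function at the same point. This is the pointwise inequality. The kernel
on the right is bounded, so for fixed `ε` and `z` the functional extends to `L¹`. It vanishes on the
whole disc `|ζ| < ε`, and no logarithm appears, in contrast to the Hilbert transform. The formulas for
the unit disc are the two evaluations `B(∂̄u) = -π ∂u` with `ε = 1`, the first one for the primitive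
`discPrimitive` of the indicator of the disc.

The weak type inequality reduces in this way to the one for the maximal singular integral `(B²)*`,
which is obtained from an `L²` bound by the Calderón–Zygmund decomposition
(`exists_calderonZygmund`, `StrongType.weakType`). The `L²` bound comes from `B*` applied to `B f`.

The theory of `B*` itself is built without the Fourier transform.
* `B(∂̄u) = -π ∂u` is Green's formula in polar coordinates (`HasWirtinger.integral_annulus`,
  `HasWirtinger.tendsto_truncation`).
* On `L²` the kernel of `B_ε* B_ε` is the autocorrelation of the truncated kernel. The same formula
  shows that it is at most a multiple of the normalized indicator of a disc of radius `3 ε`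
  (`norm_autocorrelation_le`), so `‖B_ε f‖²` is at most a multiple of `∫ |f| M f`.
* The truncated kernel is also a multiple of `B` of the indicator of a disc. So `B_ε f` is an average
  of `B f` over a disc, and `B* f ≤ M(B f)` (`IsTest.maximalSingular_le_maximalFn`).
* The remaining exponents follow by interpolation with the weak type bound and by duality
  (`strongType_beurlingKernel`), and almost everywhere convergence from the maximal bounds and the
  convergence on Lipschitz functions of compact support (`ae_tendsto_truncation_beurling`).

For the Hilbert transform the counterexample is `f(s) = s` on `[0, 1]`. For `x ≥ 1` the truncation of
the integral for `H(H f)(x)` at level `x` runs over `y < 0` and `y > 2 x`, where the contributions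
`H f(y) / (y - x)` have the same sign. As `H f(y)` is comparable to `1 / (1 + |y|)` for `y < 0`, the
part `-x < y < 0` alone is of size `log x / x` (`le_norm_truncation_hilbert_ramp`), which is not in
weak `L¹`.
-/

namespace MaxBeurling

/-! ### Convolution-type operators with kernels that decay like `|ζ|⁻²` -/

/-- `k` is a measurable kernel with `|k(ζ)| ≤ C (1 + |ζ|)⁻²`. -/
structure IsDecaying (k : ℂ → ℂ) (C : ℝ) : Prop where
  measurable : Measurable k
  norm_le : ∀ ζ, ‖k ζ‖ ≤ C * ((1 + ‖ζ‖) ^ 2)⁻¹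

/-- The operator `f ↦ ∫ f(y) k(y - x) dy`, with the sign convention `y - x` of `truncation`; for
decaying `k` and `f ∈ L^p`, `1 ≤ p < ∞`, the integral converges absolutely at every point. -/
noncomputable def kernelOp (k f : ℂ → ℂ) (x : ℂ) : ℂ := ∫ y, f y * k (y - x)

/-- The kernel `K` cut off to `{|ζ| > ε}`. -/
noncomputable def truncKernel (K : ℂ → ℂ) (ε : ℝ) : ℂ → ℂ := {ζ : ℂ | ε < ‖ζ‖}.indicator K

lemma truncation_eq_kernelOp (K : ℂ → ℂ) (ε : ℝ) (f : ℂ → ℂ) (x : ℂ) :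
    truncation K ε f x = kernelOp (truncKernel K ε) f x := by
  have hm : MeasurableSet {y : ℂ | ε < ‖y - x‖} :=
    measurableSet_lt measurable_const (by fun_prop)
  rw [truncation, kernelOp, ← integral_indicator hm]
  congr 1; ext y
  by_cases h : ε < ‖y - x‖ <;> simp [truncKernel, h]

lemma IsDecaying.nonneg {k : ℂ → ℂ} {C : ℝ} (hk : IsDecaying k C) : 0 ≤ C := by
  have := (norm_nonneg _).trans (hk.norm_le 0)
  simpa using this

lemma IsDecaying.norm_le_const {k : ℂ → ℂ} {C : ℝ} (hk : IsDecaying k C) (ζ : ℂ) : ‖k ζ‖ ≤ C := by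
  refine (hk.norm_le ζ).trans (mul_le_of_le_one_right hk.nonneg ?_)
  exact inv_le_one_of_one_le₀ (one_le_pow₀ (by linarith [norm_nonneg ζ]))

lemma IsDecaying.conj {k : ℂ → ℂ} {C : ℝ} (hk : IsDecaying k C) :
    IsDecaying (fun ζ => starRingEnd ℂ (k ζ)) C where
  measurable := Complex.continuous_conj.measurable.comp hk.measurable
  norm_le ζ := by simpa using hk.norm_le ζ

lemma memLp_inv_one_add_norm_sq {q : ℝ≥0∞} (hq : 1 < q) :
    MemLp (fun ζ : ℂ => ((1 + ‖ζ‖) ^ 2)⁻¹) q volume := by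
  have hc : Continuous fun ζ : ℂ => ((1 + ‖ζ‖) ^ 2)⁻¹ := by
    refine Continuous.inv₀ (by fun_prop) fun ζ => ?_
    positivity
  rcases eq_or_ne q ∞ with rfl | hq'
  · refine memLp_top_of_bound hc.aestronglyMeasurable 1 (Eventually.of_forall fun ζ => ?_)
    rw [Real.norm_of_nonneg (by positivity)]
    exact inv_le_one_of_one_le₀ (one_le_pow₀ (by linarith [norm_nonneg ζ]))
  · rw [← integrable_norm_rpow_iff hc.aestronglyMeasurable (by positivity) hq']
    have h1 : 1 < q.toReal := by
      simpa using (ENNReal.toReal_lt_toReal ENNReal.one_ne_top hq').2 hq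
    have := integrable_one_add_norm (E := ℂ) (μ := volume) (r := 2 * q.toReal)
      (by rw [Complex.finrank_real_complex]; push_cast; linarith)
    refine this.congr (Eventually.of_forall fun ζ => ?_)
    have hp : (0 : ℝ) < 1 + ‖ζ‖ := by positivity
    simp only
    rw [Real.norm_of_nonneg (by positivity), Real.rpow_neg hp.le, Real.rpow_mul hp.le,
      Real.inv_rpow (by positivity)]
    norm_num

lemma IsDecaying.memLp {k : ℂ → ℂ} {C : ℝ} (hk : IsDecaying k C) {q : ℝ≥0∞} (hq : 1 < q) :
    MemLp k q volume := by
  refine ((memLp_inv_one_add_norm_sq hq).const_mul C).mono'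
    hk.measurable.aestronglyMeasurable (Eventually.of_forall hk.norm_le)

lemma IsDecaying.memLp_shift {k : ℂ → ℂ} {C : ℝ} (hk : IsDecaying k C) {q : ℝ≥0∞} (hq : 1 < q)
    (x : ℂ) : MemLp (fun y => k (y - x)) q volume :=
  (hk.memLp hq).comp_measurePreserving (measurePreserving_sub_right volume x)

lemma one_lt_conjExponent {p : ℝ≥0∞} (hp : p ≠ ∞) : 1 < p.conjExponent := by
  rw [ENNReal.conjExponent]
  refine ENNReal.lt_add_right ENNReal.one_ne_top ?_
  simp [hp]

lemma IsDecaying.integrable {k : ℂ → ℂ} {C : ℝ} (hk : IsDecaying k C) {p : ℝ≥0∞} (hp1 : 1 ≤ p)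
    (hp : p ≠ ∞) {f : ℂ → ℂ} (hf : MemLp f p volume) (x : ℂ) :
    Integrable (fun y => f y * k (y - x)) := by
  have := ENNReal.HolderConjugate.conjExponent hp1
  exact hf.integrable_mul (hk.memLp_shift (one_lt_conjExponent hp) x)

lemma kernelOp_add {k : ℂ → ℂ} {C : ℝ} (hk : IsDecaying k C) {p q : ℝ≥0∞} (hp1 : 1 ≤ p)
    (hp : p ≠ ∞) (hq1 : 1 ≤ q) (hq : q ≠ ∞) {f g : ℂ → ℂ} (hf : MemLp f p volume)
    (hg : MemLp g q volume) (x : ℂ) :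
    kernelOp k (fun y => f y + g y) x = kernelOp k f x + kernelOp k g x := by
  simp only [kernelOp, add_mul]
  exact integral_add (hk.integrable hp1 hp hf x) (hk.integrable hq1 hq hg x)

lemma kernelOp_sub {k : ℂ → ℂ} {C : ℝ} (hk : IsDecaying k C) {p q : ℝ≥0∞} (hp1 : 1 ≤ p)
    (hp : p ≠ ∞) (hq1 : 1 ≤ q) (hq : q ≠ ∞) {f g : ℂ → ℂ} (hf : MemLp f p volume)
    (hg : MemLp g q volume) (x : ℂ) :
    kernelOp k (fun y => f y - g y) x = kernelOp k f x - kernelOp k g x := by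
  simp only [kernelOp, sub_mul]
  exact integral_sub (hk.integrable hp1 hp hf x) (hk.integrable hq1 hq hg x)

/-- Hölder's inequality, uniformly in the point at which the kernel is centred. -/
lemma IsDecaying.lintegral_enorm_mul_le {k : ℂ → ℂ} {C : ℝ} (hk : IsDecaying k C) {p : ℝ≥0∞}
    (hp1 : 1 ≤ p) {f : ℂ → ℂ} (hf : MemLp f p volume) (x : ℂ) :
    ∫⁻ y, ‖f y * k (y - x)‖ₑ ≤ eLpNorm f p volume * eLpNorm k p.conjExponent volume := by
  have := ENNReal.HolderConjugate.conjExponent hp1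
  have hm : AEStronglyMeasurable (fun y => k (y - x)) volume :=
    (hk.measurable.comp (measurable_id.sub_const x)).aestronglyMeasurable
  have h1 := eLpNorm_smul_le_mul_eLpNorm (p := p) (q := p.conjExponent) (r := 1) hm
    hf.aestronglyMeasurable
  rw [eLpNorm_one_eq_lintegral_enorm] at h1
  refine h1.trans_eq ?_
  congr 1
  exact eLpNorm_comp_measurePreserving hk.measurable.aestronglyMeasurable
    (measurePreserving_sub_right volume x)

lemma enorm_kernelOp_le {k : ℂ → ℂ} {C : ℝ} (hk : IsDecaying k C) {p : ℝ≥0∞} (hp1 : 1 ≤ p)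
    {f : ℂ → ℂ} (hf : MemLp f p volume) (x : ℂ) :
    ‖kernelOp k f x‖ₑ ≤ eLpNorm f p volume * eLpNorm k p.conjExponent volume :=
  (enorm_integral_le_lintegral_enorm _).trans (hk.lintegral_enorm_mul_le hp1 hf x)

lemma IsDecaying.reflect {k : ℂ → ℂ} {C : ℝ} (hk : IsDecaying k C) :
    IsDecaying (fun ζ => k (-ζ)) C :=
  ⟨hk.measurable.comp measurable_neg, fun ζ => by simpa using hk.norm_le (-ζ)⟩

/-- The transpose of the operator with kernel `k(ζ)` has kernel `k(-ζ)`. -/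
lemma integral_mul_kernelOp {k : ℂ → ℂ} {C : ℝ} (hk : IsDecaying k C) {q : ℝ≥0∞} (hq1 : 1 ≤ q)
    (hq : q ≠ ∞) {f g : ℂ → ℂ} (hf : Integrable f) (hg : MemLp g q volume) :
    ∫ w, g w * kernelOp k f w = ∫ y, f y * kernelOp (fun ζ => k (-ζ)) g y := by
  have hkm : Measurable fun p : ℂ × ℂ => k (p.2 - p.1) := hk.measurable.comp (by fun_prop)
  have hm : AEStronglyMeasurable (fun p : ℂ × ℂ => g p.1 * (f p.2 * k (p.2 - p.1)))
      ((volume : Measure ℂ).prod volume) :=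
    hg.aestronglyMeasurable.comp_fst.mul
      (hf.aestronglyMeasurable.comp_snd.mul hkm.aestronglyMeasurable)
  have hint : Integrable (fun p : ℂ × ℂ => g p.1 * (f p.2 * k (p.2 - p.1)))
      ((volume : Measure ℂ).prod volume) := by
    refine ⟨hm, ?_⟩
    rw [HasFiniteIntegral, lintegral_prod_symm _ hm.enorm]
    set B := eLpNorm g q volume * eLpNorm (fun ζ => k (-ζ)) q.conjExponent volume with hB
    have hBfin : B ≠ ∞ := ENNReal.mul_ne_top hg.eLpNorm_ne_top
      (hk.reflect.memLp (one_lt_conjExponent hq)).eLpNorm_ne_top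
    calc ∫⁻ y, ∫⁻ w, ‖g w * (f y * k (y - w))‖ₑ
        = ∫⁻ y, ‖f y‖ₑ * ∫⁻ w, ‖g w * k (-(w - y))‖ₑ := by
          refine lintegral_congr fun y => ?_
          rw [← lintegral_const_mul' _ _ enorm_ne_top]
          refine lintegral_congr fun w => ?_
          rw [neg_sub, ← enorm_mul]
          congr 1; ring
      _ ≤ ∫⁻ y, ‖f y‖ₑ * B := by
          gcongr with y
          exact hk.reflect.lintegral_enorm_mul_le hq1 hg y
      _ = (∫⁻ y, ‖f y‖ₑ) * B := lintegral_mul_const' _ _ hBfin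
      _ < ∞ := ENNReal.mul_lt_top hf.hasFiniteIntegral hBfin.lt_top
  simp only [kernelOp, ← integral_const_mul]
  rw [integral_integral_swap hint]
  refine integral_congr_ae (Eventually.of_forall fun y => ?_)
  refine integral_congr_ae (Eventually.of_forall fun w => ?_)
  simp only [neg_sub]
  ring

lemma kernelOp_shift (k g : ℂ → ℂ) (x z : ℂ) :
    kernelOp k (fun w => g (w - z)) x = kernelOp k g (x - z) := by
  rw [kernelOp, kernelOp, ← integral_sub_right_eq_self (fun y => g y * k (y - (x - z))) z]
  congr 1; ext y
  rw [sub_sub_sub_cancel_right]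

/-- The value of `kernelOp k` at a point is continuous with respect to convergence in `L^p`. -/
lemma tendsto_kernelOp {k : ℂ → ℂ} {C : ℝ} (hk : IsDecaying k C) {p : ℝ≥0∞} (hp1 : 1 ≤ p)
    (hp : p ≠ ∞) {ι : Type*} {l : Filter ι} {g : ι → ℂ → ℂ} {f : ℂ → ℂ} (hf : MemLp f p volume)
    (hg : ∀ n, MemLp (g n) p volume)
    (h : Tendsto (fun n => eLpNorm (fun y => g n y - f y) p volume) l (𝓝 0)) (x : ℂ) :
    Tendsto (fun n => kernelOp k (g n) x) l (𝓝 (kernelOp k f x)) := by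
  rw [tendsto_iff_edist_tendsto_0]
  have hfin : eLpNorm k p.conjExponent volume ≠ ∞ :=
    (hk.memLp (one_lt_conjExponent hp)).eLpNorm_ne_top
  have h0 := ENNReal.Tendsto.mul_const h (b := eLpNorm k p.conjExponent volume) (Or.inr hfin)
  rw [zero_mul] at h0
  refine tendsto_of_tendsto_of_tendsto_of_le_of_le tendsto_const_nhds h0 (fun _ => zero_le) ?_
  intro n
  simp only
  rw [edist_eq_enorm_sub, ← kernelOp_sub hk hp1 hp hp1 hp (hg n) hf]
  exact enorm_kernelOp_le hk hp1 ((hg n).sub hf) x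

/-- `kernelOp k f` is continuous for `f ∈ L^p`: the kernel need only be continuous almost everywhere,
which covers kernels cut off at a circle. -/
lemma continuous_kernelOp {k : ℂ → ℂ} {C : ℝ} (hk : IsDecaying k C)
    (hc : ∀ᵐ ζ : ℂ, ContinuousAt k ζ) {p : ℝ≥0∞} (hp1 : 1 ≤ p)
    (hp : p ≠ ∞) {f : ℂ → ℂ} (hf : MemLp f p volume) : Continuous (kernelOp k f) := by
  rw [continuous_iff_continuousAt]
  intro x
  have hmaj : IsDecaying (fun ζ : ℂ => ((((1 + ‖ζ‖) ^ 2)⁻¹ : ℝ) : ℂ)) 1 := by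
    refine ⟨by fun_prop, fun ζ => ?_⟩
    rw [Complex.norm_real, Real.norm_of_nonneg (by positivity), one_mul]
  have hint := ((hmaj.integrable hp1 hp hf x).norm).const_mul (4 * C)
  refine continuousAt_of_dominated (bound := fun y =>
    4 * C * ‖f y * ((((1 + ‖y - x‖) ^ 2)⁻¹ : ℝ) : ℂ)‖) ?_ ?_ hint ?_
  · exact Eventually.of_forall fun z => (hk.integrable hp1 hp hf z).aestronglyMeasurable
  · filter_upwards [Metric.ball_mem_nhds x one_pos] with z hz
    refine Eventually.of_forall fun y => ?_
    rw [norm_mul, norm_mul, Complex.norm_real, Real.norm_of_nonneg (by positivity)]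
    have h1 := hk.norm_le (y - z)
    have hz' : ‖z - x‖ < 1 := by simpa [dist_eq_norm] using hz
    have h2 : 1 + ‖y - x‖ ≤ 2 * (1 + ‖y - z‖) := by
      have : ‖y - x‖ ≤ ‖y - z‖ + ‖z - x‖ := by
        simpa using norm_add_le (y - z) (z - x)
      linarith [norm_nonneg (y - z)]
    have h3 : ((1 + ‖y - z‖) ^ 2)⁻¹ ≤ 4 * ((1 + ‖y - x‖) ^ 2)⁻¹ := by
      rw [inv_le_iff_one_le_mul₀ (by positivity), mul_assoc, ← div_eq_inv_mul, mul_div_assoc',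
        le_div_iff₀ (by positivity)]
      nlinarith [norm_nonneg (y - x)]
    calc ‖f y‖ * ‖k (y - z)‖ ≤ ‖f y‖ * (C * (4 * ((1 + ‖y - x‖) ^ 2)⁻¹)) := by
          gcongr; exact h1.trans (by gcongr; exact hk.nonneg)
      _ = _ := by ring
  · have : ∀ᵐ y : ℂ, ContinuousAt k (y - x) :=
      (measurePreserving_sub_right volume x).quasiMeasurePreserving.ae hc
    filter_upwards [this] with y hy
    exact continuousAt_const.mul
      (ContinuousAt.comp_of_eq (g := k) hy (by fun_prop) rfl)

/-! ### Kernels of Calderón–Zygmund type and their truncations -/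

/-- A standard kernel on the plane: size `A |ζ|⁻²` and Lipschitz regularity
`A |ζ - ζ'| |ζ|⁻³` for `|ζ - ζ'| ≤ |ζ| / 2`. -/
structure IsStandardKernel (K : ℂ → ℂ) (A : ℝ) : Prop where
  measurable : Measurable K
  nonneg : 0 ≤ A
  norm_le : ∀ ζ, ζ ≠ 0 → ‖K ζ‖ ≤ A / ‖ζ‖ ^ 2
  norm_sub_le : ∀ ζ ζ', ζ ≠ 0 → ‖ζ - ζ'‖ ≤ ‖ζ‖ / 2 → ‖K ζ - K ζ'‖ ≤ A * ‖ζ - ζ'‖ / ‖ζ‖ ^ 3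

lemma IsStandardKernel.continuousAt {K : ℂ → ℂ} {A : ℝ} (hK : IsStandardKernel K A) {ζ : ℂ}
    (hζ : ζ ≠ 0) : ContinuousAt K ζ := by
  rw [ContinuousAt, tendsto_iff_norm_sub_tendsto_zero]
  have h0 : Tendsto (fun ζ' : ℂ => A * ‖ζ - ζ'‖ / ‖ζ‖ ^ 3) (𝓝 ζ) (𝓝 0) := by
    have : Continuous (fun ζ' : ℂ => A * ‖ζ - ζ'‖ / ‖ζ‖ ^ 3) := by fun_prop
    simpa using this.tendsto ζ
  refine squeeze_zero' (Eventually.of_forall fun _ => norm_nonneg _) ?_ h0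
  have hpos : 0 < ‖ζ‖ / 2 := by positivity
  filter_upwards [Metric.ball_mem_nhds ζ hpos] with ζ' h'
  rw [norm_sub_rev]
  refine hK.norm_sub_le ζ ζ' hζ ?_
  rw [norm_sub_rev]
  exact (by simpa [dist_eq_norm] using h' : ‖ζ' - ζ‖ < ‖ζ‖ / 2).le

lemma isDecaying_truncKernel_of_norm_le {K : ℂ → ℂ} {A ε : ℝ} (hm : Measurable K)
    (hA : ∀ ζ, ε < ‖ζ‖ → ‖K ζ‖ ≤ A / ‖ζ‖ ^ 2) (hA0 : 0 ≤ A) (hε : 0 < ε) :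
    IsDecaying (truncKernel K ε) (A * (1 + 1 / ε) ^ 2) where
  measurable := hm.indicator (measurableSet_lt measurable_const measurable_norm)
  norm_le ζ := by
    by_cases h : ε < ‖ζ‖
    · have hζ : 0 < ‖ζ‖ := hε.trans h
      have : truncKernel K ε ζ = K ζ := Set.indicator_of_mem (by exact h) _
      rw [this]
      refine (hA ζ h).trans ?_
      have h1 : 1 + ‖ζ‖ ≤ (1 + 1 / ε) * ‖ζ‖ := by
        have : 1 ≤ 1 / ε * ‖ζ‖ := by
          rw [one_div, ← div_eq_inv_mul, one_le_div hε]; exact h.le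
        linarith
      rw [← div_eq_mul_inv, div_le_div_iff₀ (by positivity) (by positivity), mul_assoc,
        ← mul_pow]
      gcongr
    · have : truncKernel K ε ζ = 0 := Set.indicator_of_notMem (by exact h) _
      rw [this, norm_zero]; positivity

lemma IsStandardKernel.isDecaying {K : ℂ → ℂ} {A : ℝ} (hK : IsStandardKernel K A) {ε : ℝ}
    (hε : 0 < ε) : IsDecaying (truncKernel K ε) (A * (1 + 1 / ε) ^ 2) :=
  isDecaying_truncKernel_of_norm_le hK.measurable
    (fun ζ h => hK.norm_le ζ (norm_pos_iff.1 (hε.trans h))) hK.nonneg hε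

lemma ae_norm_ne (ε : ℝ) : ∀ᵐ ζ : ℂ, ‖ζ‖ ≠ ε := by
  have := Measure.addHaar_sphere (volume : Measure ℂ) 0 ε
  refine measure_mono_null (fun ζ hζ => ?_) this
  simpa using hζ

lemma ae_norm_sub_ne (ε : ℝ) (x : ℂ) : ∀ᵐ y : ℂ, ‖y - x‖ ≠ ε :=
  (measurePreserving_sub_right volume x).quasiMeasurePreserving.ae (ae_norm_ne ε)

lemma IsStandardKernel.ae_continuousAt {K : ℂ → ℂ} {A : ℝ} (hK : IsStandardKernel K A) {ε : ℝ}
    (hε : 0 < ε) : ∀ᵐ ζ : ℂ, ContinuousAt (truncKernel K ε) ζ := by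
  filter_upwards [ae_norm_ne ε] with ζ hζ
  rcases lt_or_gt_of_ne hζ with h | h
  · have : truncKernel K ε =ᶠ[𝓝 ζ] fun _ => 0 := by
      filter_upwards [(isOpen_lt continuous_norm continuous_const).mem_nhds h] with y hy
      exact Set.indicator_of_notMem (by simpa using le_of_lt hy) _
    exact continuousAt_const.congr this.symm
  · have : truncKernel K ε =ᶠ[𝓝 ζ] K := by
      filter_upwards [(isOpen_lt continuous_const continuous_norm).mem_nhds h] with y hy
      exact Set.indicator_of_mem (by exact hy) _
    exact (hK.continuousAt (norm_pos_iff.1 (hε.trans h))).congr this.symm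

lemma IsStandardKernel.continuous_truncation {K : ℂ → ℂ} {A : ℝ} (hK : IsStandardKernel K A)
    {ε : ℝ} (hε : 0 < ε) {p : ℝ≥0∞} (hp1 : 1 ≤ p) (hp : p ≠ ∞) {f : ℂ → ℂ}
    (hf : MemLp f p volume) : Continuous (truncation K ε f) := by
  simp_rw [funext (truncation_eq_kernelOp K ε f)]
  exact continuous_kernelOp (hK.isDecaying hε) (hK.ae_continuousAt hε) hp1 hp hf

lemma IsStandardKernel.measurable_maximalSingular {K : ℂ → ℂ} {A : ℝ}
    (hK : IsStandardKernel K A) {p : ℝ≥0∞} (hp1 : 1 ≤ p) (hp : p ≠ ∞) {f : ℂ → ℂ}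
    (hf : MemLp f p volume) : Measurable (maximalSingular K f) := by
  refine LowerSemicontinuous.measurable ?_
  refine lowerSemicontinuous_iSup fun ε => lowerSemicontinuous_iSup fun hε => ?_
  exact ((hK.continuous_truncation hε hp1 hp hf).enorm).lowerSemicontinuous

lemma enorm_truncation_le_maximalSingular (K f : ℂ → ℂ) {ε : ℝ} (hε : 0 < ε) (x : ℂ) :
    ‖truncation K ε f x‖ₑ ≤ maximalSingular K f x :=
  le_iSup₂ (f := fun ε (_ : 0 < ε) => ‖truncation K ε f x‖ₑ) ε hε

lemma IsStandardKernel.truncation_add {K : ℂ → ℂ} {A : ℝ}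
    (hK : IsStandardKernel K A) {p q : ℝ≥0∞} (hp1 : 1 ≤ p)
    (hp : p ≠ ∞) (hq1 : 1 ≤ q) (hq : q ≠ ∞) {f g : ℂ → ℂ} (hf : MemLp f p volume)
    (hg : MemLp g q volume) {ε : ℝ} (hε : 0 < ε) (x : ℂ) :
    truncation K ε (fun y => f y + g y) x = truncation K ε f x + truncation K ε g x := by
  simp only [truncation_eq_kernelOp]
  exact kernelOp_add (hK.isDecaying hε) hp1 hp hq1 hq hf hg x

lemma IsStandardKernel.truncation_sub {K : ℂ → ℂ} {A : ℝ}
    (hK : IsStandardKernel K A) {p q : ℝ≥0∞} (hp1 : 1 ≤ p)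
    (hp : p ≠ ∞) (hq1 : 1 ≤ q) (hq : q ≠ ∞) {f g : ℂ → ℂ} (hf : MemLp f p volume)
    (hg : MemLp g q volume) {ε : ℝ} (hε : 0 < ε) (x : ℂ) :
    truncation K ε (fun y => f y - g y) x = truncation K ε f x - truncation K ε g x := by
  simp only [truncation_eq_kernelOp]
  exact kernelOp_sub (hK.isDecaying hε) hp1 hp hq1 hq hf hg x

lemma IsStandardKernel.maximalSingular_add_le {K : ℂ → ℂ} {A : ℝ}
    (hK : IsStandardKernel K A) {p q : ℝ≥0∞} (hp1 : 1 ≤ p)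
    (hp : p ≠ ∞) (hq1 : 1 ≤ q) (hq : q ≠ ∞) {f g : ℂ → ℂ} (hf : MemLp f p volume)
    (hg : MemLp g q volume) (x : ℂ) :
    maximalSingular K (fun y => f y + g y) x ≤ maximalSingular K f x + maximalSingular K g x := by
  refine iSup₂_le fun ε hε => ?_
  rw [hK.truncation_add hp1 hp hq1 hq hf hg hε]
  exact (enorm_add_le _ _).trans (add_le_add (enorm_truncation_le_maximalSingular K f hε x)
    (enorm_truncation_le_maximalSingular K g hε x))

/-- The maximal operator is lower semicontinuous along sequences converging in `L^p`. -/
lemma IsStandardKernel.maximalSingular_le_liminf {K : ℂ → ℂ} {A : ℝ}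
    (hK : IsStandardKernel K A) {p : ℝ≥0∞} (hp1 : 1 ≤ p) (hp : p ≠ ∞) {f : ℂ → ℂ}
    {g : ℕ → ℂ → ℂ} (hf : MemLp f p volume) (hg : ∀ n, MemLp (g n) p volume)
    (h : Tendsto (fun n => eLpNorm (fun y => g n y - f y) p volume) atTop (𝓝 0)) (x : ℂ) :
    maximalSingular K f x ≤ liminf (fun n => maximalSingular K (g n) x) atTop := by
  refine iSup₂_le fun ε hε => ?_
  have h1 := (tendsto_kernelOp (hK.isDecaying hε) hp1 hp hf hg h x).enorm
  simp only [← truncation_eq_kernelOp] at h1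
  rw [← h1.liminf_eq]
  exact liminf_le_liminf (Eventually.of_forall fun n =>
    enorm_truncation_le_maximalSingular K (g n) hε x)

lemma norm_comparable_of_near {ζ ζ' : ℂ} (hζ : ζ ≠ 0) (h : ‖ζ - ζ'‖ ≤ ‖ζ‖ / 2) :
    ‖ζ‖ / 2 ≤ ‖ζ'‖ ∧ ‖ζ'‖ ≤ 2 * ‖ζ‖ ∧ ζ' ≠ 0 := by
  have h1 : ‖ζ‖ ≤ ‖ζ - ζ'‖ + ‖ζ'‖ := by simpa using norm_add_le (ζ - ζ') ζ'
  have h2 : ‖ζ'‖ ≤ ‖ζ - ζ'‖ + ‖ζ‖ := by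
    simpa [norm_sub_rev] using norm_add_le (ζ' - ζ) ζ
  have hpos : 0 < ‖ζ‖ := norm_pos_iff.2 hζ
  exact ⟨by linarith, by linarith, norm_pos_iff.1 (by linarith)⟩

/-- The constants `12` and `120 π`, here and for `B²`, are not sharp. -/
lemma isStandardKernel_beurlingKernel : IsStandardKernel beurlingKernel 12 where
  measurable := by unfold beurlingKernel; fun_prop
  nonneg := by norm_num
  norm_le ζ hζ := by
    rw [beurlingKernel, norm_div, norm_pow, norm_one]
    gcongr; norm_num
  norm_sub_le ζ ζ' hζ h := by
    obtain ⟨h1, h2, h3⟩ := norm_comparable_of_near hζ h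
    have hpos : 0 < ‖ζ‖ := norm_pos_iff.2 hζ
    have hpos' : 0 < ‖ζ'‖ := norm_pos_iff.2 h3
    have e : beurlingKernel ζ - beurlingKernel ζ' = -((ζ - ζ') * (ζ + ζ')) / (ζ ^ 2 * ζ' ^ 2) := by
      unfold beurlingKernel; field_simp; ring
    rw [e, norm_div, norm_neg, norm_mul, norm_mul, norm_pow, norm_pow,
      div_le_div_iff₀ (by positivity) (by positivity)]
    have h4 : ‖ζ + ζ'‖ ≤ 3 * ‖ζ‖ := (norm_add_le _ _).trans (by linarith)
    have h5 : ‖ζ‖ ^ 2 ≤ 4 * ‖ζ'‖ ^ 2 := by nlinarith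
    calc ‖ζ - ζ'‖ * ‖ζ + ζ'‖ * ‖ζ‖ ^ 3 ≤ ‖ζ - ζ'‖ * (3 * ‖ζ‖) * ‖ζ‖ ^ 3 := by gcongr
      _ = 3 * ‖ζ - ζ'‖ * ‖ζ‖ ^ 2 * ‖ζ‖ ^ 2 := by ring
      _ ≤ 3 * ‖ζ - ζ'‖ * ‖ζ‖ ^ 2 * (4 * ‖ζ'‖ ^ 2) := by gcongr
      _ = _ := by ring

lemma isStandardKernel_beurlingSqKernel : IsStandardKernel beurlingSqKernel (120 * Real.pi) where
  measurable := by
    unfold beurlingSqKernel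
    have := Complex.continuous_conj.measurable
    fun_prop
  nonneg := by positivity
  norm_le ζ hζ := by
    have hpos : 0 < ‖ζ‖ := norm_pos_iff.2 hζ
    rw [beurlingSqKernel, norm_div, norm_mul, norm_mul, norm_pow, Complex.norm_real,
      RCLike.norm_conj, div_le_div_iff₀ (by positivity) (by positivity),
      Real.norm_of_nonneg Real.pi_pos.le]
    have : (0 : ℝ) < Real.pi * ‖ζ‖ ^ 3 := by positivity
    simp only [Complex.norm_ofNat]
    nlinarith
  norm_sub_le ζ ζ' hζ h := by
    obtain ⟨h1, h2, h3⟩ := norm_comparable_of_near hζ h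
    have hpos : 0 < ‖ζ‖ := norm_pos_iff.2 hζ
    have hpos' : 0 < ‖ζ'‖ := norm_pos_iff.2 h3
    have e : beurlingSqKernel ζ - beurlingSqKernel ζ' = 2 * Real.pi *
        (starRingEnd ℂ (ζ - ζ') * ζ' ^ 3
          - starRingEnd ℂ ζ' * (ζ - ζ') * (ζ ^ 2 + ζ * ζ' + ζ' ^ 2)) / (ζ ^ 3 * ζ' ^ 3) := by
      unfold beurlingSqKernel; rw [map_sub]; field_simp; ring
    rw [e, norm_div, norm_mul, norm_mul, norm_mul, norm_pow, norm_pow, Complex.norm_real,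
      div_le_div_iff₀ (by positivity) (by positivity), Real.norm_of_nonneg Real.pi_pos.le]
    simp only [Complex.norm_ofNat]
    have h5 : ‖starRingEnd ℂ (ζ - ζ') * ζ' ^ 3
          - starRingEnd ℂ ζ' * (ζ - ζ') * (ζ ^ 2 + ζ * ζ' + ζ' ^ 2)‖ ≤
          ‖ζ - ζ'‖ * (12 * ‖ζ'‖ ^ 3) := by
      have hq : ‖ζ ^ 2 + ζ * ζ' + ζ' ^ 2‖ ≤ 7 * ‖ζ'‖ ^ 2 := by
        refine norm_add₃_le.trans ?_
        rw [norm_pow, norm_pow, norm_mul]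
        nlinarith
      refine (norm_sub_le _ _).trans ?_
      rw [norm_mul, norm_mul, norm_mul, RCLike.norm_conj, RCLike.norm_conj, norm_pow]
      have : ‖ζ'‖ * ‖ζ - ζ'‖ * ‖ζ ^ 2 + ζ * ζ' + ζ' ^ 2‖ ≤
          ‖ζ'‖ * ‖ζ - ζ'‖ * (7 * ‖ζ'‖ ^ 2) := by gcongr
      have h0 : 0 ≤ ‖ζ - ζ'‖ * ‖ζ'‖ ^ 3 := by positivity
      nlinarith
    calc _ ≤ 2 * Real.pi * (‖ζ - ζ'‖ * (12 * ‖ζ'‖ ^ 3)) * ‖ζ‖ ^ 3 := by gcongr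
      _ = 24 * (Real.pi * ‖ζ - ζ'‖ * (‖ζ‖ ^ 3 * ‖ζ'‖ ^ 3)) := by ring
      _ ≤ 120 * (Real.pi * ‖ζ - ζ'‖ * (‖ζ‖ ^ 3 * ‖ζ'‖ ^ 3)) := by gcongr; norm_num
      _ = _ := by ring

/-! ### Layer-cake estimates -/

lemma lintegral_Ioo_rpow {b s : ℝ} (hb : 0 ≤ b) (hs : -1 < s) :
    ∫⁻ t in Set.Ioo 0 b, ENNReal.ofReal (t ^ s) = ENNReal.ofReal (b ^ (s + 1) / (s + 1)) := by
  have hi : IntegrableOn (fun t : ℝ => t ^ s) (Set.Ioo 0 b) := by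
    rw [← integrableOn_Ioc_iff_integrableOn_Ioo, ← intervalIntegrable_iff_integrableOn_Ioc_of_le hb]
    exact intervalIntegral.intervalIntegrable_rpow' hs
  rw [← ofReal_integral_eq_lintegral_ofReal hi, ← integral_Ioc_eq_integral_Ioo,
    ← intervalIntegral.integral_of_le hb, integral_rpow (Or.inl hs),
    Real.zero_rpow (by linarith), sub_zero]
  exact (ae_restrict_iff' measurableSet_Ioo).2
    (Eventually.of_forall fun t ht => Real.rpow_nonneg ht.1.le _)

lemma lintegral_Ioi_rpow {b s : ℝ} (hb : 0 < b) (hs : s < -1) :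
    ∫⁻ t in Set.Ioi b, ENNReal.ofReal (t ^ s) = ENNReal.ofReal (b ^ (s + 1) / (-(s + 1))) := by
  rw [← ofReal_integral_eq_lintegral_ofReal (integrableOn_Ioi_rpow_of_lt hs hb),
    integral_Ioi_rpow_of_lt hs hb, neg_div, div_neg]
  exact (ae_restrict_iff' measurableSet_Ioi).2
    (Eventually.of_forall fun t ht => Real.rpow_nonneg (hb.trans ht).le _)

/-- The layer-cake formula `a ^ p = ∫_{0 < t < a} p t ^ (p - 1) dt`, as an inequality so that `a = ∞`
needs no separate treatment. -/
lemma rpow_le_lintegral_indicator (a : ℝ≥0∞) {p : ℝ} (hp : 0 < p) :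
    a ^ p ≤ ∫⁻ t in Set.Ioi (0 : ℝ), {t : ℝ | ENNReal.ofReal t < a}.indicator
      (fun t => ENNReal.ofReal p * ENNReal.ofReal (t ^ (p - 1))) t := by
  refine ENNReal.le_of_forall_nnreal_lt fun r hr => ?_
  set b : ℝ≥0 := r ^ (1 / p) with hb
  have hba : (b : ℝ≥0∞) ≤ a := by
    have := ENNReal.rpow_le_rpow hr.le (z := 1 / p) (by positivity)
    rw [← ENNReal.rpow_mul, mul_one_div_cancel hp.ne', ENNReal.rpow_one] at this
    rwa [hb, ENNReal.coe_rpow_of_nonneg _ (by positivity)]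
  have hbp : (b : ℝ) ^ p = r := by
    rw [hb, NNReal.coe_rpow, ← Real.rpow_mul (NNReal.coe_nonneg r), one_div_mul_cancel hp.ne', Real.rpow_one]
  calc (r : ℝ≥0∞) = ENNReal.ofReal ((b : ℝ) ^ p) := by rw [hbp, ENNReal.ofReal_coe_nnreal]
    _ = ENNReal.ofReal p * ∫⁻ t in Set.Ioo 0 (b : ℝ), ENNReal.ofReal (t ^ (p - 1)) := by
        rw [lintegral_Ioo_rpow (NNReal.coe_nonneg b) (by linarith), ← ENNReal.ofReal_mul hp.le, sub_add_cancel,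
          mul_div_cancel₀ _ hp.ne']
    _ = ∫⁻ t in Set.Ioo 0 (b : ℝ), ENNReal.ofReal p * ENNReal.ofReal (t ^ (p - 1)) := by
        rw [lintegral_const_mul' _ _ ENNReal.ofReal_ne_top]
    _ ≤ ∫⁻ t in Set.Ioo 0 (b : ℝ), {t : ℝ | ENNReal.ofReal t < a}.indicator
      (fun t => ENNReal.ofReal p * ENNReal.ofReal (t ^ (p - 1))) t := by
        refine setLIntegral_mono' measurableSet_Ioo fun t ht => ?_
        rw [Set.indicator_of_mem]
        refine lt_of_lt_of_le ?_ hba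
        rw [← ENNReal.ofReal_coe_nnreal, ENNReal.ofReal_lt_ofReal_iff (ht.1.trans ht.2)]
        exact ht.2
    _ ≤ _ := lintegral_mono_set fun t ht => ht.1

section

variable {α : Type*} [MeasurableSpace α] {μ : Measure α} [SFinite μ]

lemma lintegral_rpow_le_lintegral_distribution {F : α → ℝ≥0∞} (hF : Measurable F) {p : ℝ}
    (hp : 0 < p) : ∫⁻ z, F z ^ p ∂μ ≤ ∫⁻ t in Set.Ioi (0 : ℝ),
      ENNReal.ofReal p * ENNReal.ofReal (t ^ (p - 1)) * μ {z | ENNReal.ofReal t < F z} := by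
  have hS : MeasurableSet {q : α × ℝ | ENNReal.ofReal q.2 < F q.1} :=
    measurableSet_lt (by fun_prop) (by fun_prop)
  have hmeas : Measurable ({q : α × ℝ | ENNReal.ofReal q.2 < F q.1}.indicator
      (fun q => ENNReal.ofReal p * ENNReal.ofReal (q.2 ^ (p - 1)))) :=
    Measurable.indicator (by fun_prop) hS
  calc ∫⁻ z, F z ^ p ∂μ
      ≤ ∫⁻ z, (∫⁻ t in Set.Ioi (0 : ℝ), {t : ℝ | ENNReal.ofReal t < F z}.indicator
        (fun t => ENNReal.ofReal p * ENNReal.ofReal (t ^ (p - 1))) t) ∂μ :=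
        lintegral_mono fun z => rpow_le_lintegral_indicator (F z) hp
    _ = ∫⁻ t in Set.Ioi (0 : ℝ), ∫⁻ z, {q : α × ℝ | ENNReal.ofReal q.2 < F q.1}.indicator
        (fun q => ENNReal.ofReal p * ENNReal.ofReal (q.2 ^ (p - 1))) (z, t) ∂μ := by
        rw [← lintegral_lintegral_swap]
        · rfl
        · exact (hmeas.comp measurable_swap).aemeasurable
    _ = _ := by
        refine lintegral_congr fun t => ?_
        have : (fun z => {q : α × ℝ | ENNReal.ofReal q.2 < F q.1}.indicator
            (fun q => ENNReal.ofReal p * ENNReal.ofReal (q.2 ^ (p - 1))) (z, t)) =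
            {z | ENNReal.ofReal t < F z}.indicator
              fun _ => ENNReal.ofReal p * ENNReal.ofReal (t ^ (p - 1)) := rfl
        rw [this, lintegral_indicator_const (measurableSet_lt measurable_const hF)]

/-- The contribution of the large values `φ > t / 2` in Marcinkiewicz interpolation, where the weak
type (1,1) bound is used at height `t`. -/
lemma lintegral_layer_above {φ : α → ℝ≥0} (hφ : Measurable φ) {p : ℝ} (hp : 1 < p)
    (C : ℝ≥0∞) : ∫⁻ t in Set.Ioi (0 : ℝ), ENNReal.ofReal p * ENNReal.ofReal (t ^ (p - 1)) *
      (C / ENNReal.ofReal t * ∫⁻ z in {z | t < 2 * φ z}, φ z ∂μ) ≤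
    C * ENNReal.ofReal (p * 2 ^ (p - 1) / (p - 1)) * ∫⁻ z, (φ z : ℝ≥0∞) ^ p ∂μ := by
  have hS : MeasurableSet {q : α × ℝ | q.2 < 2 * φ q.1} :=
    measurableSet_lt (by fun_prop) (by fun_prop)
  have hmeas : Measurable ({q : α × ℝ | q.2 < 2 * φ q.1}.indicator
      (fun q => (φ q.1 : ℝ≥0∞) * ENNReal.ofReal (q.2 ^ (p - 2)))) :=
    Measurable.indicator (by fun_prop) hS
  calc _ = ∫⁻ t in Set.Ioi (0 : ℝ), C * ENNReal.ofReal p * ∫⁻ z,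
          {q : α × ℝ | q.2 < 2 * φ q.1}.indicator
          (fun q => φ q.1 * ENNReal.ofReal (q.2 ^ (p - 2))) (z, t) ∂μ := by
        refine setLIntegral_congr_fun measurableSet_Ioi fun t ht => ?_
        have ht' : (0 : ℝ) < t := ht
        have e : (fun z => {q : α × ℝ | q.2 < 2 * φ q.1}.indicator
          (fun q => (φ q.1 : ℝ≥0∞) * ENNReal.ofReal (q.2 ^ (p - 2))) (z, t)) =
          {z | t < 2 * φ z}.indicator
            fun z => (φ z : ℝ≥0∞) * ENNReal.ofReal (t ^ (p - 2)) := rfl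
        rw [e, lintegral_indicator (measurableSet_lt measurable_const (by fun_prop)),
          lintegral_mul_const' _ _ ENNReal.ofReal_ne_top]
        have e2 : ENNReal.ofReal (t ^ (p - 1)) / ENNReal.ofReal t = ENNReal.ofReal (t ^ (p - 2)) := by
          rw [← ENNReal.ofReal_div_of_pos ht']
          congr 1
          rw [show p - 2 = p - 1 - 1 by ring, Real.rpow_sub_one ht'.ne' (p - 1)]
        rw [← e2, div_eq_mul_inv, div_eq_mul_inv]
        ring
    _ ≤ C * ENNReal.ofReal p * ∫⁻ t in Set.Ioi (0 : ℝ), ∫⁻ z,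
          {q : α × ℝ | q.2 < 2 * φ q.1}.indicator
          (fun q => φ q.1 * ENNReal.ofReal (q.2 ^ (p - 2))) (z, t) ∂μ := by
        rw [lintegral_const_mul]
        refine Measurable.lintegral_prod_left' (f := {q : α × ℝ | q.2 < 2 * φ q.1}.indicator
          (fun q => φ q.1 * ENNReal.ofReal (q.2 ^ (p - 2)))) ?_
        exact Measurable.indicator (by fun_prop) hS
    _ = C * ENNReal.ofReal p * ∫⁻ z, (∫⁻ t in Set.Ioi (0 : ℝ),
          {q : α × ℝ | q.2 < 2 * φ q.1}.indicator
          (fun q => φ q.1 * ENNReal.ofReal (q.2 ^ (p - 2))) (z, t)) ∂μ := by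
        rw [lintegral_lintegral_swap]
        exact (hmeas.comp measurable_swap).aemeasurable
    _ = C * ENNReal.ofReal p * ∫⁻ z, ENNReal.ofReal (2 ^ (p - 1) / (p - 1)) *
          (φ z : ℝ≥0∞) ^ p ∂μ := by
        congr 2; ext z
        have e : (fun t => {q : α × ℝ | q.2 < 2 * φ q.1}.indicator
          (fun q => (φ q.1 : ℝ≥0∞) * ENNReal.ofReal (q.2 ^ (p - 2))) (z, t)) =
          (Set.Iio (2 * (φ z : ℝ))).indicator
            fun t => (φ z : ℝ≥0∞) * ENNReal.ofReal (t ^ (p - 2)) := rfl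
        have hφ0 : (0 : ℝ) ≤ φ z := (φ z).2
        rw [e, setLIntegral_indicator measurableSet_Iio, Set.inter_comm, Set.Ioi_inter_Iio,
          lintegral_const_mul' _ _ ENNReal.coe_ne_top, lintegral_Ioo_rpow (by positivity)
          (by linarith), ← ENNReal.ofReal_coe_nnreal, ENNReal.ofReal_rpow_of_nonneg hφ0
          (by linarith), ← ENNReal.ofReal_mul hφ0, ← ENNReal.ofReal_mul
          (div_nonneg (by positivity) (by linarith))]
        congr 1
        rw [show p - 2 + 1 = p - 1 by ring, Real.mul_rpow (by norm_num) hφ0,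
          show (φ z : ℝ) ^ p = φ z ^ (1 + (p - 1)) by ring_nf,
          Real.rpow_add_of_nonneg hφ0 (by norm_num) (by linarith), Real.rpow_one]
        ring
    _ = _ := by
        rw [lintegral_const_mul' _ _ ENNReal.ofReal_ne_top, ← mul_assoc, mul_assoc C,
          ← ENNReal.ofReal_mul (by linarith), mul_div_assoc]

/-- The contribution of the small values `φ ≤ t / 2` in Marcinkiewicz interpolation, where the `L²`
bound is used at height `t`. -/
lemma lintegral_layer_below {φ : α → ℝ≥0} (hφ : Measurable φ) {p : ℝ} (hp : 1 < p) (hp2 : p < 2)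
    (C : ℝ≥0∞) : ∫⁻ t in Set.Ioi (0 : ℝ), ENNReal.ofReal p * ENNReal.ofReal (t ^ (p - 1)) *
      (C / ENNReal.ofReal t ^ 2 * ∫⁻ z in {z | 2 * φ z ≤ t}, (φ z : ℝ≥0∞) ^ 2 ∂μ) ≤
    C * ENNReal.ofReal (p * 2 ^ (p - 2) / (2 - p)) * ∫⁻ z, (φ z : ℝ≥0∞) ^ p ∂μ := by
  have hS : MeasurableSet {q : α × ℝ | 2 * φ q.1 ≤ q.2} :=
    measurableSet_le (by fun_prop) (by fun_prop)
  have hmeas : Measurable ({q : α × ℝ | 2 * φ q.1 ≤ q.2}.indicator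
      (fun q => (φ q.1 : ℝ≥0∞) ^ 2 * ENNReal.ofReal (q.2 ^ (p - 3)))) :=
    Measurable.indicator (by fun_prop) hS
  calc _ = ∫⁻ t in Set.Ioi (0 : ℝ), C * ENNReal.ofReal p * ∫⁻ z,
          {q : α × ℝ | 2 * φ q.1 ≤ q.2}.indicator
          (fun q => (φ q.1 : ℝ≥0∞) ^ 2 * ENNReal.ofReal (q.2 ^ (p - 3))) (z, t) ∂μ := by
        refine setLIntegral_congr_fun measurableSet_Ioi fun t ht => ?_
        have ht' : (0 : ℝ) < t := ht
        have e : (fun z => {q : α × ℝ | 2 * φ q.1 ≤ q.2}.indicator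
          (fun q => (φ q.1 : ℝ≥0∞) ^ 2 * ENNReal.ofReal (q.2 ^ (p - 3))) (z, t)) =
          {z | 2 * φ z ≤ t}.indicator
            fun z => (φ z : ℝ≥0∞) ^ 2 * ENNReal.ofReal (t ^ (p - 3)) := rfl
        rw [e, lintegral_indicator (measurableSet_le (by fun_prop) measurable_const),
          lintegral_mul_const' _ _ ENNReal.ofReal_ne_top]
        have e2 : ENNReal.ofReal (t ^ (p - 1)) / ENNReal.ofReal t ^ 2 =
            ENNReal.ofReal (t ^ (p - 3)) := by
          rw [← ENNReal.ofReal_pow ht'.le, ← ENNReal.ofReal_div_of_pos (by positivity)]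
          congr 1
          rw [show p - 3 = p - 1 - (2 : ℕ) by push_cast; ring, Real.rpow_sub_natCast ht'.ne']
        rw [← e2, div_eq_mul_inv, div_eq_mul_inv]
        ring
    _ ≤ C * ENNReal.ofReal p * ∫⁻ t in Set.Ioi (0 : ℝ), ∫⁻ z,
          {q : α × ℝ | 2 * φ q.1 ≤ q.2}.indicator
          (fun q => (φ q.1 : ℝ≥0∞) ^ 2 * ENNReal.ofReal (q.2 ^ (p - 3))) (z, t) ∂μ := by
        rw [lintegral_const_mul]
        refine Measurable.lintegral_prod_left' (f := {q : α × ℝ | 2 * φ q.1 ≤ q.2}.indicator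
          (fun q => (φ q.1 : ℝ≥0∞) ^ 2 * ENNReal.ofReal (q.2 ^ (p - 3)))) ?_
        exact Measurable.indicator (by fun_prop) hS
    _ = C * ENNReal.ofReal p * ∫⁻ z, (∫⁻ t in Set.Ioi (0 : ℝ),
          {q : α × ℝ | 2 * φ q.1 ≤ q.2}.indicator
          (fun q => (φ q.1 : ℝ≥0∞) ^ 2 * ENNReal.ofReal (q.2 ^ (p - 3))) (z, t)) ∂μ := by
        rw [lintegral_lintegral_swap]
        exact (hmeas.comp measurable_swap).aemeasurable
    _ ≤ C * ENNReal.ofReal p * ∫⁻ z, ENNReal.ofReal (2 ^ (p - 2) / (2 - p)) *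
          (φ z : ℝ≥0∞) ^ p ∂μ := by
        gcongr with z
        have e : (fun t => {q : α × ℝ | 2 * φ q.1 ≤ q.2}.indicator
          (fun q => (φ q.1 : ℝ≥0∞) ^ 2 * ENNReal.ofReal (q.2 ^ (p - 3))) (z, t)) =
          (Set.Ici (2 * (φ z : ℝ))).indicator
            fun t => (φ z : ℝ≥0∞) ^ 2 * ENNReal.ofReal (t ^ (p - 3)) := rfl
        rcases eq_or_ne (φ z) 0 with h0 | h0
        · rw [e]; simp [h0]
        have hφ0 : (0 : ℝ) < φ z := by positivity
        have hsub : Set.Ici (2 * (φ z : ℝ)) ∩ Set.Ioi 0 ⊆ Set.Ici (2 * (φ z : ℝ)) :=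
          Set.inter_subset_left
        rw [e, setLIntegral_indicator measurableSet_Ici]
        refine (lintegral_mono_set hsub).trans ?_
        rw [← setLIntegral_congr Ioi_ae_eq_Ici,
          lintegral_const_mul' _ _ (by simp), lintegral_Ioi_rpow (by positivity)
          (by linarith), ← ENNReal.ofReal_coe_nnreal, ENNReal.ofReal_rpow_of_pos hφ0,
          ← ENNReal.ofReal_pow hφ0.le, ← ENNReal.ofReal_mul (by positivity), ← ENNReal.ofReal_mul
          (div_nonneg (by positivity) (by linarith))]
        apply ENNReal.ofReal_le_ofReal
        rw [show p - 3 + 1 = p - 2 by ring, Real.mul_rpow (by norm_num) hφ0.le,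
          show -(p - 2) = 2 - p by ring,
          show (φ z : ℝ) ^ p = φ z ^ ((2 : ℕ) + (p - 2)) by push_cast; ring_nf,
          Real.rpow_add hφ0, Real.rpow_natCast]
        apply le_of_eq
        ring
    _ = _ := by
        rw [lintegral_const_mul' _ _ ENNReal.ofReal_ne_top, ← mul_assoc, mul_assoc C,
          ← ENNReal.ofReal_mul (by linarith), mul_div_assoc]

end

/-! ### The uncentred Hardy–Littlewood maximal function -/

/-- The uncentred Hardy–Littlewood maximal function over discs, of a density with values in
`[0, ∞]`. -/
noncomputable def maximalFn (φ : ℂ → ℝ≥0∞) (z : ℂ) : ℝ≥0∞ :=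
  ⨆ (c : ℂ) (r : ℝ) (_ : z ∈ Metric.ball c r),
    (volume (Metric.ball c r))⁻¹ * ∫⁻ w in Metric.ball c r, φ w

lemma le_maximalFn (φ : ℂ → ℝ≥0∞) {z c : ℂ} {r : ℝ} (h : z ∈ Metric.ball c r) :
    (volume (Metric.ball c r))⁻¹ * ∫⁻ w in Metric.ball c r, φ w ≤ maximalFn φ z :=
  le_iSup_of_le c (le_iSup_of_le r (le_iSup_of_le h le_rfl))

lemma lintegral_ball_le_maximalFn (φ : ℂ → ℝ≥0∞) {z c : ℂ} {r : ℝ} (h : z ∈ Metric.ball c r) :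
    ∫⁻ w in Metric.ball c r, φ w ≤ volume (Metric.ball c r) * maximalFn φ z := by
  have hr : 0 < r := dist_nonneg.trans_lt h
  have h0 : volume (Metric.ball c r) ≠ 0 := (Metric.measure_ball_pos volume c hr).ne'
  have h1 : volume (Metric.ball c r) ≠ ∞ := measure_ball_lt_top.ne
  refine le_trans ?_ (mul_le_mul_right (le_maximalFn φ h) _)
  rw [← mul_assoc, ENNReal.mul_inv_cancel h0 h1, one_mul]

lemma hardyLittlewood_le_maximalFn (f : ℂ → ℂ) (z : ℂ) :
    hardyLittlewood f z ≤ maximalFn (fun w => ‖f w‖ₑ) z :=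
  iSup₂_le fun _ hr => le_maximalFn _ (Metric.mem_ball_self hr)

lemma lowerSemicontinuous_maximalFn (φ : ℂ → ℝ≥0∞) : LowerSemicontinuous (maximalFn φ) := by
  intro z a ha
  simp only [maximalFn, lt_iSup_iff] at ha
  obtain ⟨c, r, hz, h⟩ := ha
  filter_upwards [Metric.isOpen_ball.mem_nhds hz] with y hy
  exact h.trans_le (le_maximalFn φ hy)

lemma measurable_maximalFn (φ : ℂ → ℝ≥0∞) : Measurable (maximalFn φ) :=
  (lowerSemicontinuous_maximalFn φ).measurable

lemma maximalFn_mono_ae {φ ψ : ℂ → ℝ≥0∞} (h : φ ≤ᵐ[volume] ψ) (z : ℂ) :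
    maximalFn φ z ≤ maximalFn ψ z := by
  refine iSup_le fun c => iSup_le fun r => iSup_le fun hz => le_trans ?_ (le_maximalFn ψ hz)
  exact mul_le_mul_right (lintegral_mono_ae (ae_restrict_of_ae h)) _

lemma maximalFn_add_const_le (φ : ℂ → ℝ≥0∞) (a : ℝ≥0∞) (z : ℂ) :
    maximalFn (fun w => φ w + a) z ≤ maximalFn φ z + a := by
  refine iSup_le fun c => iSup_le fun r => iSup_le fun hz => ?_
  have hr : 0 < r := dist_nonneg.trans_lt hz
  have h0 : volume (Metric.ball c r) ≠ 0 := (Metric.measure_ball_pos volume c hr).ne'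
  have h1 : volume (Metric.ball c r) ≠ ∞ := measure_ball_lt_top.ne
  rw [lintegral_add_right _ measurable_const, mul_add, setLIntegral_const, mul_comm a, ← mul_assoc,
    ENNReal.inv_mul_cancel h0 h1, one_mul]
  gcongr
  exact le_maximalFn φ hz

lemma volume_ball_mul (c : ℂ) {r : ℝ} {τ : ℝ} (hτ : 0 ≤ τ) :
    volume (Metric.ball c (τ * r)) = ENNReal.ofReal τ ^ 2 * volume (Metric.ball c r) := by
  rw [Complex.volume_ball, Complex.volume_ball, ENNReal.ofReal_mul hτ, mul_pow, mul_assoc]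

/-- The weak type (1,1) inequality for the maximal function, by the Vitali covering lemma. -/
lemma volume_lt_maximalFn_le (φ : ℂ → ℝ≥0∞) {t : ℝ≥0∞} (ht0 : t ≠ 0) (ht : t ≠ ∞) :
    volume {z | t < maximalFn φ z} ≤ 16 / t * ∫⁻ w, φ w := by
  rcases eq_or_ne (∫⁻ w, φ w) ∞ with hI | hI
  · rw [hI, ENNReal.mul_top (ENNReal.div_ne_zero.2 ⟨by norm_num, ht⟩)]; exact le_top
  set T : Set (ℂ × ℝ) := {q | 0 < q.2 ∧
    t * volume (Metric.ball q.1 q.2) < ∫⁻ w in Metric.ball q.1 q.2, φ w} with hT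
  have hbd : ∀ q ∈ T, q.2 ≤ ((∫⁻ w, φ w) / t).toReal + 1 := by
    rintro ⟨c, r⟩ ⟨hr, hq⟩
    by_contra! hlt
    simp only at hr hq hlt
    have hx : 0 ≤ ((∫⁻ w, φ w) / t).toReal := ENNReal.toReal_nonneg
    have h1 : volume (Metric.ball c r) ≤ (∫⁻ w, φ w) / t := by
      rw [ENNReal.le_div_iff_mul_le (Or.inl ht0) (Or.inl ht), mul_comm]
      exact hq.le.trans (setLIntegral_le_lintegral _ _)
    have h2 : volume (Metric.ball c r) ≥ ENNReal.ofReal r := by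
      rw [Complex.volume_ball, sq, mul_assoc]
      refine le_mul_of_one_le_right' (one_le_mul ?_ ?_)
      · rw [ENNReal.one_le_ofReal]; linarith
      · have : (1 : ℝ≥0) ≤ NNReal.pi := by
          rw [← NNReal.coe_le_coe]; simpa using (by linarith [Real.pi_gt_three] : (1:ℝ) ≤ Real.pi)
        exact_mod_cast this
    have h3 := h2.le.trans h1
    rw [ENNReal.ofReal_le_iff_le_toReal (ENNReal.div_ne_top hI ht0)] at h3
    linarith
  obtain ⟨u, huT, hdisj, hcov⟩ := Vitali.exists_disjoint_subfamily_covering_enlargement_closedBall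
    T (fun q => q.1) (fun q => q.2) _ hbd (7 / 2) (by norm_num)
  have hdisj' : u.PairwiseDisjoint fun q : ℂ × ℝ => Metric.ball q.1 q.2 :=
    hdisj.mono_on fun q _ => Metric.ball_subset_closedBall
  have hcount : u.Countable := hdisj'.countable_of_isOpen (fun _ _ => Metric.isOpen_ball)
    fun q hq => ⟨q.1, Metric.mem_ball_self (huT hq).1⟩
  have hsub : {z | t < maximalFn φ z} ⊆ ⋃ q ∈ u, Metric.ball q.1 (4 * q.2) := by
    intro z hz
    simp only [maximalFn, Set.mem_ofPred_eq, lt_iSup_iff] at hz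
    obtain ⟨c, r, hz, h⟩ := hz
    have hr : 0 < r := dist_nonneg.trans_lt hz
    have h0 : volume (Metric.ball c r) ≠ 0 := (Metric.measure_ball_pos volume c hr).ne'
    have h1 : volume (Metric.ball c r) ≠ ∞ := measure_ball_lt_top.ne
    have hmem : (c, r) ∈ T := by
      refine ⟨hr, ?_⟩
      simp only
      rw [← ENNReal.lt_div_iff_mul_lt (Or.inl h0) (Or.inl h1), ENNReal.div_eq_inv_mul]
      exact h
    obtain ⟨b, hb, hsb⟩ := hcov _ hmem
    refine Set.mem_iUnion₂.2 ⟨b, hb, ?_⟩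
    have h2 := hsb (Metric.ball_subset_closedBall hz)
    have hb0 := (huT hb).1
    rw [Metric.mem_closedBall] at h2
    rw [Metric.mem_ball]
    linarith
  have : Countable u := hcount.to_subtype
  calc volume {z | t < maximalFn φ z} ≤ volume (⋃ q ∈ u, Metric.ball q.1 (4 * q.2)) :=
        measure_mono hsub
    _ ≤ ∑' q : u, volume (Metric.ball q.1.1 (4 * q.1.2)) := measure_biUnion_le _ hcount _
    _ ≤ ∑' q : u, 16 / t * ∫⁻ w in Metric.ball q.1.1 q.1.2, φ w := by
        refine ENNReal.tsum_le_tsum fun q => ?_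
        rw [volume_ball_mul _ (by norm_num), ENNReal.div_eq_inv_mul, mul_comm t⁻¹, mul_assoc]
        have h4 : ENNReal.ofReal 4 ^ 2 = 16 := by
          rw [← ENNReal.ofReal_pow (by norm_num)]; norm_num
        rw [h4]
        gcongr
        rw [← ENNReal.div_eq_inv_mul, ENNReal.le_div_iff_mul_le (Or.inl ht0) (Or.inl ht), mul_comm]
        exact (huT q.2).2.le
    _ = 16 / t * ∫⁻ w in ⋃ q ∈ u, Metric.ball q.1 q.2, φ w := by
        rw [ENNReal.tsum_mul_left, lintegral_biUnion hcount (fun _ _ => measurableSet_ball) hdisj']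
    _ ≤ _ := by gcongr; exact Measure.restrict_le_self

/-- The maximal function is bounded on `L^p` for `1 < p < ∞`. -/
lemma exists_lintegral_maximalFn_rpow_le {p : ℝ} (hp : 1 < p) : ∃ C : ℝ≥0, ∀ f : ℂ → ℂ,
    AEStronglyMeasurable f volume →
    ∫⁻ z, maximalFn (fun w => ‖f w‖ₑ) z ^ p ≤ C * ∫⁻ z, ‖f z‖ₑ ^ p := by
  refine ⟨32 * (p * 2 ^ (p - 1) / (p - 1)).toNNReal, fun f hf => ?_⟩
  set g := hf.mk f with hg
  have hfg : f =ᵐ[volume] g := hf.ae_eq_mk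
  have hgm : Measurable g := hf.stronglyMeasurable_mk.measurable
  have hle : ∀ z, maximalFn (fun w => ‖f w‖ₑ) z ≤ maximalFn (fun w => ‖g w‖ₑ) z :=
    maximalFn_mono_ae (by filter_upwards [hfg] with z hz; rw [hz])
  have hmain := lintegral_rpow_le_lintegral_distribution (μ := (volume : Measure ℂ))
    (measurable_maximalFn (fun w => ‖g w‖ₑ)) (p := p) (by linarith)
  have hab := lintegral_layer_above (μ := (volume : Measure ℂ)) (φ := fun z => ‖g z‖₊)
    hgm.nnnorm hp 32
  calc _ ≤ ∫⁻ z, maximalFn (fun w => ‖g w‖ₑ) z ^ p := by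
        gcongr with z; exact hle z
    _ ≤ _ := hmain
    _ ≤ _ := by
        refine setLIntegral_mono' measurableSet_Ioi fun t ht => ?_
        have ht' : (0 : ℝ) < t := ht
        gcongr
        show _ ≤ 32 / ENNReal.ofReal t * ∫⁻ z in {z | t < 2 * (‖g z‖₊ : ℝ)}, ‖g z‖ₑ
        -- only the values of `g` above `t / 2` matter for the maximal function above `t`
        set S : Set ℂ := {z | t < 2 * (‖g z‖₊ : ℝ)} with hS
        have hSm : MeasurableSet S := measurableSet_lt measurable_const (by fun_prop)
        have hsub : {z | ENNReal.ofReal t < maximalFn (fun w => ‖g w‖ₑ) z} ⊆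
            {z | ENNReal.ofReal (t / 2) < maximalFn (S.indicator fun w => ‖g w‖ₑ) z} := by
          intro z hz
          have h1 : maximalFn (fun w => ‖g w‖ₑ) z ≤
              maximalFn (S.indicator fun w => ‖g w‖ₑ) z + ENNReal.ofReal (t / 2) := by
            refine (maximalFn_mono_ae (Eventually.of_forall fun w => ?_) z).trans
              (maximalFn_add_const_le _ _ z)
            by_cases hw : w ∈ S
            · rw [Set.indicator_of_mem hw]; exact le_self_add
            · rw [Set.indicator_of_notMem hw, zero_add, ← ofReal_norm]
              apply ENNReal.ofReal_le_ofReal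
              have : 2 * (‖g w‖₊ : ℝ) ≤ t := not_lt.1 hw
              rw [coe_nnnorm] at this
              linarith
          by_contra hcon
          have h2 : maximalFn (S.indicator fun w => ‖g w‖ₑ) z ≤ ENNReal.ofReal (t / 2) :=
            not_lt.1 hcon
          have h3 := h1.trans (add_le_add_left h2 _)
          rw [← ENNReal.ofReal_add (by linarith) (by linarith), add_halves] at h3
          exact absurd hz (not_lt.2 h3)
        refine (measure_mono hsub).trans ((volume_lt_maximalFn_le _ (by simpa using ht')
          ENNReal.ofReal_ne_top).trans_eq ?_)
        rw [lintegral_indicator hSm]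
        congr 1
        rw [ENNReal.ofReal_div_of_pos two_pos, ENNReal.ofReal_ofNat, div_eq_mul_inv, div_eq_mul_inv,
          div_eq_mul_inv, ENNReal.mul_inv (by simp) (by simp), inv_inv, mul_comm _ (2 : ℝ≥0∞),
          ← mul_assoc]
        norm_num
    _ ≤ _ := hab
    _ = _ := by
        have e : ∫⁻ z, ((‖g z‖₊ : ℝ≥0) : ℝ≥0∞) ^ p = ∫⁻ z, ‖f z‖ₑ ^ p :=
          lintegral_congr_ae (by filter_upwards [hfg] with z hz; rw [hz]; rfl)
        rw [e]
        rfl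

/-- Convolution against `ε² |ζ|⁻⁴` away from the disc of radius `ε` is dominated by the maximal
function. -/
lemma lintegral_inv_pow_four_le (f : ℂ → ℂ) (hf : AEStronglyMeasurable f volume) {ε : ℝ}
    (hε : 0 < ε) (z : ℂ) :
    ∫⁻ w in {w | ε < ‖w - z‖}, ‖f w‖ₑ * ENNReal.ofReal (ε ^ 2 / ‖w - z‖ ^ 4) ≤
      ENNReal.ofReal (2 * Real.pi) * hardyLittlewood f z := by
  have hm : MeasurableSet {w : ℂ | ε < ‖w - z‖} :=
    measurableSet_lt measurable_const (by fun_prop)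
  have hball : ∀ r : ℝ, 0 < r → ∫⁻ w in Metric.ball z r, ‖f w‖ₑ ≤
      ENNReal.ofReal (Real.pi * r ^ 2) * hardyLittlewood f z := by
    intro r hr
    have h0 : volume (Metric.ball z r) ≠ 0 := (Metric.measure_ball_pos volume z hr).ne'
    have h1 : volume (Metric.ball z r) ≠ ∞ := measure_ball_lt_top.ne
    have hv : volume (Metric.ball z r) = ENNReal.ofReal (Real.pi * r ^ 2) := by
      rw [Complex.volume_ball, mul_comm Real.pi, ENNReal.ofReal_mul (by positivity),
        ENNReal.ofReal_pow hr.le]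
      congr 1
      rw [← ENNReal.ofReal_coe_nnreal]; rfl
    have h2 : (volume (Metric.ball z r))⁻¹ * ∫⁻ w in Metric.ball z r, ‖f w‖ₑ ≤
        hardyLittlewood f z :=
      le_iSup₂ (f := fun r (_ : 0 < r) =>
        (volume (Metric.ball z r))⁻¹ * ∫⁻ w in Metric.ball z r, ‖f w‖ₑ) r hr
    rw [← hv]
    refine le_trans ?_ (mul_le_mul_right h2 _)
    rw [← mul_assoc, ENNReal.mul_inv_cancel h0 h1, one_mul]
  have hmeas : AEMeasurable (fun q : ℂ × ℝ => {q : ℂ × ℝ | ‖q.1 - z‖ < q.2}.indicator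
      (fun q => ‖f q.1‖ₑ * ENNReal.ofReal (4 * ε ^ 2 * q.2 ^ (-5 : ℝ))) q)
      ((volume : Measure ℂ).prod (volume.restrict (Set.Ioi ε))) := by
    refine AEMeasurable.indicator ?_ (measurableSet_lt (by fun_prop) (by fun_prop))
    exact (hf.enorm.comp_quasiMeasurePreserving Measure.quasiMeasurePreserving_fst).mul
      (by fun_prop)
  -- `ε² / |ζ|⁴` is the superposition of indicators of the discs `|ζ| < r` with weight `4 ε² r⁻⁵`
  calc _ ≤ ∫⁻ w in {w | ε < ‖w - z‖}, ∫⁻ r in Set.Ioi ε, {q : ℂ × ℝ | ‖q.1 - z‖ < q.2}.indicator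
            (fun q => ‖f q.1‖ₑ * ENNReal.ofReal (4 * ε ^ 2 * q.2 ^ (-5 : ℝ))) (w, r) := by
        refine setLIntegral_mono' hm fun w hw => ?_
        have hw' : 0 < ‖w - z‖ := hε.trans hw
        have e : (fun r => {q : ℂ × ℝ | ‖q.1 - z‖ < q.2}.indicator
            (fun q => ‖f q.1‖ₑ * ENNReal.ofReal (4 * ε ^ 2 * q.2 ^ (-5 : ℝ))) (w, r)) =
            (Set.Ioi ‖w - z‖).indicator
              fun r => ‖f w‖ₑ * ENNReal.ofReal (4 * ε ^ 2 * r ^ (-5 : ℝ)) := rfl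
        have e2 : Set.Ioi ‖w - z‖ ∩ Set.Ioi ε = Set.Ioi ‖w - z‖ :=
          Set.inter_eq_left.2 (Set.Ioi_subset_Ioi (le_of_lt hw))
        rw [e, setLIntegral_indicator measurableSet_Ioi, e2,
          lintegral_const_mul' _ _ enorm_ne_top]
        gcongr
        simp_rw [ENNReal.ofReal_mul (show 0 ≤ 4 * ε ^ 2 by positivity)]
        rw [lintegral_const_mul' _ _ ENNReal.ofReal_ne_top, lintegral_Ioi_rpow hw' (by norm_num),
          ← ENNReal.ofReal_mul (by positivity)]
        apply ENNReal.ofReal_le_ofReal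
        rw [show (-5 : ℝ) + 1 = -((4 : ℕ) : ℝ) by norm_num, Real.rpow_neg hw'.le,
          Real.rpow_natCast]
        apply le_of_eq
        field_simp
        norm_num
    _ ≤ ∫⁻ w, ∫⁻ r in Set.Ioi ε, {q : ℂ × ℝ | ‖q.1 - z‖ < q.2}.indicator
            (fun q => ‖f q.1‖ₑ * ENNReal.ofReal (4 * ε ^ 2 * q.2 ^ (-5 : ℝ))) (w, r) :=
        setLIntegral_le_lintegral _ _
    _ = ∫⁻ r in Set.Ioi ε, ∫⁻ w, {q : ℂ × ℝ | ‖q.1 - z‖ < q.2}.indicator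
            (fun q => ‖f q.1‖ₑ * ENNReal.ofReal (4 * ε ^ 2 * q.2 ^ (-5 : ℝ))) (w, r) :=
        lintegral_lintegral_swap hmeas
    _ ≤ ∫⁻ r in Set.Ioi ε, ENNReal.ofReal (4 * Real.pi * ε ^ 2) * hardyLittlewood f z *
          ENNReal.ofReal (r ^ (-3 : ℝ)) := by
        refine setLIntegral_mono' measurableSet_Ioi fun r hr => ?_
        have hr' : 0 < r := hε.trans hr
        have e : (fun w => {q : ℂ × ℝ | ‖q.1 - z‖ < q.2}.indicator
            (fun q => ‖f q.1‖ₑ * ENNReal.ofReal (4 * ε ^ 2 * q.2 ^ (-5 : ℝ))) (w, r)) =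
            (Metric.ball z r).indicator
              fun w => ‖f w‖ₑ * ENNReal.ofReal (4 * ε ^ 2 * r ^ (-5 : ℝ)) := by
          ext w
          by_cases h : ‖w - z‖ < r
          · rw [Set.indicator_of_mem (by exact h), Set.indicator_of_mem
              (by rwa [mem_ball_iff_norm])]
          · rw [Set.indicator_of_notMem (by exact h), Set.indicator_of_notMem
              (by rwa [mem_ball_iff_norm])]
        rw [e, lintegral_indicator measurableSet_ball, lintegral_mul_const' _ _ ENNReal.ofReal_ne_top]
        refine (mul_le_mul_left (hball r hr') _).trans_eq ?_
        rw [mul_right_comm, mul_right_comm (ENNReal.ofReal (4 * Real.pi * ε ^ 2)), ← ENNReal.ofReal_mul (by positivity),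
          ← ENNReal.ofReal_mul (by positivity)]
        congr 2
        rw [show (-3 : ℝ) = -5 + (2 : ℕ) by norm_num, Real.rpow_add hr', Real.rpow_natCast]
        ring
    _ = ENNReal.ofReal (4 * Real.pi * ε ^ 2) * ENNReal.ofReal (ε ^ (-3 + 1 : ℝ) / -(-3 + 1)) *
          hardyLittlewood f z := by
        rw [lintegral_const_mul _ (by fun_prop), lintegral_Ioi_rpow hε (by norm_num),
          mul_right_comm]
    _ = _ := by
        rw [← ENNReal.ofReal_mul (by positivity)]
        congr 2
        rw [show (-3 : ℝ) + 1 = -((2 : ℕ) : ℝ) by norm_num, Real.rpow_neg hε.le, Real.rpow_natCast]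
        field_simp
        norm_num

/-! ### Green's formula for piecewise smooth functions -/

/-- The real-linear map `v ↦ a v + b v̄`; it is the differential of `u` when `a = ∂u`, `b = ∂̄u`. -/
noncomputable def wirtinger (a b : ℂ) : ℂ →L[ℝ] ℂ :=
  a • ContinuousLinearMap.id ℝ ℂ + b • (Complex.conjCLE : ℂ →L[ℝ] ℂ)

@[simp] lemma wirtinger_apply (a b v : ℂ) : wirtinger a b v = a * v + b * starRingEnd ℂ v := by
  simp [wirtinger]

/-- `u` is bounded and continuous on the plane, and off the circle `|w| = ε` it is differentiable
with `∂u = a` and `∂̄u = b`, where `a` and `b` decay quadratically. The values of `a` and `b` on the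
circle are irrelevant. -/
structure HasWirtinger (u a b : ℂ → ℂ) (ε M C : ℝ) : Prop where
  continuous : Continuous u
  norm_le : ∀ w, ‖u w‖ ≤ M
  decaying_left : IsDecaying a C
  decaying_right : IsDecaying b C
  hasFDerivAt : ∀ w, ‖w‖ ≠ ε → HasFDerivAt u (wirtinger (a w) (b w)) w

lemma HasWirtinger.conj {u a b : ℂ → ℂ} {ε M C : ℝ} (h : HasWirtinger u a b ε M C) :
    HasWirtinger (fun w => starRingEnd ℂ (u w)) (fun w => starRingEnd ℂ (b w))
      (fun w => starRingEnd ℂ (a w)) ε M C where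
  continuous := Complex.continuous_conj.comp h.continuous
  norm_le w := by simpa using h.norm_le w
  decaying_left := h.decaying_right.conj
  decaying_right := h.decaying_left.conj
  hasFDerivAt w hw := by
    have h1 := (Complex.conjCLE : ℂ →L[ℝ] ℂ).hasFDerivAt.comp w (h.hasFDerivAt w hw)
    refine h1.congr_fderiv ?_
    ext v
    simp [add_comm]

lemma countable_cos_eq (c : ℝ) : {x : ℝ | Real.cos x = c}.Countable := by
  rcases Set.eq_empty_or_nonempty {x : ℝ | Real.cos x = c} with h | ⟨x₀, h₀⟩
  · rw [h]; exact Set.countable_empty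
  refine ((Set.countable_range fun k : ℤ => 2 * k * Real.pi + x₀).union
    (Set.countable_range fun k : ℤ => 2 * k * Real.pi - x₀)).mono fun x hx => ?_
  have : Real.cos x₀ = Real.cos x := (show Real.cos x₀ = c from h₀).trans hx.symm
  obtain ⟨k, hk | hk⟩ := Real.cos_eq_cos_iff.1 this
  · exact Or.inl ⟨k, hk.symm⟩
  · exact Or.inr ⟨k, hk.symm⟩

lemma norm_add_mul_exp_sq (z : ℂ) (r θ : ℝ) :
    ‖z + r * Complex.exp (θ * Complex.I)‖ ^ 2 =
      ‖z‖ ^ 2 + r ^ 2 + 2 * r * (‖z‖ * Real.cos (θ - z.arg)) := by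
  have hz : (z.re = ‖z‖ * Real.cos z.arg) ∧ (z.im = ‖z‖ * Real.sin z.arg) := by
    constructor
    · rw [Complex.norm_mul_cos_arg]
    · rw [Complex.norm_mul_sin_arg]
  have e1 : ‖z‖ ^ 2 = z.re ^ 2 + z.im ^ 2 := by
    rw [← Complex.normSq_eq_norm_sq, Complex.normSq_apply]; ring
  have e2 : ‖z‖ * Real.cos (θ - z.arg) = z.re * Real.cos θ + z.im * Real.sin θ := by
    rw [Real.cos_sub, mul_add, hz.1, hz.2]; ring
  rw [e2, e1, ← Complex.normSq_eq_norm_sq, Complex.normSq_apply]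
  have h1 : (z + r * Complex.exp (θ * Complex.I)).re = z.re + r * Real.cos θ := by
    simp [Complex.exp_ofReal_mul_I_re]
  have h2 : (z + r * Complex.exp (θ * Complex.I)).im = z.im + r * Real.sin θ := by
    simp [Complex.exp_ofReal_mul_I_im]
  rw [h1, h2]
  linear_combination r ^ 2 * Real.sin_sq_add_cos_sq θ

/-- A ray meets a circle in countably many (in fact at most two) points. -/
lemma countable_ray_inter_circle (z : ℂ) (θ ε : ℝ) :
    {r : ℝ | ‖z + r * Complex.exp (θ * Complex.I)‖ = ε}.Countable := by
  set c := ‖z‖ * Real.cos (θ - z.arg) with hc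
  set s := Real.sqrt (c ^ 2 - ‖z‖ ^ 2 + ε ^ 2)
  refine (Set.Finite.countable (Set.toFinite {-c + s, -c - s})).mono fun r hr => ?_
  have h := norm_add_mul_exp_sq z r θ
  rw [show ‖z + r * Complex.exp (θ * Complex.I)‖ = ε from hr, ← hc] at h
  have h2 : (r + c) ^ 2 = c ^ 2 - ‖z‖ ^ 2 + ε ^ 2 := by linarith [h]
  have h3 : (r + c) ^ 2 = s ^ 2 := by
    rw [Real.sq_sqrt (h2 ▸ sq_nonneg _), h2]
  rcases sq_eq_sq_iff_eq_or_eq_neg.1 h3 with h4 | h4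
  · exact Or.inl (by linarith)
  · exact Or.inr (by simp only [Set.mem_singleton_iff]; linarith)

/-- A circle not centred at the origin meets circles around the origin in countably many points. -/
lemma countable_circle_inter_circle {z : ℂ} (hz : z ≠ 0) {r : ℝ} (hr : 0 < r) (ε : ℝ) :
    {θ : ℝ | ‖z + r * Complex.exp (θ * Complex.I)‖ = ε}.Countable := by
  have hpos : 0 < ‖z‖ := norm_pos_iff.2 hz
  have := countable_cos_eq ((ε ^ 2 - ‖z‖ ^ 2 - r ^ 2) / (2 * r * ‖z‖))
  refine (this.preimage (sub_left_injective (b := z.arg))).mono fun θ hθ => ?_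
  have h := norm_add_mul_exp_sq z r θ
  rw [show ‖z + r * Complex.exp (θ * Complex.I)‖ = ε from hθ] at h
  show Real.cos (θ - z.arg) = _
  rw [eq_div_iff (by positivity)]
  linarith

lemma hasDerivAt_ray (z : ℂ) (r θ : ℝ) :
    HasDerivAt (fun r : ℝ => z + r * Complex.exp (θ * Complex.I)) (Complex.exp (θ * Complex.I)) r := by
  simpa using ((Complex.ofRealCLM.hasDerivAt (x := r)).mul_const
    (Complex.exp (θ * Complex.I))).const_add z

lemma hasDerivAt_exp_mul_I (θ : ℝ) : HasDerivAt (fun θ : ℝ => Complex.exp (θ * Complex.I))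
    (Complex.exp (θ * Complex.I) * Complex.I) θ := by
  have h1 : HasDerivAt (fun θ : ℝ => (θ : ℂ) * Complex.I) Complex.I θ := by
    simpa using (Complex.ofRealCLM.hasDerivAt (x := θ)).mul_const Complex.I
  exact h1.cexp

lemma conj_exp_mul_I (θ : ℝ) : starRingEnd ℂ (Complex.exp (θ * Complex.I)) =
    Complex.exp (-(θ * Complex.I)) := by
  rw [← Complex.exp_conj]; simp

lemma HasWirtinger.hasDerivAt_ray {u a b : ℂ → ℂ} {ε M C : ℝ} (h : HasWirtinger u a b ε M C)
    (z : ℂ) {r θ : ℝ} (hr : ‖z + r * Complex.exp (θ * Complex.I)‖ ≠ ε) :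
    HasDerivAt (fun r : ℝ => u (z + r * Complex.exp (θ * Complex.I)))
      (a (z + r * Complex.exp (θ * Complex.I)) * Complex.exp (θ * Complex.I) +
        b (z + r * Complex.exp (θ * Complex.I)) * Complex.exp (-(θ * Complex.I))) r := by
  have := (h.hasFDerivAt _ hr).comp_hasDerivAt r (MaxBeurling.hasDerivAt_ray z r θ)
  rwa [wirtinger_apply, conj_exp_mul_I] at this

lemma HasWirtinger.hasDerivAt_circle {u a b : ℂ → ℂ} {ε M C : ℝ} (h : HasWirtinger u a b ε M C)
    (z : ℂ) {r θ : ℝ} (hr : ‖z + r * Complex.exp (θ * Complex.I)‖ ≠ ε) :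
    HasDerivAt (fun θ : ℝ => u (z + r * Complex.exp (θ * Complex.I)))
      (a (z + r * Complex.exp (θ * Complex.I)) * (r * (Complex.exp (θ * Complex.I) * Complex.I)) -
        b (z + r * Complex.exp (θ * Complex.I)) *
          (r * (Complex.exp (-(θ * Complex.I)) * Complex.I))) θ := by
  have h1 : HasDerivAt (fun θ : ℝ => z + r * Complex.exp (θ * Complex.I))
      (r * (Complex.exp (θ * Complex.I) * Complex.I)) θ :=
    ((hasDerivAt_exp_mul_I θ).const_mul (r : ℂ)).const_add z
  have := (h.hasFDerivAt _ hr).comp_hasDerivAt θ h1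
  rw [wirtinger_apply, map_mul, map_mul, conj_exp_mul_I, Complex.conj_I, Complex.conj_ofReal] at this
  exact this.congr_deriv (by ring)

lemma setIntegral_annulus_eq_polar (f : ℂ → ℂ) {δ R : ℝ} (hδ : 0 < δ) :
    ∫ ζ in {ζ : ℂ | δ < ‖ζ‖ ∧ ‖ζ‖ < R}, f ζ =
      ∫ p in Set.Ioo δ R ×ˢ Set.Ioo (-Real.pi) Real.pi,
        (p.1 : ℂ) * f (p.1 * Complex.exp (p.2 * Complex.I)) := by
  have hm : MeasurableSet {ζ : ℂ | δ < ‖ζ‖ ∧ ‖ζ‖ < R} :=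
    (measurableSet_lt measurable_const measurable_norm).inter
      (measurableSet_lt measurable_norm measurable_const)
  rw [← integral_indicator hm, ← Complex.integral_comp_polarCoord_symm,
    polarCoord_target, ← integral_indicator (measurableSet_Ioi.prod measurableSet_Ioo),
    ← integral_indicator (measurableSet_Ioo.prod measurableSet_Ioo)]
  congr 1
  ext ⟨r, θ⟩
  have hs : Complex.polarCoord.symm (r, θ) = r * Complex.exp (θ * Complex.I) := by
    rw [Complex.polarCoord_symm_apply, Complex.exp_mul_I]; push_cast; rfl
  by_cases hr : 0 < r
  · have hn : ‖(r : ℂ) * Complex.exp (θ * Complex.I)‖ = r := by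
      rw [norm_mul, Complex.norm_exp_ofReal_mul_I, mul_one, Complex.norm_real,
        Real.norm_of_nonneg hr.le]
    by_cases hθ : θ ∈ Set.Ioo (-Real.pi) Real.pi
    · rw [Set.indicator_of_mem (show (r, θ) ∈ Set.Ioi (0 : ℝ) ×ˢ Set.Ioo (-Real.pi) Real.pi from ⟨hr, hθ⟩), hs]
      by_cases hrr : δ < r ∧ r < R
      · rw [Set.indicator_of_mem (by rw [Set.mem_ofPred_eq, hn]; exact hrr), Set.indicator_of_mem (by exact ⟨hrr, hθ⟩),
          Complex.real_smul]
      · rw [Set.indicator_of_notMem (by rw [Set.mem_ofPred_eq, hn]; exact hrr),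
          Set.indicator_of_notMem (fun h => hrr h.1), smul_zero]
    · rw [Set.indicator_of_notMem (fun h => hθ h.2), Set.indicator_of_notMem (fun h => hθ h.2)]
  · rw [Set.indicator_of_notMem (fun h => hr h.1),
      Set.indicator_of_notMem (fun h => hr (hδ.trans h.1.1))]

/-- The first Fourier coefficient `∫ e^{-iθ} u(z + r e^{iθ}) dθ` of `u` on the circle of centre `z`
and radius `r`. -/
noncomputable def circleMean (u : ℂ → ℂ) (z : ℂ) (r : ℝ) : ℂ :=
  ∫ θ in (-Real.pi)..Real.pi,
    Complex.exp (-(θ * Complex.I)) * u (z + r * Complex.exp (θ * Complex.I))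

lemma norm_exp_neg_mul_I (θ : ℝ) : ‖Complex.exp (-(θ * Complex.I))‖ = 1 := by
  rw [← conj_exp_mul_I, RCLike.norm_conj, Complex.norm_exp_ofReal_mul_I]

/-- Green's formula on an annulus centred at `z` for the function `u(w) / (w - z)²`. In polar
coordinates `2 ∂̄u = e^{iθ} (u_r + (i / r) u_θ)`; the first summand is integrated along rays, the
second one along circles. -/
lemma HasWirtinger.integral_annulus {u a b : ℂ → ℂ} {ε M C : ℝ} (h : HasWirtinger u a b ε M C)
    {z : ℂ} (hz : z ≠ 0) {δ R : ℝ} (hδ : 0 < δ) (hR : δ < R) :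
    ∫ ζ in {ζ : ℂ | δ < ‖ζ‖ ∧ ‖ζ‖ < R}, b (z + ζ) / ζ ^ 2 =
      (circleMean u z R / R - circleMean u z δ / δ) / 2 := by
  have hu := h.continuous
  have ha := h.decaying_left.measurable
  have hb := h.decaying_right.measurable
  set W : ℝ × ℝ → ℂ := fun p => z + p.1 * Complex.exp (p.2 * Complex.I) with hW
  have hWm : Continuous W := by fun_prop
  -- `P` is the radial derivative of `e^{-iθ} u / r`, and `Q` the angular derivative of
  -- `i e^{-iθ} u / r²`
  set P : ℝ × ℝ → ℂ := fun p => Complex.exp (-(p.2 * Complex.I)) *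
    ((a (W p) * Complex.exp (p.2 * Complex.I) + b (W p) * Complex.exp (-(p.2 * Complex.I))) / p.1
      - u (W p) / p.1 ^ 2) with hP
  set Q : ℝ × ℝ → ℂ := fun p => Complex.exp (-(p.2 * Complex.I)) *
    (u (W p) + Complex.I * (a (W p) * (p.1 * (Complex.exp (p.2 * Complex.I) * Complex.I)) -
        b (W p) * (p.1 * (Complex.exp (-(p.2 * Complex.I)) * Complex.I)))) / p.1 ^ 2 with hQ
  have hPm : Measurable P := by
    have h1 := ha.comp hWm.measurable
    have h2 := hb.comp hWm.measurable
    have h3 := hu.measurable.comp hWm.measurable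
    simp only [Function.comp_def] at h1 h2 h3
    fun_prop
  have hQm : Measurable Q := by
    have h1 := ha.comp hWm.measurable
    have h2 := hb.comp hWm.measurable
    have h3 := hu.measurable.comp hWm.measurable
    simp only [Function.comp_def] at h1 h2 h3
    fun_prop
  set S : Set (ℝ × ℝ) := Set.Ioo δ R ×ˢ Set.Ioo (-Real.pi) Real.pi with hS
  have hSm : MeasurableSet S := measurableSet_Ioo.prod measurableSet_Ioo
  have hSfin : volume S ≠ ∞ := by
    rw [hS, Measure.volume_eq_prod, Measure.prod_prod, Real.volume_Ioo, Real.volume_Ioo]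
    exact ENNReal.mul_ne_top ENNReal.ofReal_ne_top ENNReal.ofReal_ne_top
  have hC0 := h.decaying_left.nonneg
  have hM0 : 0 ≤ M := (norm_nonneg _).trans (h.norm_le 0)
  have hR0 : 0 < R := hδ.trans hR
  have hPb : ∀ p : ℝ × ℝ, δ < p.1 → ‖P p‖ ≤ (C + C) / δ + M / δ ^ 2 := by
    intro p hp
    have hp0 : 0 < p.1 := hδ.trans hp
    rw [hP, norm_mul, norm_exp_neg_mul_I, one_mul]
    refine (norm_sub_le _ _).trans (add_le_add ?_ ?_)
    · rw [norm_div, Complex.norm_real, Real.norm_of_nonneg hp0.le]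
      gcongr
      refine (norm_add_le _ _).trans (add_le_add ?_ ?_)
      · rw [norm_mul, Complex.norm_exp_ofReal_mul_I, mul_one]
        exact h.decaying_left.norm_le_const _
      · rw [norm_mul, norm_exp_neg_mul_I, mul_one]
        exact h.decaying_right.norm_le_const _
    · rw [norm_div, norm_pow, Complex.norm_real, Real.norm_of_nonneg hp0.le]
      gcongr
      exact h.norm_le _
  have hQb : ∀ p : ℝ × ℝ, δ < p.1 → p.1 < R → ‖Q p‖ ≤ (M + (C * R + C * R)) / δ ^ 2 := by
    intro p hp hpR
    have hp0 : 0 < p.1 := hδ.trans hp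
    rw [hQ, norm_div, norm_mul, norm_exp_neg_mul_I, one_mul, norm_pow, Complex.norm_real,
      Real.norm_of_nonneg hp0.le]
    gcongr
    refine (norm_add_le _ _).trans (add_le_add (h.norm_le _) ?_)
    rw [norm_mul, Complex.norm_I, one_mul]
    refine (norm_sub_le _ _).trans (add_le_add ?_ ?_)
    · rw [norm_mul, norm_mul, norm_mul, Complex.norm_exp_ofReal_mul_I, Complex.norm_I, mul_one,
        mul_one, Complex.norm_real, Real.norm_of_nonneg hp0.le]
      gcongr
      exact h.decaying_left.norm_le_const _
    · rw [norm_mul, norm_mul, norm_mul, norm_exp_neg_mul_I, Complex.norm_I, mul_one,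
        mul_one, Complex.norm_real, Real.norm_of_nonneg hp0.le]
      gcongr
      exact h.decaying_right.norm_le_const _
  have hPi : IntegrableOn P S := Measure.integrableOn_of_bounded hSfin hPm.aestronglyMeasurable
    ((ae_restrict_iff' hSm).2 (Eventually.of_forall fun p hp => hPb p hp.1.1))
  have hQi : IntegrableOn Q S := Measure.integrableOn_of_bounded hSfin hQm.aestronglyMeasurable
    ((ae_restrict_iff' hSm).2 (Eventually.of_forall fun p hp => hQb p hp.1.1 hp.1.2))
  have key : ∀ p ∈ S, (p.1 : ℂ) * (b (z + p.1 * Complex.exp (p.2 * Complex.I)) /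
      (p.1 * Complex.exp (p.2 * Complex.I)) ^ 2) = (P p + Q p) / 2 := by
    rintro ⟨r, θ⟩ hp
    have hr : (r : ℂ) ≠ 0 := by exact_mod_cast (hδ.trans hp.1.1).ne'
    have he := Complex.exp_ne_zero (θ * Complex.I)
    simp only [hP, hQ, hW, Complex.exp_neg]
    field_simp
    rw [Complex.I_sq]
    ring
  have hPI : ∫ p in S, P p = circleMean u z R / R - circleMean u z δ / δ := by
    have e1 : ∫ p in S, P p = ∫ θ in Set.Ioo (-Real.pi) Real.pi, ∫ r in Set.Ioo δ R, P (r, θ) := by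
      rw [hS, Measure.volume_eq_prod] at *
      rw [setIntegral_prod P hPi]
      refine integral_integral_swap ?_
      rw [Measure.prod_restrict]
      exact hPi
    have e2 : ∀ θ : ℝ, ∫ r in Set.Ioo δ R, P (r, θ) = Complex.exp (-(θ * Complex.I)) *
        (u (z + R * Complex.exp (θ * Complex.I)) / R -
          u (z + δ * Complex.exp (θ * Complex.I)) / δ) := by
      intro θ
      rw [← integral_Ioc_eq_integral_Ioo, ← intervalIntegral.integral_of_le hR.le]
      simp only [hP]
      rw [intervalIntegral.integral_const_mul]
      congr 1
      refine integral_eq_of_hasDerivAt_off_countable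
        (fun r : ℝ => u (z + r * Complex.exp (θ * Complex.I)) / r)
        _ (countable_ray_inter_circle z θ ε) ?_ ?_ ?_
      · refine ContinuousOn.div (by fun_prop) (by fun_prop) fun r hr => ?_
        rw [Set.uIcc_of_le hR.le] at hr
        exact_mod_cast (hδ.trans_le hr.1).ne'
      · rintro r ⟨hr, hrs⟩
        rw [min_eq_left hR.le, max_eq_right hR.le] at hr
        have hr0 : (r : ℂ) ≠ 0 := by exact_mod_cast (hδ.trans hr.1).ne'
        have hd := (h.hasDerivAt_ray z hrs).div (Complex.ofRealCLM.hasDerivAt (x := r)) (by simpa using hr0)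
        refine hd.congr_deriv ?_
        simp only [Complex.ofRealCLM_apply, Complex.ofReal_one, mul_one, hW]
        field_simp
      · rw [intervalIntegrable_iff_integrableOn_Ioo_of_le hR.le]
        have hb' : ∀ r : ℝ, δ < r → ‖P (r, θ)‖ ≤ (C + C) / δ + M / δ ^ 2 := fun r hr => hPb (r, θ) hr
        refine Measure.integrableOn_of_bounded (M := (C + C) / δ + M / δ ^ 2) (by simp) ?_
          ((ae_restrict_iff' measurableSet_Ioo).2 (Eventually.of_forall fun r hr => ?_))
        · have h1 := hPm.comp (measurable_prodMk_right (y := θ))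
          have h2 := h1.const_mul (Complex.exp (θ * Complex.I))
          refine Measurable.aestronglyMeasurable ?_
          convert h2 using 1
          ext r
          simp only [hP, Function.comp_apply]
          rw [← mul_assoc, ← Complex.exp_add, add_neg_cancel, Complex.exp_zero, one_mul]
        · have h1 := hb' r hr.1
          simp only [hP] at h1
          rwa [norm_mul, norm_exp_neg_mul_I, one_mul] at h1
    rw [e1]
    simp_rw [e2]
    rw [← integral_Ioc_eq_integral_Ioo, ← intervalIntegral.integral_of_le
      (by linarith [Real.pi_pos]), circleMean, circleMean, ← intervalIntegral.integral_div,
      ← intervalIntegral.integral_div, ← intervalIntegral.integral_sub]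
    · congr 1; ext θ; ring
    · refine Continuous.intervalIntegrable ?_ _ _; fun_prop
    · refine Continuous.intervalIntegrable ?_ _ _; fun_prop
  have hQI : ∫ p in S, Q p = 0 := by
    have e1 : ∫ p in S, Q p = ∫ r in Set.Ioo δ R, ∫ θ in Set.Ioo (-Real.pi) Real.pi, Q (r, θ) := by
      rw [hS, Measure.volume_eq_prod] at *
      rw [setIntegral_prod Q hQi]
    have hpi : -Real.pi ≤ Real.pi := by linarith [Real.pi_pos]
    rw [e1]
    refine setIntegral_eq_zero_of_forall_eq_zero fun r hr => ?_
    have hr0 : 0 < r := hδ.trans hr.1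
    rw [← integral_Ioc_eq_integral_Ioo, ← intervalIntegral.integral_of_le hpi]
    have hd : ∫ θ in (-Real.pi)..Real.pi, Q (r, θ) =
        (fun θ : ℝ => Complex.I * (Complex.exp (-(θ * Complex.I)) *
          u (z + r * Complex.exp (θ * Complex.I))) / r ^ 2) Real.pi -
        (fun θ : ℝ => Complex.I * (Complex.exp (-(θ * Complex.I)) *
          u (z + r * Complex.exp (θ * Complex.I))) / r ^ 2) (-Real.pi) := by
      refine integral_eq_of_hasDerivAt_off_countable
        (fun θ : ℝ => Complex.I * (Complex.exp (-(θ * Complex.I)) *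
          u (z + r * Complex.exp (θ * Complex.I))) / r ^ 2) (fun θ => Q (r, θ))
        (countable_circle_inter_circle hz hr0 ε) ?_ ?_ ?_
      · exact Continuous.continuousOn (by fun_prop)
      · rintro θ ⟨-, hθ⟩
        have h1 : HasDerivAt (fun θ : ℝ => Complex.exp (-(θ * Complex.I)))
            (Complex.exp (-(θ * Complex.I)) * -Complex.I) θ := by
          have h1 : HasDerivAt (fun θ : ℝ => -((θ : ℂ) * Complex.I)) (-Complex.I) θ := by
            have h0 : HasDerivAt (fun θ : ℝ => (θ : ℂ) * Complex.I) Complex.I θ := by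
              simpa using (Complex.ofRealCLM.hasDerivAt (x := θ)).mul_const Complex.I
            exact h0.neg
          exact h1.cexp
        have h2 := ((h1.mul (h.hasDerivAt_circle z hθ)).const_mul Complex.I).div_const
          ((r : ℂ) ^ 2)
        refine h2.congr_deriv ?_
        simp only [hQ, hW]
        congr 1
        linear_combination (-Complex.exp (-(θ * Complex.I)) *
          u (z + r * Complex.exp (θ * Complex.I))) * Complex.I_mul_I
      · rw [intervalIntegrable_iff_integrableOn_Ioo_of_le hpi]
        exact Measure.integrableOn_of_bounded (by simp)
          (hQm.comp (measurable_prodMk_left (x := r))).aestronglyMeasurable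
          (Eventually.of_forall fun θ => hQb (r, θ) hr.1 hr.2)
    rw [hd]
    have e3 : Complex.exp (((Real.pi : ℝ) : ℂ) * Complex.I) = -1 := Complex.exp_pi_mul_I
    have e4 : Complex.exp (-(((Real.pi : ℝ) : ℂ) * Complex.I)) = -1 := by
      rw [Complex.exp_neg, e3]; norm_num
    simp only [Complex.ofReal_neg, neg_mul, neg_neg, e3, e4, sub_self]
  rw [setIntegral_annulus_eq_polar _ hδ, setIntegral_congr_fun hSm key, integral_div,
    integral_add hPi hQi, hPI, hQI, add_zero]

lemma norm_circleMean_le {u : ℂ → ℂ} {M : ℝ} (hu : ∀ w, ‖u w‖ ≤ M) (z : ℂ) (r : ℝ) :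
    ‖circleMean u z r‖ ≤ M * (2 * Real.pi) := by
  have := intervalIntegral.norm_integral_le_of_norm_le_const (a := -Real.pi) (b := Real.pi)
    (f := fun θ : ℝ => Complex.exp (-(θ * Complex.I)) * u (z + r * Complex.exp (θ * Complex.I)))
    (C := M) (fun θ _ => by rw [norm_mul, norm_exp_neg_mul_I, one_mul]; exact hu _)
  rwa [sub_neg_eq_add, ← two_mul, abs_of_pos (by positivity)] at this

lemma integral_exp_mul_I_eq_zero {n : ℤ} (hn : n ≠ 0) :
    ∫ θ in (-Real.pi)..Real.pi, Complex.exp (n * (θ * Complex.I)) = 0 := by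
  have hc : (n : ℂ) * Complex.I ≠ 0 := mul_ne_zero (by exact_mod_cast hn) Complex.I_ne_zero
  have := integral_exp_mul_complex (a := -Real.pi) (b := Real.pi) hc
  have e : ∀ θ : ℝ, (n : ℂ) * (θ * Complex.I) = n * Complex.I * θ := fun θ => by ring
  simp_rw [e]
  rw [this]
  have h1 : Complex.exp (n * Complex.I * (Real.pi : ℝ)) =
      Complex.exp (n * Complex.I * ((-Real.pi : ℝ) : ℂ)) := by
    rw [Complex.exp_eq_exp_iff_exists_int]
    exact ⟨n, by push_cast; ring⟩
  rw [h1, sub_self, zero_div]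

lemma integral_exp_neg_mul_I : ∫ θ in (-Real.pi)..Real.pi, Complex.exp (-(θ * Complex.I)) = 0 := by
  simpa using integral_exp_mul_I_eq_zero (n := -1) (by norm_num)

lemma circleMean_eq_sub {u : ℂ → ℂ} (hu : Continuous u) (z : ℂ) (r : ℝ) :
    circleMean u z r = ∫ θ in (-Real.pi)..Real.pi,
      Complex.exp (-(θ * Complex.I)) * (u (z + r * Complex.exp (θ * Complex.I)) - u z) := by
  simp_rw [mul_sub]
  rw [intervalIntegral.integral_sub, intervalIntegral.integral_mul_const, integral_exp_neg_mul_I,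
    zero_mul, sub_zero, circleMean]
  · exact Continuous.intervalIntegrable (by fun_prop) _ _
  · exact Continuous.intervalIntegrable (by fun_prop) _ _

lemma truncation_eq_setIntegral (K f : ℂ → ℂ) (δ : ℝ) (z : ℂ) :
    truncation K δ f z = ∫ ζ in {ζ : ℂ | δ < ‖ζ‖}, f (z + ζ) * K ζ := by
  have hm : MeasurableSet {ζ : ℂ | δ < ‖ζ‖} := measurableSet_lt measurable_const measurable_norm
  rw [truncation_eq_kernelOp, kernelOp, ← integral_add_right_eq_self _ z, ← integral_indicator hm]
  congr 1; ext ζ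
  by_cases h : δ < ‖ζ‖ <;> simp [truncKernel, h, add_comm]

/-- The truncations of the Beurling transform of `∂̄u` are first Fourier coefficients of `u` on
circles. -/
lemma HasWirtinger.truncation_eq {u a b : ℂ → ℂ} {ε M C : ℝ} (h : HasWirtinger u a b ε M C)
    {z : ℂ} (hz : z ≠ 0) {δ : ℝ} (hδ : 0 < δ) :
    truncation beurlingKernel δ b z = -(circleMean u z δ / δ) / 2 := by
  set s : ℕ → Set ℂ := fun n => {ζ : ℂ | δ < ‖ζ‖ ∧ ‖ζ‖ < δ + 1 + n} with hs
  have hU : ⋃ n, s n = {ζ : ℂ | δ < ‖ζ‖} := by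
    ext ζ
    simp only [hs, Set.mem_iUnion, Set.mem_ofPred_eq]
    refine ⟨fun ⟨n, hn⟩ => hn.1, fun hn => ?_⟩
    obtain ⟨n, hn'⟩ := exists_nat_gt ‖ζ‖
    exact ⟨n, hn, by linarith⟩
  have hsm : ∀ n, MeasurableSet (s n) := fun n =>
    (measurableSet_lt measurable_const measurable_norm).inter
      (measurableSet_lt measurable_norm measurable_const)
  have hmono : Monotone s := fun m n hmn ζ hζ =>
    ⟨hζ.1, hζ.2.trans_le (by have : (m : ℝ) ≤ n := by exact_mod_cast hmn
                             linarith)⟩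
  have hint : IntegrableOn (fun ζ => b (z + ζ) * beurlingKernel ζ) (⋃ n, s n) := by
    rw [hU]
    have h1 := (isStandardKernel_beurlingKernel.isDecaying hδ).integrable one_le_two
      (by norm_num) (h.decaying_right.memLp (q := 2) (by norm_num)) z
    have h2 := h1.comp_add_right z
    rw [← integrable_indicator_iff (measurableSet_lt measurable_const measurable_norm)]
    refine h2.congr (Eventually.of_forall fun ζ => ?_)
    by_cases h : δ < ‖ζ‖ <;> simp [truncKernel, h, add_comm]
  have h1 := tendsto_setIntegral_of_monotone hsm hmono hint
  rw [hU, ← truncation_eq_setIntegral] at h1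
  refine tendsto_nhds_unique h1 ?_
  have h2 : ∀ n : ℕ, ∫ ζ in s n, b (z + ζ) * beurlingKernel ζ =
      (circleMean u z (δ + 1 + n) / ((δ + 1 + n : ℝ) : ℂ) - circleMean u z δ / δ) / 2 := by
    intro n
    rw [← h.integral_annulus hz hδ (R := δ + 1 + n)
      (by have := Nat.cast_nonneg (α := ℝ) n; linarith)]
    simp [beurlingKernel, div_eq_mul_inv, hs]
  simp_rw [h2]
  have h3 : Tendsto (fun n : ℕ => circleMean u z (δ + 1 + n) / ((δ + 1 + n : ℝ) : ℂ)) atTop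
      (𝓝 0) := by
    have hR : Tendsto (fun n : ℕ => (δ + 1 + n : ℝ)) atTop atTop :=
      tendsto_atTop_add_const_left _ _ tendsto_natCast_atTop_atTop
    have h4 : Tendsto (fun n : ℕ => M * (2 * Real.pi) / (δ + 1 + n)) atTop (𝓝 0) :=
      tendsto_const_nhds.div_atTop hR
    refine squeeze_zero_norm (fun n => ?_) h4
    have hp : 0 < δ + 1 + (n : ℝ) := by positivity
    rw [norm_div, Complex.norm_real, Real.norm_of_nonneg hp.le]
    gcongr
    exact norm_circleMean_le h.norm_le _ _
  have h5 := (h3.sub_const (circleMean u z δ / δ)).div_const 2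
  rwa [zero_sub] at h5

lemma HasWirtinger.norm_sub_le {u a b : ℂ → ℂ} {ε M C L : ℝ} (h : HasWirtinger u a b ε M C)
    (hL : ∀ w, ‖w‖ ≠ ε → ‖a w‖ + ‖b w‖ ≤ L) (z : ℂ) {δ : ℝ} (hδ : 0 ≤ δ) (θ : ℝ) :
    ‖u (z + δ * Complex.exp (θ * Complex.I)) - u z‖ ≤ L * δ := by
  have ha := h.decaying_left.measurable
  have hb := h.decaying_right.measurable
  have hu := h.continuous
  set D : ℝ → ℂ := fun r => a (z + r * Complex.exp (θ * Complex.I)) * Complex.exp (θ * Complex.I) +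
        b (z + r * Complex.exp (θ * Complex.I)) * Complex.exp (-(θ * Complex.I)) with hD
  have hDn : ∀ r, ‖D r‖ ≤ ‖a (z + r * Complex.exp (θ * Complex.I))‖ +
      ‖b (z + r * Complex.exp (θ * Complex.I))‖ := fun r => by
    refine (norm_add_le _ _).trans_eq ?_
    rw [norm_mul, norm_mul, norm_exp_neg_mul_I, Complex.norm_exp_ofReal_mul_I, mul_one, mul_one]
  have hDm : Measurable D := by
    have hW : Measurable fun r : ℝ => z + r * Complex.exp (θ * Complex.I) := by fun_prop
    exact ((ha.comp hW).mul_const _).add ((hb.comp hW).mul_const _)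
  have hi : IntervalIntegrable D volume 0 δ := by
    rw [intervalIntegrable_iff_integrableOn_Ioo_of_le hδ]
    exact Measure.integrableOn_of_bounded (M := C + C) (by simp) hDm.aestronglyMeasurable
      (Eventually.of_forall fun r => (hDn r).trans
        (add_le_add (h.decaying_left.norm_le_const _) (h.decaying_right.norm_le_const _)))
  have hF := integral_eq_of_hasDerivAt_off_countable
    (fun r : ℝ => u (z + r * Complex.exp (θ * Complex.I))) D (countable_ray_inter_circle z θ ε)
    (a := 0) (b := δ) (Continuous.continuousOn (by fun_prop))
    (fun r hr => h.hasDerivAt_ray z hr.2) hi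
  simp only [Complex.ofReal_zero, zero_mul, add_zero] at hF
  rw [← hF]
  have hn := intervalIntegral.norm_integral_le_of_norm_le_const_ae (a := 0) (b := δ) (f := D)
    (C := L) ?_
  · simpa [abs_of_nonneg hδ] using hn
  · have := (countable_ray_inter_circle z θ ε).ae_notMem volume
    filter_upwards [this] with r hr _
    exact (hDn r).trans (hL _ hr)

/-- A bound for the truncations which does not depend on the level `δ`: by cancellation the Fourier
coefficient is one of `u - u(z)`, and `u` is Lipschitz. -/
lemma HasWirtinger.norm_truncation_le {u a b : ℂ → ℂ} {ε M C L : ℝ}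
    (h : HasWirtinger u a b ε M C) (hL : ∀ w, ‖w‖ ≠ ε → ‖a w‖ + ‖b w‖ ≤ L) {z : ℂ} (hz : z ≠ 0)
    {δ : ℝ} (hδ : 0 < δ) : ‖truncation beurlingKernel δ b z‖ ≤ Real.pi * L := by
  rw [h.truncation_eq hz hδ, circleMean_eq_sub h.continuous]
  have := intervalIntegral.norm_integral_le_of_norm_le_const (a := -Real.pi) (b := Real.pi)
    (f := fun θ : ℝ => Complex.exp (-(θ * Complex.I)) *
      (u (z + δ * Complex.exp (θ * Complex.I)) - u z))
    (C := L * δ) (fun θ _ => by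
      rw [norm_mul, norm_exp_neg_mul_I, one_mul]; exact h.norm_sub_le hL z hδ.le θ)
  rw [sub_neg_eq_add, ← two_mul, abs_of_pos (by positivity)] at this
  rw [norm_div, norm_neg, norm_div, Complex.norm_real, Real.norm_of_nonneg hδ.le,
    Complex.norm_ofNat, div_div, div_le_iff₀ (by positivity)]
  linarith

/-- The principal value of the Beurling transform of `∂̄u` is `-π ∂u`: the Fourier coefficients in
`truncation_eq` are difference quotients of `u` at `z`. -/
lemma HasWirtinger.tendsto_truncation {u a b : ℂ → ℂ} {ε M C : ℝ}
    (h : HasWirtinger u a b ε M C) {z : ℂ} (hz : z ≠ 0) (hzε : ‖z‖ ≠ ε) :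
    Tendsto (fun δ => truncation beurlingKernel δ b z) (𝓝[>] 0) (𝓝 (-Real.pi * a z)) := by
  have hL : ∀ w, ‖w‖ ≠ ε → ‖a w‖ + ‖b w‖ ≤ C + C := fun w _ =>
    add_le_add (h.decaying_left.norm_le_const _) (h.decaying_right.norm_le_const _)
  have hu := h.continuous
  have h1 : Tendsto (fun δ : ℝ => ∫ θ in (-Real.pi)..Real.pi, Complex.exp (-(θ * Complex.I)) *
      ((u (z + δ * Complex.exp (θ * Complex.I)) - u z) / δ)) (𝓝[>] 0)
      (𝓝 (∫ θ in (-Real.pi)..Real.pi, Complex.exp (-(θ * Complex.I)) *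
        (a z * Complex.exp (θ * Complex.I) + b z * Complex.exp (-(θ * Complex.I))))) := by
    refine intervalIntegral.tendsto_integral_filter_of_dominated_convergence
      (fun _ => C + C) ?_ ?_ ?_ ?_
    · refine Eventually.of_forall fun δ => Continuous.aestronglyMeasurable ?_
      fun_prop
    · filter_upwards [self_mem_nhdsWithin] with δ (hδ : 0 < δ)
      refine Eventually.of_forall fun θ _ => ?_
      rw [norm_mul, norm_exp_neg_mul_I, one_mul, norm_div, Complex.norm_real,
        Real.norm_of_nonneg hδ.le, div_le_iff₀ hδ]
      exact h.norm_sub_le hL z hδ.le θ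
    · simp
    · refine Eventually.of_forall fun θ _ => Tendsto.const_mul _ ?_
      have hd := h.hasDerivAt_ray z (r := 0) (θ := θ) (by simpa using hzε)
      simp only [Complex.ofReal_zero, zero_mul, add_zero] at hd
      have := (hasDerivAt_iff_tendsto_slope_zero.1 hd).mono_left (nhdsGT_le_nhdsNE 0)
      refine this.congr fun δ => ?_
      simp [div_eq_inv_mul]
  have h2 : ∫ θ in (-Real.pi)..Real.pi, Complex.exp (-(θ * Complex.I)) *
        (a z * Complex.exp (θ * Complex.I) + b z * Complex.exp (-(θ * Complex.I))) =
        2 * Real.pi * a z := by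
    have e : ∀ θ : ℝ, Complex.exp (-(θ * Complex.I)) *
        (a z * Complex.exp (θ * Complex.I) + b z * Complex.exp (-(θ * Complex.I))) =
        a z + b z * Complex.exp ((-2 : ℤ) * (θ * Complex.I)) := by
      intro θ
      have e1 : Complex.exp ((-2 : ℤ) * (θ * Complex.I)) = Complex.exp (-(θ * Complex.I)) *
          Complex.exp (-(θ * Complex.I)) := by rw [← Complex.exp_add]; congr 1; push_cast; ring
      have e2 : Complex.exp (-(θ * Complex.I)) * Complex.exp (θ * Complex.I) = 1 := by
        rw [← Complex.exp_add]; simp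
      rw [e1]
      linear_combination a z * e2
    simp_rw [e]
    rw [intervalIntegral.integral_add (by simp) (Continuous.intervalIntegrable (by fun_prop) _ _),
      intervalIntegral.integral_const_mul, integral_exp_mul_I_eq_zero (by norm_num),
      intervalIntegral.integral_const, mul_zero, add_zero, Complex.real_smul]
    push_cast
    ring
  rw [h2] at h1
  have h3 := (h1.neg).div_const 2
  rw [show -(2 * Real.pi * a z) / 2 = -Real.pi * a z by ring] at h3
  refine h3.congr' ?_
  filter_upwards [self_mem_nhdsWithin] with δ (hδ : 0 < δ)
  rw [h.truncation_eq hz hδ, circleMean_eq_sub hu, ← intervalIntegral.integral_div]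
  simp only [mul_div_assoc]

/-! ### The primitives of the disc kernels -/

lemma IsDecaying.mono {k : ℂ → ℂ} {C D : ℝ} (hk : IsDecaying k C) (h : C ≤ D) :
    IsDecaying k D :=
  ⟨hk.measurable, fun ζ => (hk.norm_le ζ).trans (by gcongr)⟩

lemma IsDecaying.neg {k : ℂ → ℂ} {C : ℝ} (hk : IsDecaying k C) :
    IsDecaying (fun ζ => -k ζ) C :=
  ⟨hk.measurable.neg, fun ζ => by rw [norm_neg]; exact hk.norm_le ζ⟩

lemma hasFDerivAt_wirtinger_of_hasDerivAt {f : ℂ → ℂ} {f' w : ℂ} (h : HasDerivAt f f' w) :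
    HasFDerivAt f (wirtinger f' 0) w := by
  refine (h.hasFDerivAt.restrictScalars ℝ).congr_fderiv ?_
  ext v
  simp [mul_comm]

lemma hasFDerivAt_conj (w : ℂ) : HasFDerivAt (fun w : ℂ => starRingEnd ℂ w) (wirtinger 0 1) w := by
  refine ((Complex.conjCLE : ℂ →L[ℝ] ℂ).hasFDerivAt (x := w)).congr_fderiv ?_
  ext v; simp

lemma hasFDerivAt_conj_mul {f : ℂ → ℂ} {f' w : ℂ} (h : HasDerivAt f f' w) :
    HasFDerivAt (fun w => starRingEnd ℂ w * f w) (wirtinger (starRingEnd ℂ w * f') (f w)) w := by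
  refine ((hasFDerivAt_conj w).mul (hasFDerivAt_wirtinger_of_hasDerivAt h)).congr_fderiv ?_
  ext v
  simp only [add_apply, smul_apply, wirtinger_apply, smul_eq_mul]
  ring

/-- The Lipschitz function equal to `w̄ / ε²` for `|w| ≤ ε` and to `1 / w` for `|w| ≥ ε`. Its `∂̄` is
the normalized indicator of the disc, its `∂` is minus the truncated Beurling kernel. -/
noncomputable def discPrimitive (ε : ℝ) (w : ℂ) : ℂ :=
  starRingEnd ℂ w * (((max ‖w‖ ε ^ 2)⁻¹ : ℝ) : ℂ)

/-- The indicator of the disc of radius `ε`, divided by `ε²`. -/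
noncomputable def discKernel (ε : ℝ) : ℂ → ℂ := (Metric.ball (0 : ℂ) ε).indicator fun _ => 1 / ε ^ 2

lemma discPrimitive_of_lt {ε : ℝ} {w : ℂ} (h : ‖w‖ < ε) :
    discPrimitive ε w = starRingEnd ℂ w * (1 / ε ^ 2) := by
  simp [discPrimitive, max_eq_right h.le]

lemma discPrimitive_of_gt {ε : ℝ} {w : ℂ} (h : ε < ‖w‖) :
    discPrimitive ε w = w⁻¹ := by
  rw [discPrimitive, max_eq_left h.le, Complex.inv_def, Complex.normSq_eq_norm_sq]

lemma isDecaying_discKernel {ε : ℝ} (hε : 0 < ε) :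
    IsDecaying (discKernel ε) (1 / ε ^ 2 * (1 + ε) ^ 2) where
  measurable := measurable_const.indicator measurableSet_ball
  norm_le ζ := by
    by_cases h : ζ ∈ Metric.ball (0 : ℂ) ε
    · rw [discKernel, Set.indicator_of_mem h, norm_div, norm_one, norm_pow, Complex.norm_real,
        Real.norm_of_nonneg hε.le, mul_assoc]
      refine le_mul_of_one_le_right (by positivity) ?_
      rw [← div_eq_mul_inv, one_le_div (by positivity)]
      gcongr
      exact (mem_ball_zero_iff.1 h).le
    · rw [discKernel, Set.indicator_of_notMem h, norm_zero]; positivity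

lemma eventually_norm_lt {ε : ℝ} {w : ℂ} (h : ‖w‖ < ε) : ∀ᶠ y in 𝓝 w, ‖y‖ < ε :=
  (isOpen_lt continuous_norm continuous_const).mem_nhds h

lemma eventually_lt_norm {ε : ℝ} {w : ℂ} (h : ε < ‖w‖) : ∀ᶠ y in 𝓝 w, ε < ‖y‖ :=
  (isOpen_lt continuous_const continuous_norm).mem_nhds h

/-- The truncated Beurling kernel is a multiple of the Beurling transform of the indicator of a
disc. -/
lemma exists_hasWirtinger_discPrimitive {ε : ℝ} (hε : 0 < ε) : ∃ C,
    HasWirtinger (discPrimitive ε) (fun w => -truncKernel beurlingKernel ε w) (discKernel ε)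
      ε (1 / ε) C := by
  refine ⟨max (12 * (1 + 1 / ε) ^ 2) (1 / ε ^ 2 * (1 + ε) ^ 2), ?_, ?_,
    ((isStandardKernel_beurlingKernel.isDecaying hε).neg).mono (le_max_left _ _),
    (isDecaying_discKernel hε).mono (le_max_right _ _), ?_⟩
  · unfold discPrimitive
    refine Complex.continuous_conj.mul (Complex.continuous_ofReal.comp
      (Continuous.inv₀ (by fun_prop) fun w => ?_))
    have : 0 < max ‖w‖ ε := lt_max_of_lt_right hε
    positivity
  · intro w
    have hm : 0 < max ‖w‖ ε := lt_max_of_lt_right hε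
    rw [discPrimitive, norm_mul, RCLike.norm_conj, Complex.norm_real,
      Real.norm_of_nonneg (by positivity), ← div_eq_mul_inv,
      div_le_div_iff₀ (by positivity) hε, one_mul, sq]
    exact mul_le_mul (le_max_left _ _) (le_max_right _ _) hε.le hm.le
  · intro w hw
    rcases lt_or_gt_of_ne hw with h | h
    · have e1 : truncKernel beurlingKernel ε w = 0 :=
        Set.indicator_of_notMem (by simpa using h.le) _
      have e2 : discKernel ε w = 1 / ε ^ 2 := Set.indicator_of_mem (mem_ball_zero_iff.2 h) _
      rw [e1, e2, neg_zero]
      have := hasFDerivAt_conj_mul (hasDerivAt_const w ((1 : ℂ) / ε ^ 2))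
      rw [mul_zero] at this
      refine this.congr_of_eventuallyEq ?_
      filter_upwards [eventually_norm_lt h] with y hy
      exact discPrimitive_of_lt hy
    · have hw0 : w ≠ 0 := norm_pos_iff.1 (hε.trans h)
      have e1 : truncKernel beurlingKernel ε w = 1 / w ^ 2 := Set.indicator_of_mem (by exact h) _
      have e2 : discKernel ε w = 0 :=
        Set.indicator_of_notMem (by simpa using h.le) _
      rw [e1, e2]
      have := hasFDerivAt_wirtinger_of_hasDerivAt (hasDerivAt_inv hw0)
      rw [← one_div] at this
      refine this.congr_of_eventuallyEq ?_
      filter_upwards [eventually_lt_norm h] with y hy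
      exact discPrimitive_of_gt hy

/-- The kernel `(2 ζ̄ / ζ³ - 3 ε² / ζ⁴) χ_{|ζ| > ε}` of `π⁻¹ B_ε ∘ B`. -/
noncomputable def iteratedKernel (ε : ℝ) : ℂ → ℂ :=
  truncKernel (fun ζ => 2 * starRingEnd ℂ ζ / ζ ^ 3 - 3 * ε ^ 2 / ζ ^ 4) ε

lemma isDecaying_iteratedKernel {ε : ℝ} (hε : 0 < ε) :
    IsDecaying (iteratedKernel ε) (5 * (1 + 1 / ε) ^ 2) := by
  refine isDecaying_truncKernel_of_norm_le ?_ (fun ζ hζ => ?_) (by norm_num) hε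
  · have := Complex.continuous_conj.measurable
    fun_prop
  · have h0 : 0 < ‖ζ‖ := hε.trans hζ
    refine (norm_sub_le _ _).trans ?_
    rw [norm_div, norm_div, norm_mul, norm_mul, norm_pow, norm_pow, norm_pow, RCLike.norm_conj,
      Complex.norm_real, Real.norm_of_nonneg hε.le, Complex.norm_ofNat, Complex.norm_ofNat,
      show (5 : ℝ) / ‖ζ‖ ^ 2 = 2 * ‖ζ‖ / ‖ζ‖ ^ 3 + 3 * ‖ζ‖ ^ 2 / ‖ζ‖ ^ 4 by field_simp; norm_num]
    gcongr

/-- The Lipschitz function vanishing for `|w| ≤ ε` and equal to `w̄ / w² - ε² / w³` for `|w| ≥ ε`.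
Its `∂̄` is the truncated Beurling kernel. -/
noncomputable def truncPrimitive (ε : ℝ) (w : ℂ) : ℂ :=
  starRingEnd ℂ w ^ 3 * (((max ‖w‖ ε ^ 2 - ε ^ 2) * (max ‖w‖ ε ^ 6)⁻¹ : ℝ) : ℂ)

lemma truncPrimitive_of_lt {ε : ℝ} {w : ℂ} (h : ‖w‖ < ε) : truncPrimitive ε w = 0 := by
  simp [truncPrimitive, max_eq_right h.le]

lemma truncPrimitive_of_gt {ε : ℝ} (hε : 0 < ε) {w : ℂ} (h : ε < ‖w‖) :
    truncPrimitive ε w = starRingEnd ℂ w * (w ^ 2)⁻¹ - ε ^ 2 * (w ^ 3)⁻¹ := by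
  have hw0 : w ≠ 0 := norm_pos_iff.1 (hε.trans h)
  have hc : starRingEnd ℂ w ≠ 0 := by simpa using hw0
  have e : ((‖w‖ : ℝ) : ℂ) ^ 2 = w * starRingEnd ℂ w := by
    rw [Complex.mul_conj, Complex.normSq_eq_norm_sq]; push_cast; rfl
  have e6 : ((‖w‖ : ℝ) : ℂ) ^ 6 = (w * starRingEnd ℂ w) ^ 3 := by rw [← e]; ring
  rw [truncPrimitive, max_eq_left h.le]
  push_cast
  rw [e, e6]
  field_simp

/-- The Beurling transform of the truncated Beurling kernel is a multiple of `iteratedKernel`, which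
vanishes on the disc `|ζ| < ε`. -/
lemma exists_hasWirtinger_truncPrimitive {ε : ℝ} (hε : 0 < ε) : ∃ C,
    HasWirtinger (truncPrimitive ε) (fun w => -iteratedKernel ε w) (truncKernel beurlingKernel ε)
      ε (1 / ε) C := by
  refine ⟨max (5 * (1 + 1 / ε) ^ 2) (12 * (1 + 1 / ε) ^ 2), ?_, ?_,
    ((isDecaying_iteratedKernel hε).neg).mono (le_max_left _ _),
    (isStandardKernel_beurlingKernel.isDecaying hε).mono (le_max_right _ _), ?_⟩
  · unfold truncPrimitive
    refine (Complex.continuous_conj.pow 3).mul (Complex.continuous_ofReal.comp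
      (Continuous.mul (by fun_prop) (Continuous.inv₀ (by fun_prop) fun w => ?_)))
    have : 0 < max ‖w‖ ε := lt_max_of_lt_right hε
    positivity
  · intro w
    have hm : 0 < max ‖w‖ ε := lt_max_of_lt_right hε
    have h1 : 0 ≤ max ‖w‖ ε ^ 2 - ε ^ 2 := sub_nonneg.2 (by gcongr; exact le_max_right _ _)
    rw [truncPrimitive, norm_mul, norm_pow, RCLike.norm_conj, Complex.norm_real,
      Real.norm_of_nonneg (by positivity)]
    calc ‖w‖ ^ 3 * ((max ‖w‖ ε ^ 2 - ε ^ 2) * (max ‖w‖ ε ^ 6)⁻¹)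
        ≤ max ‖w‖ ε ^ 3 * (max ‖w‖ ε ^ 2 * (max ‖w‖ ε ^ 6)⁻¹) := by
          gcongr
          · exact le_max_left _ _
          · linarith [sq_nonneg ε]
      _ = 1 / max ‖w‖ ε := by field_simp
      _ ≤ 1 / ε := by gcongr; exact le_max_right _ _
  · intro w hw
    rcases lt_or_gt_of_ne hw with h | h
    · have e1 : truncKernel beurlingKernel ε w = 0 :=
        Set.indicator_of_notMem (by simpa using h.le) _
      have e2 : iteratedKernel ε w = 0 := by
        unfold iteratedKernel truncKernel
        exact Set.indicator_of_notMem (by simpa using h.le) _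
      rw [e1, e2, neg_zero]
      have := hasFDerivAt_wirtinger_of_hasDerivAt (hasDerivAt_const w (0 : ℂ))
      refine this.congr_of_eventuallyEq ?_
      filter_upwards [eventually_norm_lt h] with y hy
      exact truncPrimitive_of_lt hy
    · have hw0 : w ≠ 0 := norm_pos_iff.1 (hε.trans h)
      have e1 : truncKernel beurlingKernel ε w = 1 / w ^ 2 := Set.indicator_of_mem (by exact h) _
      have e2 : iteratedKernel ε w = 2 * starRingEnd ℂ w / w ^ 3 - 3 * ε ^ 2 / w ^ 4 := by
        unfold iteratedKernel truncKernel
        exact Set.indicator_of_mem (by exact h) _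
      rw [e1, e2]
      have hd2 : HasDerivAt (fun w : ℂ => (w ^ 2)⁻¹) (-2 / w ^ 3) w := by
        refine ((hasDerivAt_pow 2 w).fun_inv (by positivity)).congr_deriv ?_
        field_simp
        norm_num
        ring
      have hd3 : HasDerivAt (fun w : ℂ => (w ^ 3)⁻¹) (-3 / w ^ 4) w := by
        refine ((hasDerivAt_pow 3 w).fun_inv (by positivity)).congr_deriv ?_
        field_simp
        norm_num
        ring
      have h1 := (hasFDerivAt_conj_mul hd2).sub
        (hasFDerivAt_wirtinger_of_hasDerivAt (hd3.const_mul ((ε : ℂ) ^ 2)))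
      refine (h1.congr_fderiv ?_).congr_of_eventuallyEq ?_
      · ext v
        simp only [sub_apply, wirtinger_apply]
        field_simp
        ring
      · filter_upwards [eventually_lt_norm h] with y hy
        exact truncPrimitive_of_gt hε hy

/-! ### The Beurling transform on Lipschitz functions of compact support -/

/-- Lipschitz functions of compact support: a class on which principal values exist everywhere and
which is dense in every `L^p`, `p < ∞`. -/
structure IsTest (f : ℂ → ℂ) : Prop where
  lipschitz : ∃ L, LipschitzWith L f
  hasCompactSupport : HasCompactSupport f

lemma IsTest.continuous {f : ℂ → ℂ} (hf : IsTest f) : Continuous f :=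
  hf.lipschitz.choose_spec.continuous

lemma IsTest.memLp {f : ℂ → ℂ} (hf : IsTest f) (p : ℝ≥0∞) : MemLp f p volume :=
  hf.continuous.memLp_of_hasCompactSupport hf.hasCompactSupport

lemma IsTest.integrable {f : ℂ → ℂ} (hf : IsTest f) : Integrable f :=
  memLp_one_iff_integrable.1 (hf.memLp 1)

lemma IsTest.conj {f : ℂ → ℂ} (hf : IsTest f) : IsTest (fun z => starRingEnd ℂ (f z)) where
  lipschitz := by
    obtain ⟨L, hL⟩ := hf.lipschitz
    refine ⟨L, LipschitzWith.of_dist_le_mul fun x y => ?_⟩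
    rw [dist_eq_norm, ← map_sub, RCLike.norm_conj, ← dist_eq_norm]
    exact hL.dist_le_mul x y
  hasCompactSupport := hf.hasCompactSupport.comp_left (g := starRingEnd ℂ) (map_zero _)

/-- Test functions are dense in `L^p`, `1 ≤ p < ∞`. -/
lemma exists_isTest_tendsto {p : ℝ≥0∞} (hp1 : 1 ≤ p) (hp : p ≠ ∞) {f : ℂ → ℂ}
    (hf : MemLp f p volume) : ∃ g : ℕ → ℂ → ℂ, (∀ n, IsTest (g n)) ∧
      Tendsto (fun n => eLpNorm (fun y => g n y - f y) p volume) atTop (𝓝 0) := by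
  have h : ∀ n : ℕ, ∃ g : ℂ → ℂ, IsTest g ∧ eLpNorm (fun y => g y - f y) p volume ≤
      ENNReal.ofReal (1 / ((n : ℝ) + 1)) := fun n => by
    obtain ⟨g, hg1, hg2, hg3⟩ := hf.exist_eLpNorm_sub_le hp hp1 (Nat.one_div_pos_of_nat (n := n))
    refine ⟨g, ⟨hg2.lipschitzWith_of_hasCompactSupport hg1 (by simp), hg1⟩, ?_⟩
    rw [← eLpNorm_neg]
    refine le_trans (le_of_eq ?_) hg3
    congr 1; ext y; simp
  choose g hg1 hg2 using h
  refine ⟨g, hg1, tendsto_of_tendsto_of_tendsto_of_le_of_le tendsto_const_nhds ?_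
    (fun _ => zero_le) hg2⟩
  have := ENNReal.tendsto_ofReal (tendsto_one_div_add_atTop_nhds_zero_nat (𝕜 := ℝ))
  rwa [ENNReal.ofReal_zero] at this

lemma IsTest.exists_eq_zero {f : ℂ → ℂ} (hf : IsTest f) :
    ∃ R : ℝ, 1 ≤ R ∧ ∀ y, R < ‖y‖ → f y = 0 := by
  obtain ⟨R, hR⟩ := hf.hasCompactSupport.isCompact.isBounded.subset_closedBall 0
  refine ⟨max R 1, le_max_right _ _, fun y hy => ?_⟩
  by_contra hne
  have := hR (subset_tsupport _ hne)
  rw [mem_closedBall_zero_iff] at this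
  linarith [le_max_left R 1]

lemma measurable_kernelOp {k f : ℂ → ℂ} (hk : Measurable k) (hf : Measurable f) :
    Measurable (kernelOp k f) := by
  have hm : Measurable fun p : ℂ × ℂ => f p.2 * k (p.2 - p.1) :=
    (hf.comp measurable_snd).mul (hk.comp (by fun_prop))
  exact (hm.stronglyMeasurable.integral_prod_right (ν := volume)).measurable

/-- The image of a test function under an operator with a decaying kernel decays. -/
lemma IsDecaying.exists_kernelOp {k f : ℂ → ℂ} {C : ℝ} (hk : IsDecaying k C) (hf : IsTest f) :
    ∃ D, IsDecaying (kernelOp k f) D := by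
  obtain ⟨R, hR1, hR⟩ := hf.exists_eq_zero
  refine ⟨(∫ y, ‖f y‖) * (C * (1 + R) ^ 2), measurable_kernelOp hk.measurable
    hf.continuous.measurable, fun w => ?_⟩
  rw [kernelOp, mul_assoc, ← integral_mul_const]
  refine norm_integral_le_of_norm_le (hf.integrable.norm.mul_const _)
    (Eventually.of_forall fun y => ?_)
  rw [norm_mul]
  by_cases hy : R < ‖y‖
  · rw [hR y hy]; simp
  gcongr
  refine (hk.norm_le _).trans ?_
  rw [mul_assoc]
  gcongr
  · exact hk.nonneg
  have h1 : 1 + ‖w‖ ≤ (1 + R) * (1 + ‖y - w‖) := by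
    have : ‖w‖ ≤ ‖y‖ + ‖y - w‖ := by
      have := norm_sub_le y (y - w)
      simpa using this
    have h0 := norm_nonneg (y - w)
    nlinarith [not_lt.1 hy]
  rw [← div_eq_mul_inv, inv_le_iff_one_le_mul₀ (by positivity), div_mul_eq_mul_div,
    one_le_div (by positivity), ← mul_pow]
  gcongr

lemma truncKernel_beurling_neg (ε : ℝ) (ζ : ℂ) :
    truncKernel beurlingKernel ε (-ζ) = truncKernel beurlingKernel ε ζ := by
  by_cases h : ε < ‖ζ‖ <;> simp [truncKernel, h, beurlingKernel]

lemma truncKernel_beurling_I_mul (ε : ℝ) (ζ : ℂ) :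
    truncKernel beurlingKernel ε (Complex.I * ζ) = -truncKernel beurlingKernel ε ζ := by
  by_cases h : ε < ‖ζ‖
  · simp [truncKernel, h, beurlingKernel, mul_pow]
  · simp [truncKernel, h]

lemma measurePreserving_I_mul : MeasurePreserving (fun ζ : ℂ => Complex.I * ζ) volume volume := by
  have h := (rotation ⟨Complex.I, by simp [Submonoid.unitSphere]⟩).measurePreserving
  exact h

/-- The quarter turn changes the sign of `ζ⁻²`; averaging over it exhibits the cancellation of the
kernel. -/
lemma truncation_eq_half_integral {f : ℂ → ℂ} (hf : IsTest f) {δ : ℝ} (hδ : 0 < δ) (z : ℂ) :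
    truncation beurlingKernel δ f z = (∫ ζ, (f (z + ζ) - f (z + Complex.I * ζ)) *
      truncKernel beurlingKernel δ ζ) / 2 := by
  have hint : Integrable (fun ζ => f (z + ζ) * truncKernel beurlingKernel δ ζ) := by
    have := ((isStandardKernel_beurlingKernel.isDecaying hδ).integrable one_le_two
      (by norm_num) (hf.memLp 2) z).comp_add_right z
    simpa [add_comm] using this
  have e1 : truncation beurlingKernel δ f z = ∫ ζ, f (z + ζ) * truncKernel beurlingKernel δ ζ := by
    rw [truncation_eq_kernelOp, kernelOp, ← integral_add_right_eq_self _ z]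
    simp [add_comm]
  have hemb : MeasurableEmbedding (fun ζ : ℂ => Complex.I * ζ) :=
    (Homeomorph.mulLeft₀ Complex.I Complex.I_ne_zero).measurableEmbedding
  have e2 : ∫ ζ, f (z + Complex.I * ζ) * truncKernel beurlingKernel δ ζ =
      -∫ ζ, f (z + ζ) * truncKernel beurlingKernel δ ζ := by
    have h := measurePreserving_I_mul.integral_comp hemb
      (fun ζ => f (z + ζ) * truncKernel beurlingKernel δ ζ)
    rw [← h, ← integral_neg]
    simp [truncKernel_beurling_I_mul]
  have hint2 : Integrable (fun ζ => f (z + Complex.I * ζ) * truncKernel beurlingKernel δ ζ) := by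
    have := ((measurePreserving_I_mul.integrable_comp_emb hemb).2 hint).neg
    refine this.congr (Eventually.of_forall fun ζ => ?_)
    simp [truncKernel_beurling_I_mul]
  simp_rw [sub_mul]
  rw [integral_sub hint hint2, e2, e1]
  ring

lemma integrable_indicator_inv_norm (ρ : ℝ) :
    Integrable (fun ζ : ℂ => (Set.Iic ρ).indicator (fun r => r⁻¹) ‖ζ‖) := by
  rw [integrable_fun_norm_addHaar (volume : Measure ℂ) (f := (Set.Iic ρ).indicator fun r => r⁻¹),
    Complex.finrank_real_complex]
  have h1 : IntegrableOn (fun _ : ℝ => (1 : ℝ)) (Set.Ioc 0 ρ) := by simp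
  have h2 := (integrable_indicator_iff measurableSet_Ioc).2 h1
  refine h2.integrableOn.congr_fun (fun r hr => ?_) measurableSet_Ioi
  have hr0 : (0 : ℝ) < r := hr
  by_cases h : r ≤ ρ
  · rw [Set.indicator_of_mem (by exact ⟨hr0, h⟩)]
    rw [Set.indicator_of_mem (by exact h)]
    simp [hr0.ne']
  · rw [Set.indicator_of_notMem (fun hh => h hh.2)]
    rw [Set.indicator_of_notMem (by exact h), smul_zero]

/-- The integrand in `truncation_eq_half_integral` has an integrable singularity. -/
lemma norm_quarter_turn_le {f : ℂ → ℂ} {L : ℝ≥0} (hL : LipschitzWith L f) {R : ℝ}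
    (hR : ∀ y, R < ‖y‖ → f y = 0) {z : ℂ} {ρ : ℝ} (hρ : R + ‖z‖ ≤ ρ) (ζ : ℂ) :
    ‖(f (z + ζ) - f (z + Complex.I * ζ)) * beurlingKernel ζ‖ ≤
      2 * L * (Set.Iic ρ).indicator (fun r => r⁻¹) ‖ζ‖ := by
  by_cases h : ‖ζ‖ ≤ ρ
  · rw [Set.indicator_of_mem (by exact h), norm_mul, beurlingKernel, norm_div, norm_one, norm_pow]
    have h1 : ‖f (z + ζ) - f (z + Complex.I * ζ)‖ ≤ L * (2 * ‖ζ‖) := by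
      refine (hL.norm_sub_le _ _).trans ?_
      gcongr
      rw [add_sub_add_left_eq_sub]
      refine (_root_.norm_sub_le _ _).trans ?_
      rw [norm_mul, Complex.norm_I, one_mul, two_mul]
    rcases eq_or_ne ζ 0 with rfl | h0
    · simp
    have hp : 0 < ‖ζ‖ := norm_pos_iff.2 h0
    calc _ ≤ L * (2 * ‖ζ‖) * (1 / ‖ζ‖ ^ 2) := by gcongr
      _ = _ := by field_simp
  · rw [Set.indicator_of_notMem (by exact h)]
    have h1 : ∀ η : ℂ, ‖η‖ = ‖ζ‖ → f (z + η) = 0 := fun η hη => by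
      refine hR _ ?_
      have := norm_sub_le (z + η) z
      rw [add_sub_cancel_left] at this
      linarith [not_le.1 h]
    rw [h1 ζ rfl, h1 (Complex.I * ζ) (by simp), sub_zero, zero_mul, norm_zero, mul_zero]

lemma IsTest.tendsto_truncation {f : ℂ → ℂ} (hf : IsTest f) (z : ℂ) :
    Tendsto (fun δ => truncation beurlingKernel δ f z) (𝓝[>] 0) (𝓝 (beurling f z)) := by
  suffices h : ∃ l, Tendsto (fun δ => truncation beurlingKernel δ f z) (𝓝[>] 0) (𝓝 l) by
    exact tendsto_nhds_limUnder h
  obtain ⟨L, hL⟩ := hf.lipschitz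
  obtain ⟨R, hR1, hR⟩ := hf.exists_eq_zero
  have hfc := hf.continuous
  have hK := isStandardKernel_beurlingKernel.measurable
  refine ⟨(∫ ζ, (f (z + ζ) - f (z + Complex.I * ζ)) * beurlingKernel ζ) / 2, ?_⟩
  have h1 : Tendsto (fun δ : ℝ => ∫ ζ, (f (z + ζ) - f (z + Complex.I * ζ)) *
      truncKernel beurlingKernel δ ζ) (𝓝[>] 0)
      (𝓝 (∫ ζ, (f (z + ζ) - f (z + Complex.I * ζ)) * beurlingKernel ζ)) := by
    refine tendsto_integral_filter_of_dominated_convergence _ ?_ ?_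
      ((integrable_indicator_inv_norm (R + ‖z‖)).const_mul (2 * L)) ?_
    · refine Eventually.of_forall fun δ => Measurable.aestronglyMeasurable ?_
      refine Measurable.mul (by fun_prop) ?_
      exact hK.indicator (measurableSet_lt measurable_const measurable_norm)
    · refine Eventually.of_forall fun δ => Eventually.of_forall fun ζ => ?_
      refine le_trans ?_ (norm_quarter_turn_le hL hR le_rfl ζ)
      rw [norm_mul, norm_mul]
      gcongr
      exact norm_indicator_le_norm_self _ _
    · have h0 : ∀ᵐ ζ : ℂ, ζ ≠ 0 := by
        simp [ae_iff]
      filter_upwards [h0] with ζ hζ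
      refine Tendsto.const_mul _ (tendsto_const_nhds.congr' ?_)
      have : Set.Ioo (0 : ℝ) ‖ζ‖ ∈ 𝓝[>] (0 : ℝ) := Ioo_mem_nhdsGT (norm_pos_iff.2 hζ)
      filter_upwards [this] with δ hδ
      exact (Set.indicator_of_mem (by exact hδ.2) _).symm
  refine (h1.div_const 2).congr' ?_
  filter_upwards [self_mem_nhdsWithin] with δ hδ
  exact (truncation_eq_half_integral hf hδ z).symm

/-- The truncations of the Beurling transform of a test function decay uniformly. -/
lemma IsTest.exists_norm_truncation_le {f : ℂ → ℂ} (hf : IsTest f) :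
    ∃ D : ℝ, ∀ δ > 0, ∀ w, ‖truncation beurlingKernel δ f w‖ ≤ D * ((1 + ‖w‖) ^ 2)⁻¹ := by
  obtain ⟨L, hL⟩ := hf.lipschitz
  obtain ⟨R, hR1, hR⟩ := hf.exists_eq_zero
  set D₁ := (∫ ζ : ℂ, 2 * L * (Set.Iic (3 * R)).indicator (fun r => r⁻¹) ‖ζ‖) / 2 with hD₁
  set D₂ := (∫ y, ‖f y‖) * 4 with hD₂
  have hD₂0 : 0 ≤ D₂ := mul_nonneg (integral_nonneg fun _ => norm_nonneg _) (by norm_num)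
  have hD₁0 : 0 ≤ D₁ := by
    refine div_nonneg (integral_nonneg fun ζ => mul_nonneg (by positivity) ?_) (by norm_num)
    exact Set.indicator_apply_nonneg fun _ => by positivity
  refine ⟨max (D₁ * (1 + 2 * R) ^ 2) (D₂ * 4), fun δ hδ w => ?_⟩
  rw [← div_eq_mul_inv, le_div_iff₀ (by positivity)]
  by_cases hw : ‖w‖ ≤ 2 * R
  · refine le_trans ?_ (le_max_left _ _)
    have h1 : ‖truncation beurlingKernel δ f w‖ ≤ D₁ := by
      rw [truncation_eq_half_integral hf hδ, norm_div, Complex.norm_ofNat, hD₁]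
      gcongr
      refine norm_integral_le_of_norm_le ((integrable_indicator_inv_norm (3 * R)).const_mul (2 * L))
        (Eventually.of_forall fun ζ => ?_)
      refine le_trans ?_ (norm_quarter_turn_le hL hR (z := w) (by linarith) ζ)
      rw [norm_mul, norm_mul]
      gcongr
      exact norm_indicator_le_norm_self _ _
    gcongr
  · rw [not_le] at hw
    refine le_trans ?_ (le_max_right _ _)
    have hw0 : 0 < ‖w‖ := by linarith
    have h1 : ‖truncation beurlingKernel δ f w‖ ≤ D₂ / ‖w‖ ^ 2 := by
      rw [truncation_eq_kernelOp, kernelOp, hD₂, mul_div_assoc, ← integral_mul_const]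
      refine norm_integral_le_of_norm_le (hf.integrable.norm.mul_const _)
        (Eventually.of_forall fun y => ?_)
      rw [norm_mul]
      by_cases hy : R < ‖y‖
      · rw [hR y hy]; simp
      gcongr
      refine (norm_indicator_le_norm_self _ _).trans ?_
      have h2 : ‖w‖ / 2 ≤ ‖y - w‖ := by
        have := norm_sub_norm_le w y
        rw [norm_sub_rev] at this
        linarith [not_lt.1 hy]
      rw [beurlingKernel, norm_div, norm_one, norm_pow]
      calc 1 / ‖y - w‖ ^ 2 ≤ 1 / (‖w‖ / 2) ^ 2 := by gcongr
        _ = 4 / ‖w‖ ^ 2 := by field_simp; norm_num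
    calc ‖truncation beurlingKernel δ f w‖ * (1 + ‖w‖) ^ 2
        ≤ D₂ / ‖w‖ ^ 2 * (2 * ‖w‖) ^ 2 := by gcongr; linarith
      _ = D₂ * 4 := by field_simp; norm_num

lemma measurable_truncation {K f : ℂ → ℂ} (hK : Measurable K) (hf : Measurable f) (δ : ℝ) :
    Measurable (truncation K δ f) := by
  rw [funext (truncation_eq_kernelOp K δ f)]
  exact measurable_kernelOp (hK.indicator (measurableSet_lt measurable_const measurable_norm)) hf

/-- The positive sequence `1 / (n + 1)`, along which truncation levels tend to zero. -/
lemma tendsto_one_div_nhdsGT : Tendsto (fun n : ℕ => 1 / ((n : ℝ) + 1)) atTop (𝓝[>] 0) :=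
  tendsto_nhdsWithin_iff.2 ⟨tendsto_one_div_add_atTop_nhds_zero_nat,
    Eventually.of_forall fun _ => Set.mem_Ioi.2 Nat.one_div_pos_of_nat⟩

lemma IsTest.exists_isDecaying_beurling {f : ℂ → ℂ} (hf : IsTest f) :
    ∃ D, IsDecaying (beurling f) D := by
  obtain ⟨D, hD⟩ := hf.exists_norm_truncation_le
  refine ⟨D, ?_, fun w => ?_⟩
  · refine measurable_of_tendsto_metrizable (fun n : ℕ => measurable_truncation
      isStandardKernel_beurlingKernel.measurable hf.continuous.measurable (1 / ((n : ℝ) + 1)))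
      (tendsto_pi_nhds.2 fun w => (hf.tendsto_truncation w).comp tendsto_one_div_nhdsGT)
  · refine le_of_tendsto (hf.tendsto_truncation w).norm ?_
    filter_upwards [self_mem_nhdsWithin] with δ hδ using hD δ hδ w

lemma ae_ne_and_norm_sub_ne (z : ℂ) (ε : ℝ) : ∀ᵐ y : ℂ, y - z ≠ 0 ∧ ‖y - z‖ ≠ ε := by
  filter_upwards [ae_norm_sub_ne ε z, ae_norm_sub_ne 0 z] with y h1 h2
  exact ⟨norm_ne_zero_iff.1 h2, h1⟩

/-- Transposition of the principal value: integrating `B f` against a translate of `∂̄u` is the same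
as integrating `f` against the same translate of `B(∂̄u) = -π ∂u`. -/
lemma HasWirtinger.kernelOp_beurling {u a b : ℂ → ℂ} {ε M C : ℝ} (h : HasWirtinger u a b ε M C)
    {f : ℂ → ℂ} (hf : IsTest f) (z : ℂ) :
    kernelOp b (beurling f) z = -Real.pi * kernelOp a f z := by
  obtain ⟨D, hD⟩ := hf.exists_norm_truncation_le
  have hb := h.decaying_right
  have hbz : MemLp (fun w => b (w - z)) 2 volume := hb.memLp_shift (by norm_num) z
  have hL : ∀ w, ‖w‖ ≠ ε → ‖a w‖ + ‖b w‖ ≤ C + C := fun w _ =>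
    add_le_add (h.decaying_left.norm_le_const _) (h.decaying_right.norm_le_const _)
  -- the left-hand side as a limit
  have h1 : Tendsto (fun δ : ℝ => ∫ w, b (w - z) * truncation beurlingKernel δ f w) (𝓝[>] 0)
      (𝓝 (∫ w, b (w - z) * beurling f w)) := by
    refine tendsto_integral_filter_of_dominated_convergence
      (fun w => ‖b (w - z)‖ * (D * ((1 + ‖w‖) ^ 2)⁻¹)) ?_ ?_ ?_ ?_
    · refine Eventually.of_forall fun δ => hbz.aestronglyMeasurable.mul ?_
      exact (measurable_truncation isStandardKernel_beurlingKernel.measurable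
        hf.continuous.measurable δ).aestronglyMeasurable
    · filter_upwards [self_mem_nhdsWithin] with δ hδ
      refine Eventually.of_forall fun w => ?_
      rw [norm_mul]
      gcongr
      exact hD δ hδ w
    · have := hbz.norm.integrable_mul ((memLp_inv_one_add_norm_sq (q := 2) (by norm_num)).const_mul D)
      exact this
    · exact Eventually.of_forall fun w => (hf.tendsto_truncation w).const_mul _
  -- the right-hand side as a limit
  have h2 : Tendsto (fun δ : ℝ => ∫ y, f y * truncation beurlingKernel δ b (y - z)) (𝓝[>] 0)
      (𝓝 (∫ y, f y * (-Real.pi * a (y - z)))) := by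
    refine tendsto_integral_filter_of_dominated_convergence
      (fun y => ‖f y‖ * (Real.pi * (C + C))) ?_ ?_ (hf.integrable.norm.mul_const _) ?_
    · refine Eventually.of_forall fun δ => hf.integrable.aestronglyMeasurable.mul ?_
      exact ((measurable_truncation isStandardKernel_beurlingKernel.measurable
        hb.measurable δ).comp (measurable_id.sub_const z)).aestronglyMeasurable
    · filter_upwards [self_mem_nhdsWithin] with δ hδ
      filter_upwards [ae_ne_and_norm_sub_ne z ε] with y hy
      rw [norm_mul]
      gcongr
      exact h.norm_truncation_le hL hy.1 hδ
    · filter_upwards [ae_ne_and_norm_sub_ne z ε] with y hy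
      exact (h.tendsto_truncation hy.1 hy.2).const_mul _
  have h3 : ∀ᶠ δ in 𝓝[>] (0 : ℝ), ∫ y, f y * truncation beurlingKernel δ b (y - z) =
      ∫ w, b (w - z) * truncation beurlingKernel δ f w := by
    filter_upwards [self_mem_nhdsWithin] with δ (hδ : 0 < δ)
    have hk := isStandardKernel_beurlingKernel.isDecaying hδ
    simp only [truncation_eq_kernelOp]
    rw [integral_mul_kernelOp hk one_le_two (by norm_num) hf.integrable hbz]
    simp_rw [truncKernel_beurling_neg, kernelOp_shift]
  have h4 := tendsto_nhds_unique (h2.congr' h3) h1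
  have e1 : kernelOp b (beurling f) z = ∫ w, b (w - z) * beurling f w :=
    integral_congr_ae (Eventually.of_forall fun w => mul_comm _ _)
  rw [e1, ← h4, kernelOp, ← integral_const_mul]
  congr 1; ext y; ring

/-! ### Boundedness of the Beurling transform and of its maximal operator on `L²` -/

/-- The function `1 / w̄` is antiholomorphic, so its Fourier coefficient with `e^{-iθ}` vanishes on
circles that do not surround the origin. -/
lemma circleMean_conj_inv_eq_zero {u : ℂ → ℂ} {z : ℂ} {r : ℝ} (hr : 0 < r) (hz : r < ‖z‖)
    (hu : ∀ w, ‖w - z‖ ≤ r → u w = starRingEnd ℂ w⁻¹) : circleMean u z r = 0 := by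
  have hne : ∀ w : ℂ, ‖w - z‖ ≤ r → w ≠ 0 := by
    rintro w hw rfl
    rw [zero_sub, norm_neg] at hw
    linarith
  have h0 : ∮ w in C(z, r), w⁻¹ = 0 := by
    refine Complex.circleIntegral_eq_zero_of_differentiable_on_off_countable hr.le
      Set.countable_empty ?_ ?_
    · refine continuousOn_id.inv₀ fun w hw => hne w ?_
      rwa [← dist_eq_norm]
    · rintro w ⟨hw, -⟩
      refine differentiableAt_inv (hne w ?_)
      rw [← dist_eq_norm]; exact (Metric.mem_ball.1 hw).le
  have hnorm : ∀ θ : ℝ, ‖z + r * Complex.exp (θ * Complex.I) - z‖ ≤ r := fun θ => by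
    rw [add_sub_cancel_left, norm_mul, Complex.norm_exp_ofReal_mul_I, mul_one, Complex.norm_real,
      Real.norm_of_nonneg hr.le]
  set G : ℝ → ℂ := fun θ => Complex.exp (θ * Complex.I) *
    (z + r * Complex.exp (θ * Complex.I))⁻¹ with hG
  have hper : Function.Periodic G (2 * Real.pi) := fun θ => by
    have : Complex.exp (((θ + 2 * Real.pi : ℝ) : ℂ) * Complex.I) = Complex.exp (θ * Complex.I) := by
      push_cast
      rw [add_mul, Complex.exp_add, Complex.exp_two_pi_mul_I, mul_one]
    simp only [hG, this]
  have h1 : ∫ θ in (0 : ℝ)..2 * Real.pi, G θ = 0 := by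
    have e : ∮ w in C(z, r), w⁻¹ = (r * Complex.I) * ∫ θ in (0 : ℝ)..2 * Real.pi, G θ := by
      rw [circleIntegral, ← intervalIntegral.integral_const_mul]
      congr 1; ext θ
      simp only [deriv_circleMap, circleMap, zero_add, smul_eq_mul, hG]
      ring
    rw [e] at h0
    refine (mul_eq_zero.1 h0).resolve_left (mul_ne_zero ?_ Complex.I_ne_zero)
    exact_mod_cast hr.ne'
  have h2 := hper.intervalIntegral_add_eq (-Real.pi) 0
  rw [zero_add, h1, show -Real.pi + 2 * Real.pi = Real.pi by ring] at h2
  have h3 : circleMean u z r = starRingEnd ℂ (∫ θ in (-Real.pi)..Real.pi, G θ) := by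
    rw [circleMean, intervalIntegral.integral_of_le (by linarith [Real.pi_pos]),
      intervalIntegral.integral_of_le (by linarith [Real.pi_pos]), ← integral_conj]
    congr 1; ext θ
    rw [hu _ (hnorm θ), hG, map_mul, conj_exp_mul_I]
  rw [h3, h2, map_zero]

lemma norm_discKernel_add_norm_truncKernel_le {ε : ℝ} (hε : 0 < ε) (w : ℂ) :
    ‖discKernel ε w‖ + ‖truncKernel beurlingKernel ε w‖ ≤ 1 / ε ^ 2 := by
  by_cases h : ‖w‖ < ε
  · rw [discKernel, truncKernel, Set.indicator_of_mem (mem_ball_zero_iff.2 h),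
      Set.indicator_of_notMem (by simpa using h.le), norm_zero, add_zero, norm_div, norm_one,
      norm_pow, Complex.norm_real, Real.norm_of_nonneg hε.le]
  · rw [discKernel, Set.indicator_of_notMem (by simpa using h), norm_zero, zero_add]
    by_cases h' : ε < ‖w‖
    · rw [truncKernel, Set.indicator_of_mem (by exact h'), beurlingKernel, norm_div, norm_one,
        norm_pow]
      gcongr
    · rw [truncKernel, Set.indicator_of_notMem (by exact h'), norm_zero]
      positivity

lemma kernelOp_conj (k f : ℂ → ℂ) (x : ℂ) :
    kernelOp (fun ζ => starRingEnd ℂ (k ζ)) (fun y => starRingEnd ℂ (f y)) x =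
      starRingEnd ℂ (kernelOp k f x) := by
  rw [kernelOp, kernelOp, ← integral_conj]
  simp_rw [map_mul]

/-- The autocorrelation of the truncated kernel `K_ε` is bounded by `π / ε²` and vanishes outside
the disc of radius `3 ε`. Both facts come from Green's formula for the conjugate of the primitive of
`K_ε`, which is antiholomorphic outside the disc of radius `ε`. -/
lemma norm_autocorrelation_le {ε : ℝ} (hε : 0 < ε) {ζ : ℂ} (hζ : ζ ≠ 0) :
    ‖kernelOp (fun ζ => starRingEnd ℂ (truncKernel beurlingKernel ε ζ))
      (truncKernel beurlingKernel ε) ζ‖ ≤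
      (Metric.ball (0 : ℂ) (3 * ε)).indicator (fun _ => Real.pi * (1 / ε ^ 2)) ζ := by
  obtain ⟨C, hC⟩ := exists_hasWirtinger_discPrimitive hε
  have hc := hC.conj
  have e : ‖kernelOp (fun ζ => starRingEnd ℂ (truncKernel beurlingKernel ε ζ))
      (truncKernel beurlingKernel ε) ζ‖ = ‖truncation beurlingKernel ε
        (fun w => starRingEnd ℂ (-truncKernel beurlingKernel ε w)) ζ‖ := by
    have h1 := kernelOp_conj (truncKernel beurlingKernel ε)
      (fun w => starRingEnd ℂ (truncKernel beurlingKernel ε w)) ζ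
    simp only [Complex.conj_conj] at h1
    rw [h1, RCLike.norm_conj, truncation_eq_kernelOp, kernelOp, kernelOp]
    simp_rw [map_neg, neg_mul]
    rw [integral_neg, norm_neg]
  rw [e]
  by_cases h : ζ ∈ Metric.ball (0 : ℂ) (3 * ε)
  · rw [Set.indicator_of_mem h]
    refine hc.norm_truncation_le (fun w _ => ?_) hζ hε
    rw [RCLike.norm_conj, RCLike.norm_conj, norm_neg]
    exact norm_discKernel_add_norm_truncKernel_le hε w
  · rw [Set.indicator_of_notMem h, hc.truncation_eq hζ hε, circleMean_conj_inv_eq_zero hε]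
    · simp
    · rw [mem_ball_zero_iff] at h; linarith
    · intro w hw
      rw [discPrimitive_of_gt]
      rw [mem_ball_zero_iff] at h
      have := norm_sub_norm_le ζ w
      rw [norm_sub_rev] at this
      linarith

lemma ofReal_enorm_sq (c : ℂ) : ‖c‖ₑ ^ (2 : ℝ) = ENNReal.ofReal (‖c‖ ^ 2) := by
  rw [← ofReal_norm, ENNReal.ofReal_rpow_of_nonneg (norm_nonneg _) (by norm_num)]
  norm_num

lemma truncation_eq_kernelOp_fun (K f : ℂ → ℂ) (ε : ℝ) :
    truncation K ε f = kernelOp (truncKernel K ε) f :=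
  funext (truncation_eq_kernelOp K ε f)

lemma volume_ball_eq_ofReal (z : ℂ) {r : ℝ} (hr : 0 ≤ r) :
    volume (Metric.ball z r) = ENNReal.ofReal (Real.pi * r ^ 2) := by
  rw [Complex.volume_ball, mul_comm Real.pi, ENNReal.ofReal_mul (by positivity),
    ENNReal.ofReal_pow hr]
  congr 1
  rw [← ENNReal.ofReal_coe_nnreal]; rfl

/-- The `T*T` argument: `B_ε* B_ε` is dominated by the maximal function, because its kernel, the
autocorrelation of the truncated kernel, is bounded by a multiple of the normalized indicator of a
disc. -/
lemma lintegral_truncation_sq_le_lintegral_mul {ε : ℝ} (hε : 0 < ε) {f : ℂ → ℂ} (hf : IsTest f) :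
    ∫⁻ z, ‖truncation beurlingKernel ε f z‖ₑ ^ (2 : ℝ) ≤
      ∫⁻ y, ‖f y‖ₑ * (ENNReal.ofReal (9 * Real.pi ^ 2) * maximalFn (fun w => ‖f w‖ₑ) y) := by
  set k := truncKernel beurlingKernel ε with hk
  have hkd := isStandardKernel_beurlingKernel.isDecaying hε
  rw [truncation_eq_kernelOp_fun]
  obtain ⟨D, hD⟩ := hkd.exists_kernelOp hf
  have hL2 : MemLp (kernelOp k f) 2 volume := hD.memLp (by norm_num)
  have hL2c : MemLp (fun w => starRingEnd ℂ (kernelOp k f w)) 2 volume :=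
    hD.conj.memLp (by norm_num)
  have heven : (fun ζ => k (-ζ)) = k := funext (truncKernel_beurling_neg ε)
  have h1 := integral_mul_kernelOp hkd one_le_two (by norm_num) hf.integrable hL2c
  rw [← hk, heven] at h1
  have h2 : ∀ y, ‖kernelOp k (fun w => starRingEnd ℂ (kernelOp k f w)) y‖ₑ ≤
      ENNReal.ofReal (9 * Real.pi ^ 2) * maximalFn (fun w => ‖f w‖ₑ) y := by
    intro y
    have e1 : kernelOp k (fun w => starRingEnd ℂ (kernelOp k f w)) y =
        ∫ x, starRingEnd ℂ (f x) * kernelOp (fun ζ => starRingEnd ℂ (k ζ)) k (x - y) := by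
      have h3 := integral_mul_kernelOp hkd.conj one_le_two (by norm_num) hf.conj.integrable
        (hkd.memLp_shift (q := 2) (by norm_num) y)
      simp only [kernelOp_conj, truncKernel_beurling_neg] at h3
      simp_rw [← hk] at h3
      rw [kernelOp]
      simp_rw [mul_comm (starRingEnd ℂ (kernelOp k f _))]
      rw [h3]
      congr 1; ext x
      exact congrArg _ (kernelOp_shift _ _ _ _)
    rw [e1]
    calc _ ≤ ∫⁻ x, ‖starRingEnd ℂ (f x) *
          kernelOp (fun ζ => starRingEnd ℂ (k ζ)) k (x - y)‖ₑ := enorm_integral_le_lintegral_enorm _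
      _ ≤ ∫⁻ x, (Metric.ball y (3 * ε)).indicator
          (fun x => ‖f x‖ₑ * ENNReal.ofReal (Real.pi * (1 / ε ^ 2))) x := by
          refine lintegral_mono_ae ?_
          filter_upwards [ae_ne_and_norm_sub_ne y 0] with x hx
          have h4 := norm_autocorrelation_le hε hx.1
          rw [enorm_mul]
          have e2 : ‖starRingEnd ℂ (f x)‖ₑ = ‖f x‖ₑ := by
            rw [← ofReal_norm, ← ofReal_norm, RCLike.norm_conj]
          rw [e2]
          by_cases hxy : x ∈ Metric.ball y (3 * ε)
          · rw [Set.indicator_of_mem hxy]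
            rw [Set.indicator_of_mem (by
              rwa [mem_ball_zero_iff, ← mem_ball_iff_norm])] at h4
            gcongr
            rw [← ofReal_norm]
            exact ENNReal.ofReal_le_ofReal h4
          · rw [Set.indicator_of_notMem hxy]
            rw [Set.indicator_of_notMem (by
              rwa [mem_ball_zero_iff, ← mem_ball_iff_norm])] at h4
            rw [norm_le_zero_iff.1 h4]; simp
      _ = ENNReal.ofReal (Real.pi * (1 / ε ^ 2)) * ∫⁻ x in Metric.ball y (3 * ε), ‖f x‖ₑ := by
          rw [lintegral_indicator measurableSet_ball, lintegral_mul_const' _ _ ENNReal.ofReal_ne_top,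
            mul_comm]
      _ ≤ ENNReal.ofReal (Real.pi * (1 / ε ^ 2)) *
          (volume (Metric.ball y (3 * ε)) * maximalFn (fun w => ‖f w‖ₑ) y) := by
          gcongr
          exact lintegral_ball_le_maximalFn _ (Metric.mem_ball_self (by positivity))
      _ = _ := by
          rw [volume_ball_eq_ofReal _ (by positivity), ← mul_assoc,
            ← ENNReal.ofReal_mul (by positivity)]
          congr 2
          field_simp
          norm_num
  have h3 : ∫⁻ z, ‖kernelOp k f z‖ₑ ^ (2 : ℝ) =
      ‖∫ w, starRingEnd ℂ (kernelOp k f w) * kernelOp k f w‖ₑ := by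
    have e : ∀ w, starRingEnd ℂ (kernelOp k f w) * kernelOp k f w =
        ((‖kernelOp k f w‖ ^ 2 : ℝ) : ℂ) := fun w => by
      rw [mul_comm, Complex.mul_conj, Complex.normSq_eq_norm_sq]
    simp_rw [e, ofReal_enorm_sq]
    have hi : Integrable (fun w => ‖kernelOp k f w‖ ^ 2) := by
      simpa using hL2.integrable_norm_pow (by norm_num)
    rw [integral_complex_ofReal, ← ofReal_norm, Complex.norm_real,
      Real.norm_of_nonneg (integral_nonneg fun _ => by positivity),
      ofReal_integral_eq_lintegral_ofReal hi (Eventually.of_forall fun _ => by positivity)]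
  rw [h3, h1]
  refine (enorm_integral_le_lintegral_enorm _).trans (lintegral_mono fun y => ?_)
  rw [enorm_mul]
  gcongr
  exact h2 y

/-- Uniform `L^p` bounds for the truncations `B_ε`, on test functions. -/
def UniformlyBounded (p : ℝ) : Prop :=
  ∃ C : ℝ≥0, ∀ ε > 0, ∀ f : ℂ → ℂ, IsTest f →
    ∫⁻ z, ‖truncation beurlingKernel ε f z‖ₑ ^ p ≤ C * ∫⁻ z, ‖f z‖ₑ ^ p

/-- `L^p` bounds for the maximal singular integral with kernel `K`. -/
def StrongType (K : ℂ → ℂ) (p : ℝ) : Prop :=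
  ∃ C : ℝ≥0, ∀ f : ℂ → ℂ, MemLp f (ENNReal.ofReal p) volume →
    ∫⁻ z, maximalSingular K f z ^ p ≤ C * ∫⁻ z, ‖f z‖ₑ ^ p

/-- The `L²` bound, without the Fourier transform. -/
lemma uniformlyBounded_two : UniformlyBounded 2 := by
  obtain ⟨C, hC⟩ := exists_lintegral_maximalFn_rpow_le (p := 2) (by norm_num)
  refine ⟨(9 * Real.pi ^ 2).toNNReal * C ^ (1 / 2 : ℝ), fun ε hε f hf => ?_⟩
  refine (lintegral_truncation_sq_le_lintegral_mul hε hf).trans ?_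
  have hfm : AEMeasurable (fun y => ‖f y‖ₑ) volume := hf.continuous.measurable.enorm.aemeasurable
  have hMm := (measurable_maximalFn (fun w => ‖f w‖ₑ)).aemeasurable (μ := volume)
  have e : ∀ y, ‖f y‖ₑ * (ENNReal.ofReal (9 * Real.pi ^ 2) * maximalFn (fun w => ‖f w‖ₑ) y) =
      ENNReal.ofReal (9 * Real.pi ^ 2) *
        ((fun y => ‖f y‖ₑ) * maximalFn (fun w => ‖f w‖ₑ)) y := fun y => by
    simp only [Pi.mul_apply]; ring
  simp_rw [e]
  rw [lintegral_const_mul' _ _ ENNReal.ofReal_ne_top]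
  have hH := ENNReal.lintegral_mul_le_Lp_mul_Lq volume Real.HolderConjugate.two_two hfm hMm
  have hM := ENNReal.rpow_le_rpow (hC f hf.continuous.aestronglyMeasurable)
    (z := 1 / 2) (by norm_num)
  rw [ENNReal.mul_rpow_of_nonneg _ _ (by norm_num)] at hM
  have hsq : (∫⁻ z, ‖f z‖ₑ ^ (2 : ℝ)) ^ (1 / 2 : ℝ) * (∫⁻ z, ‖f z‖ₑ ^ (2 : ℝ)) ^ (1 / 2 : ℝ) =
      ∫⁻ z, ‖f z‖ₑ ^ (2 : ℝ) := by
    rw [← ENNReal.rpow_add_of_nonneg _ _ (by norm_num) (by norm_num)]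
    norm_num
  calc _ ≤ ENNReal.ofReal (9 * Real.pi ^ 2) * ((∫⁻ z, ‖f z‖ₑ ^ (2 : ℝ)) ^ (1 / 2 : ℝ) *
        ((C : ℝ≥0∞) ^ (1 / 2 : ℝ) * (∫⁻ z, ‖f z‖ₑ ^ (2 : ℝ)) ^ (1 / 2 : ℝ))) := by
        gcongr
        exact hH.trans (by gcongr)
    _ = ENNReal.ofReal (9 * Real.pi ^ 2) * (C : ℝ≥0∞) ^ (1 / 2 : ℝ) *
        ∫⁻ z, ‖f z‖ₑ ^ (2 : ℝ) := by
        rw [show ∀ a b c : ℝ≥0∞, a * (b * (c * b)) = a * c * (b * b) from fun a b c => by ring,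
          hsq]
    _ = _ := by
        rw [ENNReal.coe_mul, ENNReal.coe_rpow_of_nonneg _ (by norm_num)]; rfl

/-- On test functions `B_ε f` is the average of `B f` over a disc of radius `ε`, since the truncated
kernel is a multiple of the Beurling transform of the indicator of that disc. -/
lemma IsTest.maximalSingular_le_maximalFn {f : ℂ → ℂ} (hf : IsTest f) (z : ℂ) :
    maximalSingular beurlingKernel f z ≤ maximalFn (fun w => ‖beurling f w‖ₑ) z := by
  refine iSup₂_le fun ε hε => ?_
  obtain ⟨C, hC⟩ := exists_hasWirtinger_discPrimitive hε
  have h1 := hC.kernelOp_beurling hf z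
  have h2 : truncation beurlingKernel ε f z = (Real.pi : ℂ)⁻¹ *
      kernelOp (discKernel ε) (beurling f) z := by
    rw [h1, truncation_eq_kernelOp, kernelOp, kernelOp]
    simp_rw [mul_neg]
    rw [integral_neg]
    have : (Real.pi : ℂ) ≠ 0 := by exact_mod_cast Real.pi_ne_zero
    field_simp
  have h3 : ‖kernelOp (discKernel ε) (beurling f) z‖ₑ ≤
      ENNReal.ofReal (1 / ε ^ 2) * ∫⁻ w in Metric.ball z ε, ‖beurling f w‖ₑ := by
    refine (enorm_integral_le_lintegral_enorm _).trans ?_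
    rw [← lintegral_const_mul' _ _ ENNReal.ofReal_ne_top, ← lintegral_indicator measurableSet_ball]
    refine lintegral_mono fun w => ?_
    rw [enorm_mul, mul_comm]
    by_cases hw : w ∈ Metric.ball z ε
    · rw [Set.indicator_of_mem hw, discKernel, Set.indicator_of_mem (by
        rwa [mem_ball_zero_iff, ← mem_ball_iff_norm])]
      gcongr
      rw [← ofReal_norm, norm_div, norm_one, norm_pow, Complex.norm_real,
        Real.norm_of_nonneg hε.le]
    · rw [discKernel, Set.indicator_of_notMem (by
        rwa [mem_ball_zero_iff, ← mem_ball_iff_norm])]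
      simp
  have h4 : ‖(Real.pi : ℂ)⁻¹‖ₑ = ENNReal.ofReal (Real.pi⁻¹) := by
    rw [← ofReal_norm, norm_inv, Complex.norm_real, Real.norm_of_nonneg Real.pi_pos.le]
  rw [h2, enorm_mul, h4]
  calc _ ≤ ENNReal.ofReal Real.pi⁻¹ * (ENNReal.ofReal (1 / ε ^ 2) *
        (volume (Metric.ball z ε) * maximalFn (fun w => ‖beurling f w‖ₑ) z)) := by
        gcongr
        refine h3.trans ?_
        gcongr
        exact lintegral_ball_le_maximalFn _ (Metric.mem_ball_self hε)
    _ = maximalFn (fun w => ‖beurling f w‖ₑ) z := by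
        rw [volume_ball_eq_ofReal _ hε.le, ← mul_assoc, ← mul_assoc,
          ← ENNReal.ofReal_mul (by positivity), ← ENNReal.ofReal_mul (by positivity)]
        have : Real.pi⁻¹ * (1 / ε ^ 2) * (Real.pi * ε ^ 2) = 1 := by
          have := Real.pi_ne_zero
          field_simp
        rw [this, ENNReal.ofReal_one, one_mul]

lemma lintegral_enorm_rpow_eq {p : ℝ} (hp : 0 < p) (f : ℂ → ℂ) :
    ∫⁻ z, ‖f z‖ₑ ^ p = eLpNorm f (ENNReal.ofReal p) volume ^ p := by
  rw [eLpNorm_eq_lintegral_rpow_enorm_toReal (by simpa using hp) ENNReal.ofReal_ne_top,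
    ENNReal.toReal_ofReal hp.le, ← ENNReal.rpow_mul, one_div_mul_cancel hp.ne', ENNReal.rpow_one]

lemma one_le_ofReal' {p : ℝ} (hp : 1 < p) : 1 ≤ ENNReal.ofReal p :=
  ENNReal.one_le_ofReal.2 hp.le

/-- Strong type bounds extend from test functions to all of `L^p`. -/
lemma strongType_of_isTest {K : ℂ → ℂ} {A p : ℝ} (hK : IsStandardKernel K A) (hp : 1 < p) {C : ℝ≥0}
    (h : ∀ f : ℂ → ℂ, IsTest f → ∫⁻ z, maximalSingular K f z ^ p ≤ C * ∫⁻ z, ‖f z‖ₑ ^ p) :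
    StrongType K p := by
  refine ⟨C, fun f hf => ?_⟩
  have hp1 := one_le_ofReal' hp
  obtain ⟨g, hg, hlim⟩ := exists_isTest_tendsto hp1 ENNReal.ofReal_ne_top hf
  have hgm := fun n => (hg n).memLp (ENNReal.ofReal p)
  have hp0 : 0 < p := by linarith
  have hle : ∀ n, ∫⁻ z, maximalSingular K (g n) z ^ p ≤
      C * (eLpNorm (fun y => g n y - f y) (ENNReal.ofReal p) volume +
        eLpNorm f (ENNReal.ofReal p) volume) ^ p := fun n => by
    refine (h _ (hg n)).trans ?_
    rw [lintegral_enorm_rpow_eq hp0]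
    gcongr
    have := eLpNorm_add_le ((hgm n).sub hf).aestronglyMeasurable hf.aestronglyMeasurable hp1
    rwa [sub_add_cancel] at this
  have hlim2 : Tendsto (fun n => (C : ℝ≥0∞) *
      (eLpNorm (fun y => g n y - f y) (ENNReal.ofReal p) volume +
        eLpNorm f (ENNReal.ofReal p) volume) ^ p) atTop
      (𝓝 (C * eLpNorm f (ENNReal.ofReal p) volume ^ p)) := by
    refine ENNReal.Tendsto.const_mul ?_ (Or.inr ENNReal.coe_ne_top)
    have := (ENNReal.continuous_rpow_const (y := p)).tendsto _ |>.comp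
      (hlim.add_const (eLpNorm f (ENNReal.ofReal p) volume))
    rwa [zero_add] at this
  rw [lintegral_enorm_rpow_eq hp0]
  calc ∫⁻ z, maximalSingular K f z ^ p
      ≤ ∫⁻ z, liminf (fun n => maximalSingular K (g n) z ^ p) atTop := by
        refine lintegral_mono fun z => ?_
        have h1 := hK.maximalSingular_le_liminf hp1 ENNReal.ofReal_ne_top hf hgm hlim z
        have h2 := (ENNReal.monotone_rpow_of_nonneg hp0.le).map_liminf_of_continuousAt
          (fun n => maximalSingular K (g n) z) (F := atTop)
          (ENNReal.continuous_rpow_const.continuousAt)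
        exact (ENNReal.rpow_le_rpow h1 hp0.le).trans_eq h2
    _ ≤ liminf (fun n => ∫⁻ z, maximalSingular K (g n) z ^ p) atTop :=
        lintegral_liminf_le fun n =>
          (hK.measurable_maximalSingular hp1 ENNReal.ofReal_ne_top (hgm n)).pow_const p
    _ ≤ liminf (fun n => (C : ℝ≥0∞) *
      (eLpNorm (fun y => g n y - f y) (ENNReal.ofReal p) volume +
        eLpNorm f (ENNReal.ofReal p) volume) ^ p) atTop :=
        liminf_le_liminf (Eventually.of_forall hle)
    _ = _ := hlim2.liminf_eq

lemma UniformlyBounded.exists_lintegral_beurling_le {p : ℝ} (h : UniformlyBounded p) :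
    ∃ C : ℝ≥0, ∀ f : ℂ → ℂ, IsTest f →
      ∫⁻ z, ‖beurling f z‖ₑ ^ p ≤ C * ∫⁻ z, ‖f z‖ₑ ^ p := by
  obtain ⟨C, hC⟩ := h
  refine ⟨C, fun f hf => ?_⟩
  calc ∫⁻ z, ‖beurling f z‖ₑ ^ p
      = ∫⁻ z, liminf (fun n : ℕ =>
          ‖truncation beurlingKernel (1 / ((n : ℝ) + 1)) f z‖ₑ ^ p) atTop := by
        refine lintegral_congr fun z => ?_
        have := ((ENNReal.continuous_rpow_const (y := p)).tendsto _).comp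
          ((hf.tendsto_truncation z).comp tendsto_one_div_nhdsGT).enorm
        exact this.liminf_eq.symm
    _ ≤ liminf (fun n : ℕ => ∫⁻ z,
          ‖truncation beurlingKernel (1 / ((n : ℝ) + 1)) f z‖ₑ ^ p) atTop :=
        lintegral_liminf_le fun n => ((measurable_truncation
          isStandardKernel_beurlingKernel.measurable hf.continuous.measurable _).enorm).pow_const p
    _ ≤ C * ∫⁻ z, ‖f z‖ₑ ^ p :=
        liminf_le_of_le (by isBoundedDefault) fun b hb => by
          obtain ⟨n, hn⟩ := hb.exists
          exact hn.trans (hC _ Nat.one_div_pos_of_nat f hf)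

/-- Since `B* f ≤ M(B f)` on test functions, `B*` is bounded as soon as `B` and the
maximal function are. -/
lemma UniformlyBounded.strongType {p : ℝ} (hp : 1 < p) (h : UniformlyBounded p) :
    StrongType beurlingKernel p := by
  obtain ⟨C, hC⟩ := h.exists_lintegral_beurling_le
  obtain ⟨D, hD⟩ := exists_lintegral_maximalFn_rpow_le hp
  refine strongType_of_isTest isStandardKernel_beurlingKernel hp (C := D * C) fun f hf => ?_
  obtain ⟨E, hE⟩ := hf.exists_isDecaying_beurling
  calc ∫⁻ z, maximalSingular beurlingKernel f z ^ p
      ≤ ∫⁻ z, maximalFn (fun w => ‖beurling f w‖ₑ) z ^ p := by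
        gcongr with z; exact hf.maximalSingular_le_maximalFn z
    _ ≤ D * ∫⁻ z, ‖beurling f z‖ₑ ^ p := hD _ hE.measurable.aestronglyMeasurable
    _ ≤ D * (C * ∫⁻ z, ‖f z‖ₑ ^ p) := by gcongr; exact hC f hf
    _ = _ := by push_cast; ring

/-! ### The Calderón–Zygmund decomposition -/

/-- Lebesgue's differentiation theorem: `|f| ≤ M f` almost everywhere. -/
lemma ae_enorm_le_maximalFn {f : ℂ → ℂ} (hf : LocallyIntegrable f volume) :
    ∀ᵐ x, ‖f x‖ₑ ≤ maximalFn (fun w => ‖f w‖ₑ) x := by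
  filter_upwards [IsUnifLocDoublingMeasure.ae_tendsto_average (volume : Measure ℂ) hf 1] with x hx
  have h1 := hx (fun _ : ℕ => x) (fun n : ℕ => 1 / ((n : ℝ) + 1)) tendsto_one_div_nhdsGT
    (Eventually.of_forall fun n => Metric.mem_closedBall_self (by positivity))
  refine le_of_tendsto h1.enorm (Eventually.of_forall fun n => ?_)
  set r : ℝ := 1 / ((n : ℝ) + 1)
  have hr : 0 < r := Nat.one_div_pos_of_nat
  have hae : (Metric.closedBall x r : Set ℂ) =ᵐ[volume] Metric.ball x r := by
    rw [← Metric.ball_union_sphere]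
    exact union_ae_eq_left_of_ae_eq_empty (ae_eq_empty.2 (Measure.addHaar_sphere volume x r))
  rw [setAverage_eq, setIntegral_congr_set hae, measureReal_congr hae, enorm_smul]
  refine le_trans ?_ (le_maximalFn (fun w => ‖f w‖ₑ) (Metric.mem_ball_self hr))
  refine mul_le_mul' (le_of_eq ?_) (enorm_integral_le_lintegral_enorm _)
  have h0 : volume (Metric.ball x r) ≠ 0 := (Metric.measure_ball_pos volume x hr).ne'
  have h1 : volume (Metric.ball x r) ≠ ∞ := measure_ball_lt_top.ne
  have hpos : 0 < (volume (Metric.ball x r)).toReal := ENNReal.toReal_pos h0 h1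
  rw [Real.enorm_of_nonneg (by positivity), measureReal_def, ENNReal.ofReal_inv_of_pos hpos,
    ENNReal.ofReal_toReal h1]

/-- A Whitney type covering of an open set of finite measure: disjoint discs `B_i` such that the
fourfold enlargements, cut down to disjoint pieces `Q_i`, fill the open set, while the elevenfold
enlargements leave it. -/
lemma exists_whitney {Ω : Set ℂ} (hΩ : IsOpen Ω) (hfin : volume Ω ≠ ∞) :
    ∃ (ι : Type) (_ : Countable ι) (c : ι → ℂ) (r : ι → ℝ) (Q : ι → Set ℂ),
      (∀ i, 0 < r i) ∧ (Pairwise fun i j => Disjoint (Metric.ball (c i) (r i))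
        (Metric.ball (c j) (r j))) ∧ (∀ i, MeasurableSet (Q i)) ∧
      (Pairwise fun i j => Disjoint (Q i) (Q j)) ∧ ⋃ i, Q i = Ω ∧
      (∀ i, Q i ⊆ Metric.closedBall (c i) (4 * r i)) ∧ (∀ i, Metric.ball (c i) (r i) ⊆ Ω) ∧
      (∀ i, ∃ p ∉ Ω, p ∈ Metric.ball (c i) (11 * r i)) := by
  have hne : (Ωᶜ).Nonempty := by
    rw [Set.nonempty_compl]
    rintro rfl
    exact hfin (measure_univ_of_isAddLeftInvariant volume)
  set d : ℂ → ℝ := fun x => Metric.infDist x Ωᶜ with hd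
  have hdpos : ∀ x ∈ Ω, 0 < d x := fun x hx => by
    rw [hd, ← hΩ.isClosed_compl.notMem_iff_infDist_pos hne]
    simpa using hx
  have hball : ∀ x, Metric.ball x (d x) ⊆ Ω := fun x => by
    simpa using (Metric.disjoint_ball_infDist (x := x) (s := Ωᶜ)).subset_compl_right
  have hbd : ∀ x ∈ Ω, d x / 10 ≤ (volume Ω).toReal + 1 := by
    intro x hx
    by_contra! hlt
    have hv : 0 ≤ (volume Ω).toReal := ENNReal.toReal_nonneg
    have h1 := ENNReal.toReal_mono hfin (measure_mono (μ := volume) (hball x))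
    rw [volume_ball_eq_ofReal _ (hdpos x hx).le, ENNReal.toReal_ofReal (by positivity)] at h1
    nlinarith [Real.pi_gt_three]
  obtain ⟨u, huΩ, hdisj, hcov⟩ := Vitali.exists_disjoint_subfamily_covering_enlargement_closedBall
    Ω id (fun x => d x / 10) _ hbd (7 / 2) (by norm_num)
  have hdisj' : u.PairwiseDisjoint fun q : ℂ => Metric.ball q (d q / 10) :=
    hdisj.mono_on fun q _ => Metric.ball_subset_closedBall
  have hcount : u.Countable := hdisj'.countable_of_isOpen (fun _ _ => Metric.isOpen_ball)
    fun q hq => ⟨q, Metric.mem_ball_self (by have := hdpos q (huΩ hq); positivity)⟩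
  have hcu : Countable u := hcount.to_subtype
  obtain ⟨e, he⟩ := Countable.exists_injective_nat u
  set B : u → Set ℂ := fun b => Metric.closedBall b.1 (4 * (d b.1 / 10)) with hB
  -- the pieces `Q_b` are made disjoint by giving each point to the first enlarged disc containing it
  refine ⟨u, hcu, fun b => b.1, fun b => d b.1 / 10,
    fun b => B b \ ⋃ b' ∈ {b' : u | e b' < e b}, B b', ?_, ?_, ?_, ?_, ?_, ?_, ?_, ?_⟩
  · intro b
    have := hdpos b.1 (huΩ b.2)
    positivity
  · intro b b' hbb'
    exact hdisj' b.2 b'.2 fun h => hbb' (Subtype.ext h)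
  · intro b
    exact Metric.isClosed_closedBall.measurableSet.diff
      (MeasurableSet.iUnion fun b' => MeasurableSet.iUnion fun _ =>
        Metric.isClosed_closedBall.measurableSet)
  · intro b b' hbb'
    rw [Set.disjoint_left]
    rintro x ⟨hx1, hx2⟩ ⟨hx3, hx4⟩
    rcases lt_or_gt_of_ne (fun h => hbb' (he h)) with h | h
    · exact hx4 (Set.mem_iUnion₂.2 ⟨b, h, hx1⟩)
    · exact hx2 (Set.mem_iUnion₂.2 ⟨b', h, hx3⟩)
  · ext x
    simp only [Set.mem_iUnion]
    constructor
    · rintro ⟨b, hx, -⟩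
      have := hdpos b.1 (huΩ b.2)
      exact hball b.1 (Metric.closedBall_subset_ball (by linarith) hx)
    · intro hx
      have hex : ∃ n, ∃ b : u, e b = n ∧ x ∈ B b := by
        obtain ⟨b, hb, hsb⟩ := hcov x hx
        refine ⟨e ⟨b, hb⟩, ⟨b, hb⟩, rfl, ?_⟩
        have hbp := hdpos b (huΩ hb)
        have h1 := hsb (Metric.mem_closedBall_self (by have := hdpos x hx; positivity))
        exact Metric.closedBall_subset_closedBall (by linarith) h1
      classical
      obtain ⟨b, hb, hxb⟩ := Nat.find_spec hex
      refine ⟨b, hxb, fun hmem => ?_⟩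
      obtain ⟨b', hb', hxb'⟩ := Set.mem_iUnion₂.1 hmem
      exact Nat.find_min hex (m := e b') (hb ▸ hb') ⟨b', rfl, hxb'⟩
  · exact fun b => Set.sdiff_subset
  · intro b
    have := hdpos b.1 (huΩ b.2)
    exact (Metric.ball_subset_ball (by linarith)).trans (hball b.1)
  · intro b
    have := hdpos b.1 (huΩ b.2)
    obtain ⟨p, hp, hlt⟩ := (Metric.infDist_lt_iff hne (x := b.1) (r := 11 * (d b.1 / 10))).1
      (by change d b.1 < _; linarith)
    exact ⟨p, hp, by rwa [Metric.mem_ball, dist_comm]⟩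

lemma tsum_indicator_of_mem {ι : Type*} {S : ι → Set ℂ}
    (hS : Pairwise fun i j => Disjoint (S i) (S j)) (h : ι → ℂ → ℂ) {i : ι} {y : ℂ} (hy : y ∈ S i) :
    ∑' j, (S j).indicator (h j) y = h i y := by
  rw [tsum_eq_single i, Set.indicator_of_mem hy]
  intro j hj
  exact Set.indicator_of_notMem (fun h' => Set.disjoint_left.1 (hS hj) h' hy) _

lemma summable_indicator {ι : Type*} {S : ι → Set ℂ}
    (hS : Pairwise fun i j => Disjoint (S i) (S j)) (h : ι → ℂ → ℂ) (y : ℂ) :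
    Summable fun j => (S j).indicator (h j) y := by
  by_cases hy : ∃ i, y ∈ S i
  · obtain ⟨i, hi⟩ := hy
    refine summable_of_ne_finset_zero (s := {i}) fun j hj => ?_
    exact Set.indicator_of_notMem
      (fun h' => Set.disjoint_left.1 (hS (by simpa using hj)) h' hi) _
  · rw [not_exists] at hy
    have : (fun j => (S j).indicator (h j) y) = 0 :=
      funext fun j => Set.indicator_of_notMem (hy j) _
    rw [this]; exact summable_zero

/-- The Calderón–Zygmund decomposition of an integrable function at height `t`: the bad part is
`∑ b_i`, with `b_i` of mean zero and supported in the disc of radius `4 r_i`. The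
integral of `f` over a Whitney piece is compensated by a constant on the disc of radius `r_i`; these
smaller discs are disjoint. -/
lemma exists_calderonZygmund {f : ℂ → ℂ} (hf : Integrable f) {t : ℝ} (ht : 0 < t) :
    ∃ (ι : Type) (_ : Countable ι) (c : ι → ℂ) (r : ι → ℝ) (b : ι → ℂ → ℂ),
      (∀ i, 0 < r i) ∧ (∀ i, Integrable (b i)) ∧ (∀ i, ∫ y, b i y = 0) ∧
      (∀ i, ∀ y ∉ Metric.closedBall (c i) (4 * r i), b i y = 0) ∧
      ∑' i, ∫⁻ y, ‖b i y‖ₑ ≤ 2 * ∫⁻ y, ‖f y‖ₑ ∧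
      volume (⋃ i, Metric.closedBall (c i) (8 * r i)) ≤
        1296 / ENNReal.ofReal t * ∫⁻ y, ‖f y‖ₑ ∧
      ∀ᵐ y, ‖f y - ∑' i, b i y‖ ≤ 121 * t := by
  set Ω : Set ℂ := {z | ENNReal.ofReal t < maximalFn (fun w => ‖f w‖ₑ) z} with hΩdef
  have ht0 : ENNReal.ofReal t ≠ 0 := by simpa using ht
  have hΩo : IsOpen Ω := (lowerSemicontinuous_maximalFn _).isOpen_preimage _
  have hΩv : volume Ω ≤ 16 / ENNReal.ofReal t * ∫⁻ y, ‖f y‖ₑ :=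
    volume_lt_maximalFn_le _ ht0 ENNReal.ofReal_ne_top
  have hN : ∫⁻ y, ‖f y‖ₑ ≠ ∞ := hf.hasFiniteIntegral.ne
  have hΩfin : volume Ω ≠ ∞ := ne_top_of_le_ne_top
    (ENNReal.mul_ne_top (ENNReal.div_ne_top (by norm_num) ht0) hN) hΩv
  obtain ⟨ι, hι, c, r, Q, hr, hBd, hQm, hQd, hQU, hQB, hBΩ, hex⟩ := exists_whitney hΩo hΩfin
  set V : ι → ℝ := fun i => Real.pi * r i ^ 2 with hV
  have hVpos : ∀ i, 0 < V i := fun i => by have := hr i; positivity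
  have hBv : ∀ i, volume (Metric.ball (c i) (r i)) = ENNReal.ofReal (V i) := fun i =>
    volume_ball_eq_ofReal _ (hr i).le
  set m : ι → ℂ := fun i => (∫ y in Q i, f y) / V i with hm
  set b : ι → ℂ → ℂ := fun i y => (Q i).indicator f y -
    (Metric.ball (c i) (r i)).indicator (fun _ => m i) y with hb
  have hBfin : ∀ i, volume (Metric.ball (c i) (r i)) ≠ ∞ := fun i => measure_ball_lt_top.ne
  have hi1 : ∀ i, Integrable ((Q i).indicator f) := fun i => hf.indicator (hQm i)
  have hi2 : ∀ i, Integrable ((Metric.ball (c i) (r i)).indicator fun _ => m i) := fun i =>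
    (integrable_indicator_iff measurableSet_ball).2 (integrableOn_const (hBfin i))
  have hmV : ∀ i, ‖m i‖ₑ * ENNReal.ofReal (V i) ≤ ∫⁻ y in Q i, ‖f y‖ₑ := fun i => by
    have : ‖m i‖ₑ * ENNReal.ofReal (V i) = ‖∫ y in Q i, f y‖ₑ := by
      rw [hm, ← ofReal_norm, ← ofReal_norm, norm_div, Complex.norm_real,
        Real.norm_of_nonneg (hVpos i).le, ← ENNReal.ofReal_mul (by have := hVpos i; positivity),
        div_mul_cancel₀ _ (hVpos i).ne']
    rw [this]; exact enorm_integral_le_lintegral_enorm _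
  have hmt : ∀ i, ‖m i‖ ≤ 121 * t := fun i => by
    obtain ⟨p, hpΩ, hp⟩ := hex i
    have h1 : ∫⁻ y in Q i, ‖f y‖ₑ ≤ ENNReal.ofReal (121 * t * V i) := by
      calc ∫⁻ y in Q i, ‖f y‖ₑ ≤ ∫⁻ y in Metric.ball (c i) (11 * r i), ‖f y‖ₑ :=
            lintegral_mono_set ((hQB i).trans
              (Metric.closedBall_subset_ball (by have := hr i; linarith)))
        _ ≤ volume (Metric.ball (c i) (11 * r i)) * maximalFn (fun w => ‖f w‖ₑ) p :=
            lintegral_ball_le_maximalFn _ hp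
        _ ≤ ENNReal.ofReal (Real.pi * (11 * r i) ^ 2) * ENNReal.ofReal t := by
            rw [volume_ball_eq_ofReal _ (by have := hr i; positivity)]
            gcongr
            exact not_lt.1 hpΩ
        _ = _ := by
            rw [← ENNReal.ofReal_mul (by positivity)]
            congr 1; rw [hV]; ring
    have h2 := (hmV i).trans h1
    rw [← ofReal_norm, ← ENNReal.ofReal_mul (norm_nonneg _),
      ENNReal.ofReal_le_ofReal_iff (by have := hVpos i; positivity)] at h2
    exact le_of_mul_le_mul_right h2 (hVpos i)
  refine ⟨ι, hι, c, r, b, hr, fun i => (hi1 i).sub (hi2 i), fun i => ?_, fun i y hy => ?_, ?_, ?_, ?_⟩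
  · simp only [hb]
    rw [integral_sub (hi1 i) (hi2 i), integral_indicator (hQm i),
      integral_indicator_const _ measurableSet_ball, measureReal_def, hBv,
      ENNReal.toReal_ofReal (hVpos i).le, hm, Complex.real_smul]
    have : (V i : ℂ) ≠ 0 := by exact_mod_cast (hVpos i).ne'
    field_simp
    ring
  · simp only [hb]
    rw [Set.indicator_of_notMem (fun h => hy (hQB i h)), Set.indicator_of_notMem (fun h => hy
      (Metric.ball_subset_closedBall.trans
        (Metric.closedBall_subset_closedBall (by have := hr i; linarith)) h)), sub_zero]
  · have h1 : ∀ i, ∫⁻ y, ‖b i y‖ₑ ≤ 2 * ∫⁻ y in Q i, ‖f y‖ₑ := fun i => by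
      calc ∫⁻ y, ‖b i y‖ₑ ≤ ∫⁻ y, (‖(Q i).indicator f y‖ₑ +
            ‖(Metric.ball (c i) (r i)).indicator (fun _ => m i) y‖ₑ) :=
            lintegral_mono fun y => enorm_sub_le
        _ = (∫⁻ y, ‖(Q i).indicator f y‖ₑ) +
            ∫⁻ y, ‖(Metric.ball (c i) (r i)).indicator (fun _ => m i) y‖ₑ :=
            lintegral_add_left' (hi1 i).aestronglyMeasurable.enorm _
        _ = (∫⁻ y in Q i, ‖f y‖ₑ) + ‖m i‖ₑ * ENNReal.ofReal (V i) := by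
            simp_rw [enorm_indicator_eq_indicator_enorm]
            rw [lintegral_indicator (hQm i), lintegral_indicator_const measurableSet_ball, hBv]
        _ ≤ _ := by rw [two_mul]; gcongr; exact hmV i
    refine (ENNReal.tsum_le_tsum h1).trans ?_
    rw [ENNReal.tsum_mul_left, ← lintegral_iUnion hQm hQd]
    gcongr
    exact Measure.restrict_le_self
  · calc volume (⋃ i, Metric.closedBall (c i) (8 * r i))
        ≤ ∑' i, volume (Metric.closedBall (c i) (8 * r i)) := measure_iUnion_le _
      _ ≤ ∑' i, 81 * volume (Metric.ball (c i) (r i)) := by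
          refine ENNReal.tsum_le_tsum fun i => ?_
          refine (measure_mono (Metric.closedBall_subset_ball (ε₂ := 9 * r i)
            (by have := hr i; linarith))).trans_eq ?_
          rw [volume_ball_mul _ (by norm_num), ← ENNReal.ofReal_pow (by norm_num)]
          norm_num
      _ = 81 * volume (⋃ i, Metric.ball (c i) (r i)) := by
          rw [ENNReal.tsum_mul_left, measure_iUnion hBd fun _ => measurableSet_ball]
      _ ≤ 81 * (16 / ENNReal.ofReal t * ∫⁻ y, ‖f y‖ₑ) := by
          gcongr
          exact (measure_mono (Set.iUnion_subset hBΩ)).trans hΩv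
      _ = _ := by rw [← mul_assoc, ← mul_div_assoc]; norm_num
  · filter_upwards [ae_enorm_le_maximalFn hf.locallyIntegrable] with y hy
    have hsum : ∑' i, b i y = (∑' i, (Q i).indicator f y) -
        ∑' i, (Metric.ball (c i) (r i)).indicator (fun _ => m i) y :=
      (summable_indicator hQd (fun _ => f) y).tsum_sub
        (summable_indicator hBd (fun i _ => m i) y)
    rw [hsum]
    by_cases hyΩ : y ∈ Ω
    · obtain ⟨i, hi⟩ := Set.mem_iUnion.1 (hQU ▸ hyΩ : y ∈ ⋃ i, Q i)
      rw [tsum_indicator_of_mem hQd (fun _ => f) hi, sub_sub_cancel]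
      by_cases hyB : ∃ j, y ∈ Metric.ball (c j) (r j)
      · obtain ⟨j, hj⟩ := hyB
        rw [tsum_indicator_of_mem hBd (fun i _ => m i) hj]
        exact hmt j
      · rw [not_exists] at hyB
        have : ∀ j, (Metric.ball (c j) (r j)).indicator (fun _ => m j) y = 0 := fun j =>
          Set.indicator_of_notMem (hyB j) _
        simp_rw [this]
        simp only [tsum_zero, norm_zero]
        positivity
    · have h1 : ∀ i, (Q i).indicator f y = 0 := fun i =>
        Set.indicator_of_notMem (fun h => hyΩ (hQU ▸ Set.mem_iUnion.2 ⟨i, h⟩)) _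
      have h2 : ∀ i, (Metric.ball (c i) (r i)).indicator (fun _ => m i) y = 0 := fun i =>
        Set.indicator_of_notMem (fun h => hyΩ (hBΩ i h)) _
      simp_rw [h1, h2]
      simp only [tsum_zero, sub_zero]
      have h3 := hy.trans (not_lt.1 hyΩ)
      rw [← ofReal_norm, ENNReal.ofReal_le_ofReal_iff ht.le] at h3
      linarith

/-! ### The weak type (1,1) bound for maximal singular integrals -/

lemma lintegral_inv_cube_le (c : ℂ) {s : ℝ} (hs : 0 < s) :
    ∫⁻ x in {x : ℂ | s < ‖x - c‖}, ENNReal.ofReal (1 / ‖x - c‖ ^ 3) ≤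
      ENNReal.ofReal (2 * Real.pi / s) := by
  have hm : ∀ c : ℂ, MeasurableSet {x : ℂ | s < ‖x - c‖} := fun c =>
    measurableSet_lt measurable_const (by fun_prop)
  set g : ℂ → ℝ≥0∞ := {x : ℂ | s < ‖x‖}.indicator fun x => ENNReal.ofReal (1 / ‖x‖ ^ 3) with hg
  have h1 : ∫⁻ x in {x : ℂ | s < ‖x - c‖}, ENNReal.ofReal (1 / ‖x - c‖ ^ 3) = ∫⁻ x, g x := by
    rw [← lintegral_indicator (hm c), ← lintegral_sub_right_eq_self g c]
    rfl
  rw [h1, ← Complex.lintegral_comp_polarCoord_symm]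
  have h2 : ∀ q ∈ polarCoord.target, ENNReal.ofReal q.1 • g (Complex.polarCoord.symm q) ≤
      (Set.Ioi s).indicator (fun r : ℝ => ENNReal.ofReal (r ^ (-2 : ℝ))) q.1 := by
    intro q hq
    have hq1 : 0 < q.1 := hq.1
    have hn : ‖Complex.polarCoord.symm q‖ = q.1 := by
      rw [Complex.norm_polarCoord_symm, abs_of_pos hq1]
    by_cases h : s < q.1
    · rw [hg, Set.indicator_of_mem (by rwa [Set.mem_ofPred_eq, hn]), Set.indicator_of_mem (by exact h), hn,
        smul_eq_mul, ← ENNReal.ofReal_mul hq1.le]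
      apply ENNReal.ofReal_le_ofReal
      rw [Real.rpow_neg hq1.le, show (2 : ℝ) = ((2 : ℕ) : ℝ) by norm_num, Real.rpow_natCast]
      apply le_of_eq
      field_simp
    · rw [hg, Set.indicator_of_notMem (by rwa [Set.mem_ofPred_eq, hn])]
      simp
  refine (setLIntegral_mono' polarCoord.open_target.measurableSet h2).trans ?_
  rw [polarCoord_target, Measure.volume_eq_prod, ← Measure.prod_restrict]
  have hmeas : Measurable ((Set.Ioi s).indicator fun r : ℝ => ENNReal.ofReal (r ^ (-2 : ℝ))) :=
    Measurable.indicator (by fun_prop) measurableSet_Ioi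
  rw [lintegral_prod (fun q : ℝ × ℝ => (Set.Ioi s).indicator
    (fun r : ℝ => ENNReal.ofReal (r ^ (-2 : ℝ))) q.1) (hmeas.comp measurable_fst).aemeasurable]
  simp only [lintegral_const, Measure.restrict_apply_univ, Real.volume_Ioo]
  rw [lintegral_mul_const _ hmeas, setLIntegral_indicator measurableSet_Ioi,
    Set.inter_eq_left.2 (Set.Ioi_subset_Ioi hs.le), lintegral_Ioi_rpow hs (by norm_num),
    ← ENNReal.ofReal_mul (by positivity)]
  apply ENNReal.ofReal_le_ofReal
  rw [show (-2 : ℝ) + 1 = -1 by norm_num, Real.rpow_neg_one]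
  apply le_of_eq
  field_simp
  ring

/-- The truncations of a singular integral at an atom, away from the support of the atom. If the
disc of truncation does not meet the support, the mean value zero and the regularity of the kernel
give decay; otherwise the truncation radius is at least comparable to the distance of `x` to the
support, and the size of the kernel suffices. -/
lemma IsStandardKernel.enorm_truncation_atom_le {K : ℂ → ℂ} {A : ℝ} (hK : IsStandardKernel K A)
    {b : ℂ → ℂ} (hb : Integrable b) (h0 : ∫ y, b y = 0) {c : ℂ} {ρ : ℝ} (hρ : 0 < ρ)
    (hsupp : ∀ y ∉ Metric.closedBall c ρ, b y = 0) {x : ℂ} (hx : 2 * ρ < ‖x - c‖) {ε : ℝ}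
    (hε : 0 < ε) :
    ‖truncation K ε b x‖ₑ ≤ ENNReal.ofReal (A * ρ / ‖x - c‖ ^ 3) * (∫⁻ y, ‖b y‖ₑ) +
      ENNReal.ofReal (A / ε ^ 2) * ∫⁻ y in Metric.ball x (3 * ε), ‖b y‖ₑ := by
  have hA := hK.nonneg
  have hk := hK.isDecaying hε
  have hb1 : MemLp b 1 volume := memLp_one_iff_integrable.2 hb
  have hint := hk.integrable le_rfl ENNReal.one_ne_top hb1 x
  rw [truncation_eq_kernelOp, kernelOp]
  by_cases hcase : ∀ y ∈ Metric.closedBall c ρ, ε < ‖y - x‖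
  -- the whole support lies in `{ε < |y - x|}`: subtract `K(c - x)` at no cost
  · refine le_add_right ?_
    have e : ∫ y, b y * truncKernel K ε (y - x) =
        ∫ y, b y * (truncKernel K ε (y - x) - K (c - x)) := by
      simp only [mul_sub]
      rw [integral_sub hint (hb.mul_const _), integral_mul_const, h0, zero_mul, sub_zero]
    rw [e, ← lintegral_const_mul' _ _ ENNReal.ofReal_ne_top]
    refine (enorm_integral_le_lintegral_enorm _).trans (lintegral_mono fun y => ?_)
    by_cases hy : y ∈ Metric.closedBall c ρ
    · have hyε : ε < ‖y - x‖ := hcase y hy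
      have hyc : ‖c - y‖ ≤ ρ := by simpa [dist_eq_norm, norm_sub_rev] using hy
      have hcx : 2 * ρ < ‖c - x‖ := by rwa [norm_sub_rev]
      have ht : truncKernel K ε (y - x) = K (y - x) := Set.indicator_of_mem (by exact hyε) _
      have e2 : c - x - (y - x) = c - y := by ring
      have h3 := hK.norm_sub_le (c - x) (y - x) (norm_pos_iff.1 (by linarith))
        (by rw [e2]; linarith)
      rw [e2] at h3
      rw [ht, enorm_mul, mul_comm]
      gcongr
      rw [← ofReal_norm, norm_sub_rev]
      apply ENNReal.ofReal_le_ofReal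
      refine h3.trans ?_
      rw [norm_sub_rev x c]
      gcongr
    · rw [hsupp y hy]; simp
  -- otherwise `ρ < ε`, and the support lies in the disc of radius `3 ε` around `x`
  · push Not at hcase
    obtain ⟨y₀, hy₀, hy₀ε⟩ := hcase
    refine le_add_left ?_
    have h1 : ‖y₀ - c‖ ≤ ρ := by simpa [dist_eq_norm] using hy₀
    have h2 : ‖x - c‖ ≤ ‖y₀ - x‖ + ‖y₀ - c‖ := by
      have := _root_.norm_sub_le (y₀ - c) (y₀ - x)
      rw [sub_sub_sub_cancel_left] at this
      linarith
    rw [← lintegral_indicator measurableSet_ball, ← lintegral_const_mul' _ _ ENNReal.ofReal_ne_top]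
    refine (enorm_integral_le_lintegral_enorm _).trans (lintegral_mono fun y => ?_)
    by_cases hy : y ∈ Metric.closedBall c ρ
    · have hyc : ‖y - c‖ ≤ ρ := by simpa [dist_eq_norm] using hy
      have h3 : y ∈ Metric.ball x (3 * ε) := by
        rw [mem_ball_iff_norm]
        have := _root_.norm_sub_le (y - c) (x - c)
        rw [sub_sub_sub_cancel_right] at this
        linarith
      rw [Set.indicator_of_mem h3, enorm_mul, mul_comm]
      gcongr
      rw [← ofReal_norm]
      apply ENNReal.ofReal_le_ofReal
      by_cases hyε : ε < ‖y - x‖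
      · have ht : truncKernel K ε (y - x) = K (y - x) := Set.indicator_of_mem (by exact hyε) _
        rw [ht]
        refine (hK.norm_le _ (norm_pos_iff.1 (hε.trans hyε))).trans ?_
        gcongr
      · have ht : truncKernel K ε (y - x) = 0 := Set.indicator_of_notMem (by exact hyε) _
        rw [ht, norm_zero]; positivity
    · rw [hsupp y hy]; simp

/-- A countable sum of atoms, away from the union of the discs of twice the radius. -/
lemma IsStandardKernel.maximalSingular_tsum_atoms_le {K : ℂ → ℂ} {A : ℝ}
    (hK : IsStandardKernel K A) {ι : Type*} [Countable ι] {b : ι → ℂ → ℂ}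
    (hb : ∀ i, Integrable (b i)) (h0 : ∀ i, ∫ y, b i y = 0) {c : ι → ℂ} {ρ : ι → ℝ}
    (hρ : ∀ i, 0 < ρ i) (hsupp : ∀ i, ∀ y ∉ Metric.closedBall (c i) (ρ i), b i y = 0)
    (hsum : ∑' i, ∫⁻ y, ‖b i y‖ₑ ≠ ∞) {x : ℂ}
    (hx : x ∉ ⋃ i, Metric.closedBall (c i) (2 * ρ i)) :
    maximalSingular K (fun y => ∑' i, b i y) x ≤
      (∑' i, ENNReal.ofReal (A * ρ i / ‖x - c i‖ ^ 3) * ∫⁻ y, ‖b i y‖ₑ) +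
        ENNReal.ofReal (9 * Real.pi * A) * maximalFn (fun y => ∑' i, ‖b i y‖ₑ) x := by
  have hA := hK.nonneg
  have hx' : ∀ i, 2 * ρ i < ‖x - c i‖ := fun i => by
    simp only [Set.mem_iUnion, not_exists] at hx
    simpa [dist_eq_norm] using hx i
  refine iSup₂_le fun ε hε => ?_
  have hk := hK.isDecaying hε
  have hT : truncation K ε (fun y => ∑' i, b i y) x = ∑' i, truncation K ε (b i) x := by
    simp_rw [truncation_eq_kernelOp, kernelOp, ← tsum_mul_right]
    refine integral_tsum (fun i => (hk.integrable le_rfl ENNReal.one_ne_top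
      (memLp_one_iff_integrable.2 (hb i)) x).aestronglyMeasurable) ?_
    refine ne_top_of_le_ne_top (ENNReal.mul_ne_top (ENNReal.ofReal_ne_top
      (r := A * (1 + 1 / ε) ^ 2)) hsum) ?_
    rw [← ENNReal.tsum_mul_left]
    refine ENNReal.tsum_le_tsum fun i => ?_
    rw [← lintegral_const_mul' _ _ ENNReal.ofReal_ne_top]
    refine lintegral_mono fun y => ?_
    rw [enorm_mul, mul_comm]
    gcongr
    rw [← ofReal_norm]
    exact ENNReal.ofReal_le_ofReal (hk.norm_le_const _)
  rw [hT]
  refine enorm_tsum_le_tsum_enorm.trans ((ENNReal.tsum_le_tsum fun i =>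
    hK.enorm_truncation_atom_le (hb i) (h0 i) (hρ i) (hsupp i) (hx' i) hε).trans ?_)
  rw [ENNReal.tsum_add]
  gcongr
  rw [ENNReal.tsum_mul_left, ← lintegral_tsum fun i => (hb i).aestronglyMeasurable.enorm.restrict]
  refine (mul_le_mul_right (lintegral_ball_le_maximalFn _
    (Metric.mem_ball_self (x := x) (by positivity))) _).trans_eq ?_
  rw [volume_ball_eq_ofReal _ (by positivity), ← mul_assoc, ← ENNReal.ofReal_mul (by positivity)]
  congr 2
  field_simp
  ring

/-- The weak type (1,1) bound for the maximal singular integral with kernel `K`. -/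
def WeakType (K : ℂ → ℂ) : Prop :=
  ∃ C : ℝ≥0, ∀ f : ℂ → ℂ, Integrable f → ∀ t : ℝ, 0 < t →
    volume {z : ℂ | ENNReal.ofReal t < maximalSingular K f z} ≤
      C / ENNReal.ofReal t * ∫⁻ z, ‖f z‖ₑ

lemma volume_lt_le_lintegral_div {F : ℂ → ℝ≥0∞} (hF : AEMeasurable F volume) {t : ℝ}
    (ht : 0 < t) : volume {z | ENNReal.ofReal t < F z} ≤ (∫⁻ z, F z) / ENNReal.ofReal t :=
  (measure_mono fun z (hz : ENNReal.ofReal t < F z) => hz.le).trans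
    (meas_ge_le_lintegral_div hF (by simpa using ht) ENNReal.ofReal_ne_top)

lemma div_ofReal_div (x : ℝ≥0∞) {t a : ℝ} (ha : 0 < a) :
    x / ENNReal.ofReal (t / a) = x * ENNReal.ofReal a / ENNReal.ofReal t := by
  rw [ENNReal.ofReal_div_of_pos ha, div_eq_mul_inv, div_eq_mul_inv, ENNReal.div_eq_inv_mul,
    ENNReal.mul_inv (by simp [ha]) (by simp), inv_inv]
  ring

/-- The contribution of the good part of the Calderón–Zygmund decomposition. -/
lemma volume_lt_maximalSingular_le_of_ae_norm_le {K : ℂ → ℂ} {A : ℝ} (hK : IsStandardKernel K A) {C : ℝ≥0}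
    (hC : ∀ f : ℂ → ℂ, MemLp f (ENNReal.ofReal 2) volume →
      ∫⁻ z, maximalSingular K f z ^ (2 : ℝ) ≤ C * ∫⁻ z, ‖f z‖ₑ ^ (2 : ℝ))
    {g : ℂ → ℂ} (hg : Integrable g) {t a : ℝ} (ht : 0 < t) (hgt : ∀ᵐ y, ‖g y‖ ≤ a * t) :
    MemLp g (ENNReal.ofReal 2) volume ∧
    volume {z | ENNReal.ofReal t < maximalSingular K g z} ≤
      C * ENNReal.ofReal a / ENNReal.ofReal t * ∫⁻ y, ‖g y‖ₑ := by
  have ht0 : ENNReal.ofReal t ≠ 0 := by simpa using ht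
  have hb : ∫⁻ y, ‖g y‖ₑ ^ (2 : ℝ) ≤ ENNReal.ofReal (a * t) * ∫⁻ y, ‖g y‖ₑ := by
    rw [← lintegral_const_mul' _ _ ENNReal.ofReal_ne_top]
    refine lintegral_mono_ae ?_
    filter_upwards [hgt] with y hy
    rw [ENNReal.rpow_two, pow_two]
    gcongr
    rw [← ofReal_norm]
    exact ENNReal.ofReal_le_ofReal hy
  have hfin : ∫⁻ y, ‖g y‖ₑ ^ (2 : ℝ) < ∞ :=
    hb.trans_lt (ENNReal.mul_lt_top ENNReal.ofReal_lt_top hg.hasFiniteIntegral)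
  have hmem : MemLp g (ENNReal.ofReal 2) volume := by
    refine ⟨hg.aestronglyMeasurable, ?_⟩
    rw [lintegral_enorm_rpow_eq (by norm_num)] at hfin
    exact (ENNReal.rpow_lt_top_iff_of_pos (by norm_num)).1 hfin
  refine ⟨hmem, ?_⟩
  have hm := hK.measurable_maximalSingular (one_le_ofReal' (by norm_num)) ENNReal.ofReal_ne_top hmem
  have h1 : volume {z | ENNReal.ofReal t < maximalSingular K g z} ≤
      (∫⁻ z, maximalSingular K g z ^ (2 : ℝ)) / ENNReal.ofReal (t ^ 2) := by
    refine le_trans (measure_mono fun z hz => ?_)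
      (volume_lt_le_lintegral_div (hm.pow_const _).aemeasurable (by positivity))
    rw [Set.mem_ofPred_eq, ENNReal.ofReal_pow ht.le, ENNReal.rpow_two]
    exact ENNReal.pow_lt_pow_left (by norm_num) hz
  refine h1.trans ?_
  calc _ ≤ C * (ENNReal.ofReal (a * t) * ∫⁻ y, ‖g y‖ₑ) / ENNReal.ofReal (t ^ 2) := by
        gcongr
        exact (hC g hmem).trans (by gcongr)
    _ = _ := by
        rw [ENNReal.ofReal_mul' ht.le, pow_two, ENNReal.ofReal_mul ht.le, div_eq_mul_inv,
          div_eq_mul_inv, ENNReal.mul_inv (Or.inl ht0) (Or.inl ENNReal.ofReal_ne_top)]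
        have : ENNReal.ofReal t * (ENNReal.ofReal t)⁻¹ = 1 :=
          ENNReal.mul_inv_cancel ht0 ENNReal.ofReal_ne_top
        calc _ = C * ENNReal.ofReal a * (ENNReal.ofReal t)⁻¹ * (∫⁻ y, ‖g y‖ₑ) *
            (ENNReal.ofReal t * (ENNReal.ofReal t)⁻¹) := by ring
          _ = _ := by rw [this, mul_one]

/-- A maximal singular integral bounded on `L²` is of weak type (1,1). -/
lemma StrongType.weakType {K : ℂ → ℂ} {A : ℝ} (hK : IsStandardKernel K A)
    (h2 : StrongType K 2) : WeakType K := by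
  obtain ⟨C, hC⟩ := h2
  have hA := hK.nonneg
  -- the summand `1` keeps `t / (4 a)` meaningful when `A = 0`
  set a : ℝ := 9 * Real.pi * A + 1 with ha
  have ha0 : 0 < a := by positivity
  refine ⟨C * 484 * 3 + 1296 + (8 * Real.pi * A).toNNReal + 128 * a.toNNReal, fun f hf t ht => ?_⟩
  have ht0 : ENNReal.ofReal t ≠ 0 := by simpa using ht
  obtain ⟨ι, hι, c, r, b, hr, hb, hb0, hsupp, hsum, hΩ, hg⟩ := exists_calderonZygmund hf ht
  set N : ℝ≥0∞ := ∫⁻ y, ‖f y‖ₑ with hN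
  have hNfin : N ≠ ∞ := hf.hasFiniteIntegral.ne
  set B : ℂ → ℂ := fun y => ∑' i, b i y with hB
  have hsumfin : ∑' i, ∫⁻ y, ‖b i y‖ₑ ≠ ∞ :=
    ne_top_of_le_ne_top (ENNReal.mul_ne_top (by norm_num) hNfin) hsum
  have hBN : ∫⁻ y, ‖B y‖ₑ ≤ 2 * N := by
    refine le_trans (lintegral_mono fun y => enorm_tsum_le_tsum_enorm) ?_
    rwa [lintegral_tsum fun i => (hb i).aestronglyMeasurable.enorm]
  have hBi : Integrable B := ⟨AEStronglyMeasurable.tsum fun i => (hb i).aestronglyMeasurable,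
    hBN.trans_lt (ENNReal.mul_lt_top (by norm_num) hNfin.lt_top)⟩
  have hgi : Integrable fun y => f y - B y := hf.sub hBi
  have hgN : ∫⁻ y, ‖f y - B y‖ₑ ≤ 3 * N := by
    calc ∫⁻ y, ‖f y - B y‖ₑ ≤ ∫⁻ y, (‖f y‖ₑ + ‖B y‖ₑ) := lintegral_mono fun y => enorm_sub_le
      _ = N + ∫⁻ y, ‖B y‖ₑ := lintegral_add_left' hf.aestronglyMeasurable.enorm _
      _ ≤ N + 2 * N := by gcongr
      _ = _ := by ring
  obtain ⟨hgL, hgood⟩ := volume_lt_maximalSingular_le_of_ae_norm_le hK hC hgi (t := t / 2) (a := 242) (by positivity)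
    (hg.mono fun y hy => hy.trans_eq (by ring))
  set Ω : Set ℂ := ⋃ i, Metric.closedBall (c i) (8 * r i) with hΩdef
  have hΩm : MeasurableSet Ω := MeasurableSet.iUnion fun i => measurableSet_closedBall
  set G : ℂ → ℝ≥0∞ := fun x => ∑' i, ENNReal.ofReal (A * (4 * r i) / ‖x - c i‖ ^ 3) *
    ∫⁻ y, ‖b i y‖ₑ with hG
  set M : ℂ → ℝ≥0∞ := maximalFn (fun y => ∑' i, ‖b i y‖ₑ) with hM
  have hGm : Measurable G := Measurable.tsum fun i => by fun_prop
  have hbad : ∀ x ∉ Ω, maximalSingular K B x ≤ G x + ENNReal.ofReal a * M x := fun x hx => by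
    refine (hK.maximalSingular_tsum_atoms_le hb hb0 (ρ := fun i => 4 * r i)
      (fun i => by have := hr i; positivity) hsupp hsumfin
      (by rw [hΩdef] at hx; convert hx using 5; ring)).trans ?_
    gcongr
    rw [ha]; linarith
  have hsub : {z | ENNReal.ofReal t < maximalSingular K f z} ⊆
      {z | ENNReal.ofReal (t / 2) < maximalSingular K (fun y => f y - B y) z} ∪ Ω ∪
      {z | ENNReal.ofReal (t / 4) < Ωᶜ.indicator G z} ∪
      {z | ENNReal.ofReal (t / (4 * a)) < M z} := by
    intro z hz
    by_contra hcon
    simp only [Set.mem_union, not_or, Set.mem_ofPred_eq, not_lt] at hcon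
    obtain ⟨⟨⟨h1, h2⟩, h3⟩, h4⟩ := hcon
    rw [Set.indicator_of_mem (by exact h2)] at h3
    have h5 := hK.maximalSingular_add_le (one_le_ofReal' (by norm_num)) ENNReal.ofReal_ne_top
      le_rfl ENNReal.one_ne_top hgL (memLp_one_iff_integrable.2 hBi) z
    simp only [sub_add_cancel] at h5
    refine absurd hz (not_lt.2 (h5.trans ?_))
    calc _ ≤ ENNReal.ofReal (t / 2) + (ENNReal.ofReal (t / 4) +
          ENNReal.ofReal a * ENNReal.ofReal (t / (4 * a))) := by
          gcongr
          exact (hbad z h2).trans (by gcongr)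
      _ = ENNReal.ofReal t := by
          rw [← ENNReal.ofReal_mul ha0.le, ← ENNReal.ofReal_add (by positivity) (by positivity),
            ← ENNReal.ofReal_add (by positivity) (by positivity)]
          congr 1
          field_simp
          ring
  have hGint : ∫⁻ z, Ωᶜ.indicator G z ≤ ENNReal.ofReal (2 * Real.pi * A) * N := by
    rw [lintegral_indicator hΩm.compl, hG, lintegral_tsum fun i => by fun_prop]
    have : ∀ i, ∫⁻ x in Ωᶜ, ENNReal.ofReal (A * (4 * r i) / ‖x - c i‖ ^ 3) * ∫⁻ y, ‖b i y‖ₑ ≤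
        ENNReal.ofReal (Real.pi * A) * ∫⁻ y, ‖b i y‖ₑ := fun i => by
      have hri := hr i
      rw [lintegral_mul_const _ (by fun_prop)]
      gcongr
      calc ∫⁻ x in Ωᶜ, ENNReal.ofReal (A * (4 * r i) / ‖x - c i‖ ^ 3)
          ≤ ∫⁻ x in {x : ℂ | 8 * r i < ‖x - c i‖},
              ENNReal.ofReal (A * (4 * r i) / ‖x - c i‖ ^ 3) := by
            refine lintegral_mono_set fun x hx => ?_
            simp only [hΩdef, Set.mem_compl_iff, Set.mem_iUnion, not_exists] at hx
            simpa [dist_eq_norm] using hx i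
        _ = ENNReal.ofReal (A * (4 * r i)) *
              ∫⁻ x in {x : ℂ | 8 * r i < ‖x - c i‖}, ENNReal.ofReal (1 / ‖x - c i‖ ^ 3) := by
            rw [← lintegral_const_mul' _ _ ENNReal.ofReal_ne_top]
            refine lintegral_congr fun x => ?_
            rw [← ENNReal.ofReal_mul (by positivity), mul_one_div]
        _ ≤ ENNReal.ofReal (A * (4 * r i)) * ENNReal.ofReal (2 * Real.pi / (8 * r i)) := by
            gcongr
            exact lintegral_inv_cube_le _ (by positivity)
        _ = _ := by
            rw [← ENNReal.ofReal_mul (by positivity)]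
            congr 1
            field_simp
            ring
    refine (ENNReal.tsum_le_tsum this).trans ?_
    rw [ENNReal.tsum_mul_left]
    calc _ ≤ ENNReal.ofReal (Real.pi * A) * (2 * N) := by gcongr
      _ = _ := by
        rw [show 2 * Real.pi * A = Real.pi * A * 2 by ring, ENNReal.ofReal_mul (p := Real.pi * A) (by positivity),
          ENNReal.ofReal_ofNat, mul_assoc]
  have hv1 : volume {z | ENNReal.ofReal (t / 2) < maximalSingular K (fun y => f y - B y) z} ≤
      C * 484 * 3 / ENNReal.ofReal t * N := by
    refine hgood.trans ?_
    rw [div_ofReal_div _ (by norm_num)]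
    refine (mul_le_mul_right hgN _).trans_eq ?_
    rw [ENNReal.ofReal_ofNat, ENNReal.ofReal_ofNat, div_eq_mul_inv, div_eq_mul_inv]
    ring
  have hv3 : volume {z | ENNReal.ofReal (t / 4) < Ωᶜ.indicator G z} ≤
      ENNReal.ofReal (8 * Real.pi * A) / ENNReal.ofReal t * N := by
    refine (volume_lt_le_lintegral_div (hGm.indicator hΩm.compl).aemeasurable
      (by positivity)).trans ?_
    rw [div_ofReal_div _ (by norm_num)]
    refine (ENNReal.div_le_div_right (mul_le_mul_left hGint _) _).trans_eq ?_
    rw [show 8 * Real.pi * A = 2 * Real.pi * A * 4 by ring,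
      ENNReal.ofReal_mul (p := 2 * Real.pi * A) (by positivity), div_eq_mul_inv, div_eq_mul_inv]
    ring
  have hv4 : volume {z | ENNReal.ofReal (t / (4 * a)) < M z} ≤
      128 * ENNReal.ofReal a / ENNReal.ofReal t * N := by
    refine (volume_lt_maximalFn_le _ (by simp only [ne_eq, ENNReal.ofReal_eq_zero, not_le]; positivity) ENNReal.ofReal_ne_top).trans ?_
    rw [div_ofReal_div _ (by positivity), lintegral_tsum fun i => (hb i).aestronglyMeasurable.enorm]
    refine (mul_le_mul_right hsum _).trans_eq ?_
    rw [ENNReal.ofReal_mul (by norm_num), ENNReal.ofReal_ofNat, div_eq_mul_inv, div_eq_mul_inv]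
    ring
  refine (measure_mono hsub).trans ((measure_union_le _ _).trans ((add_le_add ((measure_union_le _ _).trans
    (add_le_add ((measure_union_le _ _).trans (add_le_add hv1 hΩ)) hv3)) hv4).trans_eq ?_))
  push_cast
  simp only [ENNReal.add_div, add_mul]
  rfl

/-! ### `L^p` bounds for the maximal Beurling transform -/

/-- Marcinkiewicz interpolation between the weak type (1,1) and the `L²` bound. -/
lemma StrongType.of_weakType {K : ℂ → ℂ} {A : ℝ} (hK : IsStandardKernel K A) (h1 : WeakType K)
    (h2 : StrongType K 2) {p : ℝ} (hp : 1 < p) (hp2 : p < 2) : StrongType K p := by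
  obtain ⟨C₁, hC₁⟩ := h1
  obtain ⟨C₂, hC₂⟩ := h2
  refine strongType_of_isTest hK hp (C := 2 * C₁ * (p * 2 ^ (p - 1) / (p - 1)).toNNReal +
    4 * C₂ * (p * 2 ^ (p - 2) / (2 - p)).toNNReal) fun f hf => ?_
  have hfm : Measurable f := hf.continuous.measurable
  have hf2 := hf.memLp (ENNReal.ofReal 2)
  have hdist : ∀ t : ℝ, 0 < t → volume {z | ENNReal.ofReal t < maximalSingular K f z} ≤
      2 * C₁ / ENNReal.ofReal t * (∫⁻ z in {z | t < 2 * (‖f z‖₊ : ℝ)}, (‖f z‖₊ : ℝ≥0∞)) +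
      4 * C₂ / ENNReal.ofReal t ^ 2 *
        ∫⁻ z in {z | 2 * (‖f z‖₊ : ℝ) ≤ t}, (‖f z‖₊ : ℝ≥0∞) ^ 2 := by
    intro t ht
    set S : Set ℂ := {z | t < 2 * (‖f z‖₊ : ℝ)} with hS
    have hSm : MeasurableSet S := measurableSet_lt measurable_const (by fun_prop)
    have hSc : {z | 2 * (‖f z‖₊ : ℝ) ≤ t} = Sᶜ := by ext z; simp [hS]
    rw [hSc]
    have hi1 : Integrable (S.indicator f) := hf.integrable.indicator hSm
    have hi2 : MemLp (Sᶜ.indicator f) (ENNReal.ofReal 2) volume := hf2.indicator hSm.compl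
    have hsub : {z | ENNReal.ofReal t < maximalSingular K f z} ⊆
        {z | ENNReal.ofReal (t / 2) < maximalSingular K (S.indicator f) z} ∪
        {z | ENNReal.ofReal ((t / 2) ^ 2) < maximalSingular K (Sᶜ.indicator f) z ^ (2 : ℝ)} := by
      intro z hz
      by_contra hcon
      simp only [Set.mem_union, not_or, Set.mem_ofPred_eq, not_lt] at hcon
      obtain ⟨h3, h4⟩ := hcon
      rw [ENNReal.ofReal_pow (by positivity), ← ENNReal.rpow_two,
        ENNReal.rpow_le_rpow_iff (by norm_num)] at h4
      have h5 := hK.maximalSingular_add_le le_rfl ENNReal.one_ne_top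
        (one_le_ofReal' (by norm_num)) ENNReal.ofReal_ne_top
        (memLp_one_iff_integrable.2 hi1) hi2 z
      have e : (fun y => S.indicator f y + Sᶜ.indicator f y) = f :=
        Set.indicator_self_add_compl S f
      rw [e] at h5
      refine absurd hz (not_lt.2 (h5.trans ((add_le_add h3 h4).trans_eq ?_)))
      rw [← ENNReal.ofReal_add (by positivity) (by positivity), add_halves]
    refine (measure_mono hsub).trans ((measure_union_le _ _).trans (add_le_add ?_ ?_))
    · refine (hC₁ _ hi1 (t / 2) (by positivity)).trans_eq ?_
      simp_rw [enorm_indicator_eq_indicator_enorm]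
      rw [lintegral_indicator hSm, div_ofReal_div _ two_pos, ENNReal.ofReal_ofNat,
        mul_comm (C₁ : ℝ≥0∞)]
      rfl
    · have hm := hK.measurable_maximalSingular (one_le_ofReal' (by norm_num))
        ENNReal.ofReal_ne_top hi2
      refine (volume_lt_le_lintegral_div (hm.pow_const _).aemeasurable (by positivity)).trans ?_
      rw [div_pow, div_ofReal_div _ (by norm_num), ENNReal.ofReal_pow ht.le,
        show ENNReal.ofReal (2 ^ 2) = 4 by norm_num]
      refine (ENNReal.div_le_div_right (mul_le_mul_left (hC₂ _ hi2) _) _).trans_eq ?_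
      have e : ∫⁻ z, ‖Sᶜ.indicator f z‖ₑ ^ (2 : ℝ) = ∫⁻ z in Sᶜ, (‖f z‖₊ : ℝ≥0∞) ^ 2 := by
        rw [← lintegral_indicator hSm.compl]
        refine lintegral_congr fun z => ?_
        by_cases hz : z ∈ Sᶜ
        · rw [Set.indicator_of_mem hz, Set.indicator_of_mem hz, ENNReal.rpow_two]; rfl
        · rw [Set.indicator_of_notMem hz, Set.indicator_of_notMem hz]; simp
      rw [e, div_eq_mul_inv, div_eq_mul_inv]
      ring
  have hm := hK.measurable_maximalSingular (one_le_ofReal' (by norm_num)) ENNReal.ofReal_ne_top hf2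
  have hab := lintegral_layer_above (μ := (volume : Measure ℂ)) (φ := fun z => ‖f z‖₊)
    hfm.nnnorm hp (2 * C₁)
  have hbe := lintegral_layer_below (μ := (volume : Measure ℂ)) (φ := fun z => ‖f z‖₊)
    hfm.nnnorm hp hp2 (4 * C₂)
  refine (lintegral_rpow_le_lintegral_distribution hm (by linarith)).trans ?_
  refine (setLIntegral_mono' measurableSet_Ioi fun t ht => mul_le_mul_right (hdist t ht) _).trans ?_
  simp_rw [mul_add]
  refine (le_of_eq (lintegral_add_left ?_ _)).trans ((add_le_add hab hbe).trans_eq ?_)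
  · refine Measurable.mul (by fun_prop) (Measurable.mul (by fun_prop) ?_)
    have hS : MeasurableSet {q : ℝ × ℂ | q.1 < 2 * (‖f q.2‖₊ : ℝ)} :=
      measurableSet_lt (by fun_prop) (by fun_prop)
    have h3 : Measurable ({q : ℝ × ℂ | q.1 < 2 * (‖f q.2‖₊ : ℝ)}.indicator
      fun q => (‖f q.2‖₊ : ℝ≥0∞)) := Measurable.indicator (by fun_prop) hS
    have h4 : (fun t : ℝ => ∫⁻ z in {z | t < 2 * (‖f z‖₊ : ℝ)}, (‖f z‖₊ : ℝ≥0∞)) =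
        fun t => ∫⁻ z, {q : ℝ × ℂ | q.1 < 2 * (‖f q.2‖₊ : ℝ)}.indicator
          (fun q => (‖f q.2‖₊ : ℝ≥0∞)) (t, z) := by
      ext t
      have hSt : MeasurableSet {z : ℂ | t < 2 * (‖f z‖₊ : ℝ)} :=
        measurableSet_lt measurable_const (by fun_prop)
      exact (lintegral_indicator hSt fun z => (‖f z‖₊ : ℝ≥0∞)).symm
    rw [h4]
    exact h3.lintegral_prod_right'
  · push_cast
    rw [add_mul]
    rfl

/-- Duality: an `L^q` bound for `B*` bounds the truncations on the dual space. -/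
lemma StrongType.uniformlyBounded_conj {p q : ℝ} (hpq : p.HolderConjugate q) (hp2 : 2 < p)
    (h : StrongType beurlingKernel q) : UniformlyBounded p := by
  obtain ⟨C, hC⟩ := h
  refine ⟨C ^ (p - 1), fun ε hε f hf => ?_⟩
  have hp0 : 0 < p := by linarith
  have hq0 : 0 < q := hpq.symm.pos
  have hq1 : 1 < q := hpq.symm.lt
  have hK := isStandardKernel_beurlingKernel
  set h : ℂ → ℂ := truncation beurlingKernel ε f with hh
  obtain ⟨D, hD⟩ := (hK.isDecaying hε).exists_kernelOp hf
  rw [← truncation_eq_kernelOp_fun, ← hh] at hD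
  set X := ∫⁻ z, ‖h z‖ₑ ^ p with hX
  have hpq1 : (p - 1) * q = p := by
    have := hpq.sub_one_mul_conj; linarith
  have hXfin : X ≠ ∞ := by
    rw [hX, lintegral_enorm_rpow_eq hp0]
    exact ENNReal.rpow_ne_top_of_nonneg hp0.le
      (hD.memLp (by rw [ENNReal.one_lt_ofReal]; linarith)).eLpNorm_ne_top
  -- the extremal function for the duality of `L^p` and `L^q` at `h = B_ε f`
  set φ : ℂ → ℂ := fun z => starRingEnd ℂ (h z) * ((‖h z‖ ^ (p - 2) : ℝ) : ℂ) with hφ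
  have hφn : ∀ z, ‖φ z‖ = ‖h z‖ ^ (p - 1) := fun z => by
    rw [hφ, norm_mul, RCLike.norm_conj, Complex.norm_real, Real.norm_of_nonneg (by positivity)]
    rcases eq_or_ne (‖h z‖) 0 with h0 | h0
    · rw [h0, zero_mul, Real.zero_rpow (by linarith)]
    · rw [show p - 1 = 1 + (p - 2) by ring, Real.rpow_add (by positivity), Real.rpow_one]
  have hφh : ∀ z, φ z * h z = ((‖h z‖ ^ p : ℝ) : ℂ) := fun z => by
    have e : φ z * h z = ((‖h z‖ ^ 2 * ‖h z‖ ^ (p - 2) : ℝ) : ℂ) := by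
      rw [Complex.ofReal_mul, Complex.ofReal_pow, ← Complex.conj_mul']
      simp only [hφ]
      ring
    rw [e]
    rcases eq_or_ne (‖h z‖) 0 with h0 | h0
    · rw [h0, Real.zero_rpow hp0.ne']; simp
    · rw [← Real.rpow_natCast, ← Real.rpow_add (by positivity)]
      congr 2
      push_cast; ring
  have hφe : ∀ z, ‖φ z‖ₑ ^ q = ‖h z‖ₑ ^ p := fun z => by
    rw [← ofReal_norm, hφn, ← ENNReal.ofReal_rpow_of_nonneg (norm_nonneg _) (by linarith),
      ofReal_norm, ← ENNReal.rpow_mul, hpq1]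
  have hφm : Measurable φ := by
    have h1 := Complex.continuous_conj.measurable.comp hD.measurable
    exact h1.mul (Complex.measurable_ofReal.comp (hD.measurable.norm.pow_const _))
  have hφX : ∫⁻ z, ‖φ z‖ₑ ^ q = X := lintegral_congr hφe
  have hφL : MemLp φ (ENNReal.ofReal q) volume := by
    refine ⟨hφm.aestronglyMeasurable, ?_⟩
    have : eLpNorm φ (ENNReal.ofReal q) volume ^ q < ∞ := by
      rw [← lintegral_enorm_rpow_eq hq0, hφX]; exact hXfin.lt_top
    exact (ENNReal.rpow_lt_top_iff_of_pos hq0).1 this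
  have hdual : ∫ w, φ w * h w = ∫ y, f y * truncation beurlingKernel ε φ y := by
    have := integral_mul_kernelOp (hK.isDecaying hε) (one_le_ofReal' hq1) ENNReal.ofReal_ne_top
      hf.integrable hφL
    simp only [truncKernel_beurling_neg, ← truncation_eq_kernelOp] at this
    exact this
  have hXeq : X = ‖∫ w, φ w * h w‖ₑ := by
    have hint : Integrable fun w => ‖h w‖ ^ p := by
      have := (hD.memLp (q := ENNReal.ofReal p)
        (by rw [ENNReal.one_lt_ofReal]; linarith)).integrable_norm_rpow (by simpa using hp0)
        ENNReal.ofReal_ne_top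
      rwa [ENNReal.toReal_ofReal hp0.le] at this
    simp_rw [hφh]
    rw [integral_complex_ofReal, ← ofReal_norm, Complex.norm_real,
      Real.norm_of_nonneg (integral_nonneg fun w => by positivity),
      ofReal_integral_eq_lintegral_ofReal hint (Eventually.of_forall fun w => by positivity)]
    refine lintegral_congr fun w => ?_
    rw [← ENNReal.ofReal_rpow_of_nonneg (norm_nonneg _) hp0.le, ofReal_norm]
  set F := ∫⁻ z, ‖f z‖ₑ ^ p with hF
  have hle : X ≤ F ^ (1 / p) * (C * X) ^ (1 / q) := by
    calc X = ‖∫ y, f y * truncation beurlingKernel ε φ y‖ₑ := by rw [hXeq, hdual]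
      _ ≤ ∫⁻ y, ‖f y * truncation beurlingKernel ε φ y‖ₑ := enorm_integral_le_lintegral_enorm _
      _ = ∫⁻ y, ((fun y => ‖f y‖ₑ) * fun y => ‖truncation beurlingKernel ε φ y‖ₑ) y := by
          simp only [enorm_mul, Pi.mul_apply]
      _ ≤ F ^ (1 / p) * (∫⁻ y, ‖truncation beurlingKernel ε φ y‖ₑ ^ q) ^ (1 / q) :=
          ENNReal.lintegral_mul_le_Lp_mul_Lq _ hpq hf.continuous.measurable.enorm.aemeasurable
            (measurable_truncation hK.measurable hφm ε).enorm.aemeasurable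
      _ ≤ F ^ (1 / p) * (C * X) ^ (1 / q) := by
          gcongr
          rw [← hφX]
          refine le_trans (lintegral_mono fun y => ?_) (hC φ hφL)
          exact ENNReal.rpow_le_rpow (enorm_truncation_le_maximalSingular _ _ hε y) hq0.le
  -- divide by `X ^ (1 / q)`, which is finite since `h` decays
  rcases eq_or_ne X 0 with h0 | h0
  · rw [h0]; exact zero_le
  have hX1 : X = X ^ (1 / p) * X ^ (1 / q) := by
    rw [← ENNReal.rpow_add _ _ h0 hXfin, one_div, one_div, hpq.inv_add_inv_eq_one,
      ENNReal.rpow_one]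
  have h3 : X ^ (1 / p) ≤ F ^ (1 / p) * (C : ℝ≥0∞) ^ (1 / q) := by
    have h4 : X ^ (1 / q) ≠ 0 := by simp [h0, hXfin]
    have h5 : X ^ (1 / q) ≠ ∞ := ENNReal.rpow_ne_top_of_nonneg (by positivity) hXfin
    rw [← ENNReal.mul_le_mul_iff_left h4 h5]
    rw [ENNReal.mul_rpow_of_nonneg _ _ (by positivity), ← mul_assoc] at hle
    exact hX1.symm.le.trans hle
  have h6 := ENNReal.rpow_le_rpow h3 hp0.le
  rw [ENNReal.mul_rpow_of_nonneg _ _ hp0.le, ← ENNReal.rpow_mul, ← ENNReal.rpow_mul,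
    ← ENNReal.rpow_mul, one_div_mul_cancel hp0.ne', ENNReal.rpow_one, ENNReal.rpow_one] at h6
  refine h6.trans_eq ?_
  rw [mul_comm, ENNReal.coe_rpow_of_nonneg _ (by linarith)]
  congr 2
  field_simp
  linarith

/-- The maximal Beurling transform is bounded on `L^p` for `1 < p < ∞`: by interpolation below `2`, and
by duality above. -/
lemma strongType_beurlingKernel {p : ℝ} (hp : 1 < p) : StrongType beurlingKernel p := by
  have hK := isStandardKernel_beurlingKernel
  have h2 : StrongType beurlingKernel 2 := uniformlyBounded_two.strongType (by norm_num)
  rcases lt_trichotomy p 2 with h | rfl | h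
  · exact h2.of_weakType hK (h2.weakType hK) hp h
  · exact h2
  · have hpq := Real.HolderConjugate.conjExponent hp
    refine (StrongType.uniformlyBounded_conj hpq h ?_).strongType hp
    refine h2.of_weakType hK (h2.weakType hK) hpq.symm.lt ?_
    rw [Real.conjExponent, div_lt_iff₀ (by linarith)]
    linarith

/-! ### Almost everywhere convergence of the truncations -/

/-- If a maximal operator is bounded on `L^p`, then every `f ∈ L^p` is approximated by test
functions `g n` such that for almost every `z` the maximal function of `f - g n` gets arbitrarily
small at `z`. -/
lemma exists_isTest_maximal_lt {p : ℝ} (hp : 1 < p) {S : (ℂ → ℂ) → ℂ → ℝ≥0∞}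
    (hm : ∀ f : ℂ → ℂ, MemLp f (ENNReal.ofReal p) volume → Measurable (S f)) {C : ℝ≥0}
    (hC : ∀ f : ℂ → ℂ, MemLp f (ENNReal.ofReal p) volume →
      ∫⁻ z, S f z ^ p ≤ C * ∫⁻ z, ‖f z‖ₑ ^ p) {f : ℂ → ℂ}
    (hf : MemLp f (ENNReal.ofReal p) volume) :
    ∃ g : ℕ → ℂ → ℂ, (∀ n, IsTest (g n)) ∧
      ∀ᵐ z, ∀ δ : ℝ≥0∞, 0 < δ → ∃ n, S (fun y => f y - g n y) z < δ := by
  have hp0 : 0 < p := by linarith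
  obtain ⟨g, hg, hlim⟩ := exists_isTest_tendsto (one_le_ofReal' hp) ENNReal.ofReal_ne_top hf
  refine ⟨g, hg, ?_⟩
  have hd : ∀ n, MemLp (fun y => f y - g n y) (ENNReal.ofReal p) volume := fun n =>
    hf.sub ((hg n).memLp _)
  have h0 : Tendsto (fun n => ∫⁻ z, S (fun y => f y - g n y) z ^ p) atTop (𝓝 0) := by
    have h1 : Tendsto (fun n => (C : ℝ≥0∞) *
        eLpNorm (fun y => g n y - f y) (ENNReal.ofReal p) volume ^ p) atTop (𝓝 0) := by
      have h2 := ((ENNReal.continuous_rpow_const (y := p)).tendsto 0).comp hlim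
      rw [ENNReal.zero_rpow_of_pos hp0] at h2
      simpa using ENNReal.Tendsto.const_mul h2 (Or.inr (ENNReal.coe_ne_top (r := C)))
    refine tendsto_of_tendsto_of_tendsto_of_le_of_le tendsto_const_nhds h1 (fun _ => zero_le)
      fun n => (hC _ (hd n)).trans_eq ?_
    rw [← lintegral_enorm_rpow_eq hp0]
    simp_rw [enorm_sub_rev]
  -- by Fatou's lemma it is enough to look at the lower limit, so no subsequence is needed
  have h3 : ∫⁻ z, liminf (fun n => S (fun y => f y - g n y) z ^ p) atTop = 0 := by
    refine le_antisymm ((lintegral_liminf_le fun n => (hm _ (hd n)).pow_const p).trans ?_) zero_le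
    rw [h0.liminf_eq]
  have hmeas : Measurable fun z => liminf (fun n => S (fun y => f y - g n y) z ^ p) atTop :=
    Measurable.liminf fun n => (hm _ (hd n)).pow_const p
  filter_upwards [(lintegral_eq_zero_iff hmeas).1 h3] with z hz δ hδ
  have h4 : liminf (fun n => S (fun y => f y - g n y) z ^ p) atTop < δ ^ p := by
    rw [hz]; exact ENNReal.rpow_pos_of_nonneg hδ hp0.le
  obtain ⟨n, hn⟩ := (frequently_lt_of_liminf_lt (by isBoundedDefault) h4).exists
  exact ⟨n, (ENNReal.rpow_lt_rpow_iff hp0).1 hn⟩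

lemma exists_tendsto_of_forall_exists_near {F : Filter ℝ} [F.NeBot] {u : ℝ → ℂ}
    (h : ∀ δ : ℝ, 0 < δ → ∃ l, ∀ᶠ ε in F, dist (u ε) l < δ) : ∃ l, Tendsto u F (𝓝 l) := by
  have hc : Cauchy (F.map u) := by
    refine Metric.cauchy_iff.2 ⟨inferInstance, fun δ hδ => ?_⟩
    obtain ⟨l, hl⟩ := h (δ / 2) (by positivity)
    refine ⟨Metric.ball l (δ / 2), hl, fun x hx y hy => ?_⟩
    calc dist x y ≤ dist x l + dist y l := dist_triangle_right _ _ _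
      _ < δ / 2 + δ / 2 := add_lt_add hx hy
      _ = δ := add_halves δ
  exact CompleteSpace.complete hc

/-- The limit defining the Beurling transform exists almost everywhere. -/
lemma ae_tendsto_truncation_beurling {p : ℝ} (hp : 1 < p) {f : ℂ → ℂ}
    (hf : MemLp f (ENNReal.ofReal p) volume) :
    ∀ᵐ z : ℂ, Tendsto (fun ε => truncation beurlingKernel ε f z) (𝓝[>] 0) (𝓝 (beurling f z)) := by
  have hK := isStandardKernel_beurlingKernel
  have hp1 := one_le_ofReal' hp
  obtain ⟨C, hC⟩ := strongType_beurlingKernel hp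
  obtain ⟨g, hg, hgz⟩ := exists_isTest_maximal_lt hp (fun f hf =>
    hK.measurable_maximalSingular hp1 ENNReal.ofReal_ne_top hf) hC hf
  filter_upwards [hgz] with z hz
  refine tendsto_nhds_limUnder (exists_tendsto_of_forall_exists_near fun δ hδ => ?_)
  obtain ⟨n, hn⟩ := hz (ENNReal.ofReal (δ / 2)) (by simpa using hδ)
  refine ⟨beurling (g n) z, ?_⟩
  filter_upwards [(Metric.tendsto_nhds.1 ((hg n).tendsto_truncation z)) (δ / 2) (by positivity),
    self_mem_nhdsWithin] with ε h1 hε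
  have h2 := (enorm_truncation_le_maximalSingular _ _ hε z).trans_lt hn
  rw [hK.truncation_sub hp1 ENNReal.ofReal_ne_top hp1 ENNReal.ofReal_ne_top hf
    ((hg n).memLp _) hε, ← ofReal_norm, ENNReal.ofReal_lt_ofReal_iff (by positivity),
    ← dist_eq_norm] at h2
  linarith [dist_triangle (truncation beurlingKernel ε f z)
    (truncation beurlingKernel ε (g n) z) (beurling (g n) z)]

lemma ae_enorm_beurling_le {p : ℝ} (hp : 1 < p) {f : ℂ → ℂ}
    (hf : MemLp f (ENNReal.ofReal p) volume) :
    ∀ᵐ z : ℂ, ‖beurling f z‖ₑ ≤ maximalSingular beurlingKernel f z := by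
  filter_upwards [ae_tendsto_truncation_beurling hp hf] with z hz
  refine le_of_tendsto hz.enorm ?_
  filter_upwards [self_mem_nhdsWithin] with ε hε
  exact enorm_truncation_le_maximalSingular _ _ hε z

/-- `B f` inherits its integrability from `B* f`, and its measurability from the truncations. -/
lemma memLp_beurling {p : ℝ} (hp : 1 < p) {f : ℂ → ℂ} (hf : MemLp f (ENNReal.ofReal p) volume) :
    MemLp (beurling f) (ENNReal.ofReal p) volume := by
  have hp0 : 0 < p := by linarith
  obtain ⟨C, hC⟩ := strongType_beurlingKernel hp
  refine ⟨?_, ?_⟩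
  · refine aestronglyMeasurable_of_tendsto_ae atTop
      (f := fun (n : ℕ) z => truncation beurlingKernel (1 / ((n : ℝ) + 1)) f z)
      (fun n => (isStandardKernel_beurlingKernel.continuous_truncation Nat.one_div_pos_of_nat
        (one_le_ofReal' hp) ENNReal.ofReal_ne_top hf).aestronglyMeasurable) ?_
    filter_upwards [ae_tendsto_truncation_beurling hp hf] with z hz
    exact hz.comp tendsto_one_div_nhdsGT
  · rw [← ENNReal.rpow_lt_top_iff_of_pos hp0, ← lintegral_enorm_rpow_eq hp0]
    refine (lintegral_mono_ae ((ae_enorm_beurling_le hp hf).mono fun z hz =>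
      ENNReal.rpow_le_rpow hz hp0.le)).trans_lt ((hC f hf).trans_lt ?_)
    rw [lintegral_enorm_rpow_eq hp0]
    exact ENNReal.mul_lt_top ENNReal.coe_lt_top
      (ENNReal.rpow_lt_top_of_nonneg hp0.le hf.eLpNorm_ne_top)

/-- The Beurling transform is continuous on `L^p`. -/
lemma tendsto_eLpNorm_beurling_sub {p : ℝ} (hp : 1 < p) {f : ℂ → ℂ}
    (hf : MemLp f (ENNReal.ofReal p) volume) {g : ℕ → ℂ → ℂ}
    (hg : ∀ n, MemLp (g n) (ENNReal.ofReal p) volume)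
    (h : Tendsto (fun n => eLpNorm (fun y => g n y - f y) (ENNReal.ofReal p) volume) atTop (𝓝 0)) :
    Tendsto (fun n => eLpNorm (fun y => beurling (g n) y - beurling f y) (ENNReal.ofReal p) volume)
      atTop (𝓝 0) := by
  have hp0 : 0 < p := by linarith
  have hp1 := one_le_ofReal' hp
  have hK := isStandardKernel_beurlingKernel
  obtain ⟨C, hC⟩ := strongType_beurlingKernel hp
  have hle : ∀ n, eLpNorm (fun y => beurling (g n) y - beurling f y) (ENNReal.ofReal p) volume ^ p
      ≤ C * eLpNorm (fun y => g n y - f y) (ENNReal.ofReal p) volume ^ p := fun n => by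
    rw [← lintegral_enorm_rpow_eq hp0, ← lintegral_enorm_rpow_eq hp0]
    refine le_trans (lintegral_mono_ae ?_) (hC _ ((hg n).sub hf))
    filter_upwards [ae_tendsto_truncation_beurling hp hf, ae_tendsto_truncation_beurling hp (hg n)]
      with z h1 h2
    refine ENNReal.rpow_le_rpow (le_of_tendsto (h2.sub h1).enorm ?_) hp0.le
    filter_upwards [self_mem_nhdsWithin] with ε hε
    rw [← hK.truncation_sub hp1 ENNReal.ofReal_ne_top hp1 ENNReal.ofReal_ne_top (hg n) hf hε]
    exact enorm_truncation_le_maximalSingular _ _ hε z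
  have h1 : Tendsto (fun n => (C : ℝ≥0∞) *
      eLpNorm (fun y => g n y - f y) (ENNReal.ofReal p) volume ^ p) atTop (𝓝 0) := by
    have h2 := ((ENNReal.continuous_rpow_const (y := p)).tendsto 0).comp h
    rw [ENNReal.zero_rpow_of_pos hp0] at h2
    simpa using ENNReal.Tendsto.const_mul h2 (Or.inr (ENNReal.coe_ne_top (r := C)))
  have h3 := tendsto_of_tendsto_of_tendsto_of_le_of_le tendsto_const_nhds h1
    (fun _ => zero_le) hle
  have h4 := ((ENNReal.continuous_rpow_const (y := p⁻¹)).tendsto 0).comp h3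
  rw [ENNReal.zero_rpow_of_pos (by positivity)] at h4
  refine h4.congr fun n => ?_
  simp only [Function.comp_apply]
  rw [← ENNReal.rpow_mul, mul_inv_cancel₀ hp0.ne', ENNReal.rpow_one]

/-! ### The error term `ε² ∫_{|w - z| > ε} f(w) (w - z)⁻⁴ dA(w)` -/

/-- The kernel `ε² / ζ⁴`, cut off to `{|ζ| > ε}`. -/
noncomputable def quarticKernel (ε : ℝ) : ℂ → ℂ := truncKernel (fun ζ => (ε : ℂ) ^ 2 / ζ ^ 4) ε

lemma norm_quarticKernel_le {ε : ℝ} (hε : 0 < ε) (ζ : ℂ) : ‖quarticKernel ε ζ‖ ≤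
    {ζ : ℂ | ε < ‖ζ‖}.indicator (fun ζ => ε ^ 2 / ‖ζ‖ ^ 4) ζ := by
  by_cases h : ε < ‖ζ‖
  · rw [quarticKernel, truncKernel, Set.indicator_of_mem (by exact h),
      Set.indicator_of_mem (by exact h), norm_div, norm_pow, norm_pow, Complex.norm_real,
      Real.norm_of_nonneg hε.le]
  · rw [quarticKernel, truncKernel, Set.indicator_of_notMem (by exact h),
      Set.indicator_of_notMem (by exact h), norm_zero]

lemma isDecaying_quarticKernel {ε : ℝ} (hε : 0 < ε) :
    IsDecaying (quarticKernel ε) (1 * (1 + 1 / ε) ^ 2) := by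
  refine isDecaying_truncKernel_of_norm_le (by fun_prop) (fun ζ h => ?_) zero_le_one hε
  have hζ : 0 < ‖ζ‖ := hε.trans h
  rw [norm_div, norm_pow, norm_pow, Complex.norm_real, Real.norm_of_nonneg hε.le,
    div_le_div_iff₀ (by positivity) (by positivity), one_mul]
  calc ε ^ 2 * ‖ζ‖ ^ 2 ≤ ‖ζ‖ ^ 2 * ‖ζ‖ ^ 2 := by gcongr
    _ = ‖ζ‖ ^ 4 := by ring

/-- The error term is dominated by the Hardy–Littlewood maximal function at the same point. -/
lemma enorm_kernelOp_quarticKernel_le {f : ℂ → ℂ} (hf : AEStronglyMeasurable f volume) {ε : ℝ}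
    (hε : 0 < ε) (z : ℂ) : ‖kernelOp (quarticKernel ε) f z‖ₑ ≤
      ENNReal.ofReal (2 * Real.pi) * hardyLittlewood f z := by
  refine le_trans ?_ (lintegral_inv_pow_four_le f hf hε z)
  have hm : MeasurableSet {w : ℂ | ε < ‖w - z‖} :=
    measurableSet_lt measurable_const (by fun_prop)
  rw [← lintegral_indicator hm]
  refine (enorm_integral_le_lintegral_enorm _).trans (lintegral_mono fun w => ?_)
  have h1 := norm_quarticKernel_le hε (w - z)
  rw [enorm_mul]
  by_cases h : ε < ‖w - z‖
  · rw [Set.indicator_of_mem (by exact h)] at h1 ⊢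
    gcongr
    rw [← ofReal_norm]
    exact ENNReal.ofReal_le_ofReal h1
  · rw [Set.indicator_of_notMem (by exact h)] at h1 ⊢
    rw [norm_le_zero_iff.1 h1]
    simp

/-- The quartic kernel changes sign under rotation by `π / 4`, so it has mean zero. -/
lemma integral_quarticKernel (ε : ℝ) : ∫ ζ, quarticKernel ε ζ = 0 := by
  set c : Circle := Circle.exp (Real.pi / 4) with hc
  have hc4 : (c : ℂ) ^ 4 = -1 := by
    rw [hc, Circle.coe_exp, ← Complex.exp_nat_mul]
    rw [show ((4 : ℕ) : ℂ) * (((Real.pi / 4 : ℝ) : ℂ) * Complex.I) = Real.pi * Complex.I by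
      push_cast; ring]
    exact Complex.exp_pi_mul_I
  have h := (rotation c).measurePreserving
  have h1 := h.integral_comp (rotation c).toHomeomorph.measurableEmbedding (quarticKernel ε)
  have h2 : ∀ ζ, quarticKernel ε (rotation c ζ) = -quarticKernel ε ζ := fun ζ => by
    have hn : ‖(c : ℂ) * ζ‖ = ‖ζ‖ := by rw [norm_mul, Circle.norm_coe, one_mul]
    rw [rotation_apply, quarticKernel, truncKernel]
    by_cases hζ : ε < ‖ζ‖
    · rw [Set.indicator_of_mem (by rwa [Set.mem_ofPred_eq, hn]),
        Set.indicator_of_mem (by exact hζ), mul_pow, hc4]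
      ring
    · rw [Set.indicator_of_notMem (by rwa [Set.mem_ofPred_eq, hn]),
        Set.indicator_of_notMem (by exact hζ), neg_zero]
  simp_rw [h2, integral_neg] at h1
  exact self_eq_neg.1 h1.symm

/-- On Lipschitz functions the error term is `O(ε)`, by the cancellation of the quartic kernel. -/
lemma IsTest.tendsto_kernelOp_quarticKernel {f : ℂ → ℂ} (hf : IsTest f) (z : ℂ) :
    Tendsto (fun ε => kernelOp (quarticKernel ε) f z) (𝓝[>] 0) (𝓝 0) := by
  obtain ⟨L, hL⟩ := hf.lipschitz
  have hle : ∀ ε : ℝ, 0 < ε → ‖kernelOp (quarticKernel ε) f z‖ ≤ L * (2 * Real.pi) * ε := by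
    intro ε hε
    have hm : MeasurableSet {w : ℂ | ε < ‖w - z‖} :=
      measurableSet_lt measurable_const (by fun_prop)
    have hk := isDecaying_quarticKernel hε
    have hki : Integrable fun w => quarticKernel ε (w - z) := by
      refine ⟨(hk.measurable.comp (measurable_id.sub_const z)).aestronglyMeasurable, ?_⟩
      have : ∫⁻ w, ‖quarticKernel ε (w - z)‖ₑ ≤
          ∫⁻ w in {w : ℂ | ε < ‖w - z‖}, ENNReal.ofReal ε * ENNReal.ofReal (1 / ‖w - z‖ ^ 3) := by
        rw [← lintegral_indicator hm]
        refine lintegral_mono fun w => ?_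
        have h1 := norm_quarticKernel_le hε (w - z)
        by_cases h : ε < ‖w - z‖
        · have hw : 0 < ‖w - z‖ := hε.trans h
          rw [Set.indicator_of_mem (by exact h)] at h1 ⊢
          rw [← ofReal_norm, ← ENNReal.ofReal_mul hε.le]
          apply ENNReal.ofReal_le_ofReal
          refine h1.trans ?_
          rw [mul_one_div, div_le_div_iff₀ (by positivity) (by positivity)]
          calc ε ^ 2 * ‖w - z‖ ^ 3 = ε * ε * ‖w - z‖ ^ 3 := by ring
            _ ≤ ε * ‖w - z‖ * ‖w - z‖ ^ 3 := by gcongr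
            _ = _ := by ring
        · rw [Set.indicator_of_notMem (by exact h)] at h1 ⊢
          rw [norm_le_zero_iff.1 h1]
          simp
      refine this.trans_lt ?_
      rw [lintegral_const_mul' _ _ ENNReal.ofReal_ne_top]
      exact ENNReal.mul_lt_top ENNReal.ofReal_lt_top
        ((lintegral_inv_cube_le z hε).trans_lt ENNReal.ofReal_lt_top)
    have e : kernelOp (quarticKernel ε) f z =
        ∫ w, (f w - f z) * quarticKernel ε (w - z) := by
      simp_rw [sub_mul]
      rw [integral_sub (hk.integrable le_rfl ENNReal.one_ne_top (hf.memLp 1) z) (hki.const_mul _),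
        integral_const_mul, integral_sub_right_eq_self (quarticKernel ε), integral_quarticKernel,
        mul_zero, sub_zero, kernelOp]
    have h2 : ‖kernelOp (quarticKernel ε) f z‖ₑ ≤ ENNReal.ofReal (L * (2 * Real.pi) * ε) := by
      rw [e]
      calc _ ≤ ∫⁻ w, ‖(f w - f z) * quarticKernel ε (w - z)‖ₑ :=
            enorm_integral_le_lintegral_enorm _
        _ ≤ ∫⁻ w in {w : ℂ | ε < ‖w - z‖},
              ENNReal.ofReal (L * ε ^ 2) * ENNReal.ofReal (1 / ‖w - z‖ ^ 3) := by
            rw [← lintegral_indicator hm]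
            refine lintegral_mono fun w => ?_
            have h1 := norm_quarticKernel_le hε (w - z)
            by_cases h : ε < ‖w - z‖
            · have hw : 0 < ‖w - z‖ := hε.trans h
              rw [Set.indicator_of_mem (by exact h)] at h1 ⊢
              rw [← ofReal_norm, ← ENNReal.ofReal_mul (by positivity), norm_mul]
              apply ENNReal.ofReal_le_ofReal
              calc _ ≤ L * ‖w - z‖ * (ε ^ 2 / ‖w - z‖ ^ 4) := by
                    gcongr
                    exact hL.norm_sub_le w z
                _ = _ := by field_simp
            · rw [Set.indicator_of_notMem (by exact h)] at h1 ⊢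
              rw [norm_le_zero_iff.1 h1]
              simp
        _ ≤ ENNReal.ofReal (L * ε ^ 2) * ENNReal.ofReal (2 * Real.pi / ε) := by
            rw [lintegral_const_mul' _ _ ENNReal.ofReal_ne_top]
            gcongr
            exact lintegral_inv_cube_le z hε
        _ = _ := by
            rw [← ENNReal.ofReal_mul (by positivity)]
            congr 1
            field_simp
    rw [← ofReal_norm] at h2
    exact (ENNReal.ofReal_le_ofReal_iff (by positivity)).1 h2
  rw [tendsto_zero_iff_norm_tendsto_zero]
  have h0 : Tendsto (fun ε : ℝ => L * (2 * Real.pi) * ε) (𝓝[>] 0) (𝓝 0) := by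
    have : Continuous fun ε : ℝ => L * (2 * Real.pi) * ε := by fun_prop
    simpa using (this.tendsto 0).mono_left nhdsWithin_le_nhds
  refine squeeze_zero' (Eventually.of_forall fun _ => norm_nonneg _) ?_ h0
  filter_upwards [self_mem_nhdsWithin] with ε hε using hle ε hε

lemma ae_tendsto_kernelOp_quarticKernel {p : ℝ} (hp : 1 < p) {f : ℂ → ℂ}
    (hf : MemLp f (ENNReal.ofReal p) volume) :
    ∀ᵐ z : ℂ, Tendsto (fun ε => kernelOp (quarticKernel ε) f z) (𝓝[>] 0) (𝓝 0) := by
  have hp1 := one_le_ofReal' hp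
  obtain ⟨C, hC⟩ := exists_lintegral_maximalFn_rpow_le hp
  obtain ⟨g, hg, hgz⟩ := exists_isTest_maximal_lt hp
    (S := fun f => maximalFn fun w => ‖f w‖ₑ) (fun f _ => measurable_maximalFn _)
    (fun f hf => hC f hf.aestronglyMeasurable) hf
  filter_upwards [hgz] with z hz
  rw [Metric.tendsto_nhds]
  intro δ hδ
  have hpi := Real.pi_pos
  obtain ⟨n, hn⟩ := hz (ENNReal.ofReal (δ / (4 * Real.pi)))
    (by rw [ENNReal.ofReal_pos]; positivity)
  filter_upwards [(Metric.tendsto_nhds.1 ((hg n).tendsto_kernelOp_quarticKernel z)) (δ / 2)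
    (by positivity), self_mem_nhdsWithin] with ε h1 hε
  have hfg : MemLp (fun y => f y - g n y) (ENNReal.ofReal p) volume := hf.sub ((hg n).memLp _)
  have h2 : ‖kernelOp (quarticKernel ε) (fun y => f y - g n y) z‖ₑ ≤ ENNReal.ofReal (δ / 2) := by
    refine (enorm_kernelOp_quarticKernel_le hfg.aestronglyMeasurable hε z).trans ?_
    calc _ ≤ ENNReal.ofReal (2 * Real.pi) * ENNReal.ofReal (δ / (4 * Real.pi)) := by
          gcongr
          exact (hardyLittlewood_le_maximalFn _ z).trans hn.le
      _ = _ := by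
          rw [← ENNReal.ofReal_mul (by positivity)]
          congr 1
          field_simp
          ring
  rw [← ofReal_norm, ENNReal.ofReal_le_ofReal_iff (by positivity), kernelOp_sub
    (isDecaying_quarticKernel hε) hp1 ENNReal.ofReal_ne_top hp1 ENNReal.ofReal_ne_top hf
    ((hg n).memLp _)] at h2
  rw [dist_zero_right] at h1 ⊢
  have h3 := norm_add_le (kernelOp (quarticKernel ε) f z - kernelOp (quarticKernel ε) (g n) z)
    (kernelOp (quarticKernel ε) (g n) z)
  rw [sub_add_cancel] at h3
  linarith

/-! ### The truncations of `B` applied to `B f` -/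

lemma pi_mul_iteratedKernel (ε : ℝ) (ζ : ℂ) : (Real.pi : ℂ) * iteratedKernel ε ζ =
    truncKernel beurlingSqKernel ε ζ - 3 * Real.pi * quarticKernel ε ζ := by
  rw [iteratedKernel, quarticKernel, truncKernel, truncKernel, truncKernel]
  by_cases h : ε < ‖ζ‖
  · simp only [Set.indicator_of_mem (show ζ ∈ {ζ : ℂ | ε < ‖ζ‖} from h), beurlingSqKernel]
    ring
  · simp only [Set.indicator_of_notMem (show ζ ∉ {ζ : ℂ | ε < ‖ζ‖} from h)]
    ring

/-- The kernel of `B_ε ∘ B` is that of the truncation of `B²`, up to the quartic error term. -/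
lemma pi_mul_kernelOp_iteratedKernel {p : ℝ≥0∞} (hp1 : 1 ≤ p) (hp : p ≠ ∞) {f : ℂ → ℂ}
    (hf : MemLp f p volume) {ε : ℝ} (hε : 0 < ε) (z : ℂ) :
    (Real.pi : ℂ) * kernelOp (iteratedKernel ε) f z =
      truncation beurlingSqKernel ε f z - 3 * Real.pi * kernelOp (quarticKernel ε) f z := by
  rw [truncation_eq_kernelOp, kernelOp, kernelOp, kernelOp, ← integral_const_mul,
    ← integral_const_mul, ← integral_sub
      ((isStandardKernel_beurlingSqKernel.isDecaying hε).integrable hp1 hp hf z)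
      (((isDecaying_quarticKernel hε).integrable hp1 hp hf z).const_mul _)]
  congr 1; ext w
  rw [mul_left_comm, pi_mul_iteratedKernel]
  ring

/-- The truncation `B_ε` of the Beurling transform, applied to `B f`: the operator `B` is moved from
`f` to the truncated kernel, for test functions `f` and then by density. -/
lemma truncation_beurling_beurling {p : ℝ} (hp : 1 < p) {f : ℂ → ℂ}
    (hf : MemLp f (ENNReal.ofReal p) volume) {ε : ℝ} (hε : 0 < ε) (z : ℂ) :
    truncation beurlingKernel ε (beurling f) z =
      (Real.pi : ℂ) * kernelOp (iteratedKernel ε) f z := by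
  have hp1 := one_le_ofReal' hp
  obtain ⟨g, hg, hlim⟩ := exists_isTest_tendsto hp1 ENNReal.ofReal_ne_top hf
  obtain ⟨C, hC⟩ := exists_hasWirtinger_truncPrimitive hε
  have h1 : ∀ n, kernelOp (truncKernel beurlingKernel ε) (beurling (g n)) z =
      (Real.pi : ℂ) * kernelOp (iteratedKernel ε) (g n) z := fun n => by
    rw [hC.kernelOp_beurling (hg n) z, kernelOp, kernelOp]
    simp_rw [mul_neg]
    rw [integral_neg]
    ring
  have h2 := tendsto_kernelOp (isStandardKernel_beurlingKernel.isDecaying hε) hp1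
    ENNReal.ofReal_ne_top (memLp_beurling hp hf) (fun n => memLp_beurling hp ((hg n).memLp _))
    (tendsto_eLpNorm_beurling_sub hp hf (fun n => (hg n).memLp _) hlim) z
  have h3 := (tendsto_kernelOp (isDecaying_iteratedKernel hε) hp1 ENNReal.ofReal_ne_top hf
    (fun n => (hg n).memLp _) hlim z).const_mul (Real.pi : ℂ)
  simp_rw [h1] at h2
  rw [truncation_eq_kernelOp]
  exact tendsto_nhds_unique h2 h3

/-- `B ∘ B` is a principal value operator: the truncations of `B²` differ from `B_ε (B f)` by the
error term, which tends to zero almost everywhere. -/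
lemma ae_tendsto_truncation_beurlingSqKernel {p : ℝ} (hp : 1 < p) {f : ℂ → ℂ}
    (hf : MemLp f (ENNReal.ofReal p) volume) :
    ∀ᵐ z : ℂ, Tendsto (fun ε => truncation beurlingSqKernel ε f z) (𝓝[>] 0)
      (𝓝 (beurling (beurling f) z)) := by
  filter_upwards [ae_tendsto_truncation_beurling hp (memLp_beurling hp hf),
    ae_tendsto_kernelOp_quarticKernel hp hf] with z h1 h2
  have h3 := h1.add (h2.const_mul (3 * Real.pi : ℂ))
  rw [mul_zero, add_zero] at h3
  refine h3.congr' ?_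
  filter_upwards [self_mem_nhdsWithin] with ε hε
  rw [truncation_beurling_beurling hp hf hε, pi_mul_kernelOp_iteratedKernel (one_le_ofReal' hp)
    ENNReal.ofReal_ne_top hf hε, sub_add_cancel]

/-! ### The pointwise and the weak type inequalities for `B* ∘ B` -/

/-- The supremum over `ε > 0` of the moduli of `B_ε (B f)(z)`, written with the kernels of
`B_ε ∘ B`, so that it makes sense for `f ∈ L¹`. -/
noncomputable def iteratedMax (f : ℂ → ℂ) (z : ℂ) : ℝ≥0∞ :=
  ⨆ (ε : ℝ) (_ : 0 < ε), ‖(Real.pi : ℂ) * kernelOp (iteratedKernel ε) f z‖ₑ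

lemma beurlingMax_beurling_eq {p : ℝ} (hp : 1 < p) {f : ℂ → ℂ}
    (hf : MemLp f (ENNReal.ofReal p) volume) (z : ℂ) :
    beurlingMax (beurling f) z = iteratedMax f z :=
  iSup_congr fun ε => iSup_congr fun hε => by rw [truncation_beurling_beurling hp hf hε]

lemma enorm_three_pi_mul_le (c : ℂ) {h : ℝ≥0∞}
    (hc : ‖c‖ₑ ≤ ENNReal.ofReal (2 * Real.pi) * h) :
    ‖3 * (Real.pi : ℂ) * c‖ₑ ≤ ENNReal.ofReal (6 * Real.pi ^ 2) * h := by
  have h1 : ‖3 * (Real.pi : ℂ)‖ₑ = ENNReal.ofReal (3 * Real.pi) := by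
    rw [← ofReal_norm, norm_mul, Complex.norm_real, Real.norm_of_nonneg Real.pi_pos.le]
    norm_num
  rw [enorm_mul, h1]
  refine (mul_le_mul_right hc _).trans_eq ?_
  rw [← mul_assoc, ← ENNReal.ofReal_mul (by positivity)]
  congr 2
  ring

/-- The pointwise inequality, at every point and including `p = 1`. -/
lemma iteratedMax_le {p : ℝ≥0∞} (hp1 : 1 ≤ p) (hp : p ≠ ∞) {f : ℂ → ℂ} (hf : MemLp f p volume)
    (z : ℂ) : iteratedMax f z ≤
      ENNReal.ofReal (6 * Real.pi ^ 2) * (beurlingSqMax f z + hardyLittlewood f z) := by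
  refine iSup₂_le fun ε hε => ?_
  rw [pi_mul_kernelOp_iteratedKernel hp1 hp hf hε, mul_add]
  refine enorm_sub_le.trans (add_le_add ?_ ?_)
  · refine (enorm_truncation_le_maximalSingular _ _ hε z).trans (le_mul_of_one_le_left zero_le ?_)
    rw [ENNReal.one_le_ofReal]
    nlinarith [Real.pi_gt_three]
  · exact enorm_three_pi_mul_le _ (enorm_kernelOp_quarticKernel_le hf.aestronglyMeasurable hε z)

/-- Conversely `(B²)*` is controlled by `B* ∘ B` and the maximal function. -/
lemma beurlingSqMax_le {p : ℝ} (hp : 1 < p) {f : ℂ → ℂ}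
    (hf : MemLp f (ENNReal.ofReal p) volume) (z : ℂ) : beurlingSqMax f z ≤
      maximalSingular beurlingKernel (beurling f) z +
        ENNReal.ofReal (6 * Real.pi ^ 2) * maximalFn (fun w => ‖f w‖ₑ) z := by
  refine iSup₂_le fun ε hε => ?_
  have h1 := pi_mul_kernelOp_iteratedKernel (one_le_ofReal' hp) ENNReal.ofReal_ne_top hf hε z
  rw [← truncation_beurling_beurling hp hf hε] at h1
  rw [eq_add_of_sub_eq h1.symm]
  refine (enorm_add_le _ _).trans (add_le_add (enorm_truncation_le_maximalSingular _ _ hε z)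
    (enorm_three_pi_mul_le _ ?_))
  refine (enorm_kernelOp_quarticKernel_le hf.aestronglyMeasurable hε z).trans ?_
  gcongr
  exact hardyLittlewood_le_maximalFn f z

/-- The `L²` bound for `(B²)*` follows from the one for `B*`, applied to `B f`. -/
lemma strongType_beurlingSqKernel : StrongType beurlingSqKernel 2 := by
  have h2 : (1 : ℝ) < 2 := by norm_num
  obtain ⟨C, hC⟩ := strongType_beurlingKernel h2
  obtain ⟨D, hD⟩ := exists_lintegral_maximalFn_rpow_le h2
  set a : ℝ≥0 := (6 * Real.pi ^ 2).toNNReal with ha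
  refine ⟨2 * (C * C + a ^ (2 : ℝ) * D), fun f hf => ?_⟩
  have hB := memLp_beurling h2 hf
  have hm := isStandardKernel_beurlingKernel.measurable_maximalSingular (one_le_ofReal' h2)
    ENNReal.ofReal_ne_top hB
  have hBf : ∫⁻ z, ‖beurling f z‖ₑ ^ (2 : ℝ) ≤ C * ∫⁻ z, ‖f z‖ₑ ^ (2 : ℝ) :=
    (lintegral_mono_ae ((ae_enorm_beurling_le h2 hf).mono fun z hz =>
      ENNReal.rpow_le_rpow hz (by norm_num))).trans (hC f hf)
  calc ∫⁻ z, maximalSingular beurlingSqKernel f z ^ (2 : ℝ)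
      ≤ ∫⁻ z, 2 * (maximalSingular beurlingKernel (beurling f) z ^ (2 : ℝ) +
          (a : ℝ≥0∞) ^ (2 : ℝ) * maximalFn (fun w => ‖f w‖ₑ) z ^ (2 : ℝ)) := by
        refine lintegral_mono fun z => ?_
        refine (ENNReal.rpow_le_rpow (beurlingSqMax_le h2 hf z) (by norm_num)).trans ?_
        refine (ENNReal.rpow_add_le_mul_rpow_add_rpow _ _ h2.le).trans_eq ?_
        rw [ENNReal.mul_rpow_of_nonneg _ _ (by norm_num), show (2 : ℝ) - 1 = 1 by norm_num,
          ENNReal.rpow_one]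
        rfl
    _ = 2 * ((∫⁻ z, maximalSingular beurlingKernel (beurling f) z ^ (2 : ℝ)) +
          (a : ℝ≥0∞) ^ (2 : ℝ) * ∫⁻ z, maximalFn (fun w => ‖f w‖ₑ) z ^ (2 : ℝ)) := by
        rw [lintegral_const_mul' _ _ (by norm_num), lintegral_add_left (hm.pow_const _),
          lintegral_const_mul _ ((measurable_maximalFn _).pow_const _)]
    _ ≤ 2 * (C * (C * ∫⁻ z, ‖f z‖ₑ ^ (2 : ℝ)) +
          (a : ℝ≥0∞) ^ (2 : ℝ) * (D * ∫⁻ z, ‖f z‖ₑ ^ (2 : ℝ))) := by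
        gcongr
        · exact (hC _ hB).trans (by gcongr)
        · exact hD f hf.aestronglyMeasurable
    _ = _ := by
        rw [ENNReal.coe_mul, ENNReal.coe_add, ENNReal.coe_mul, ENNReal.coe_mul,
          ENNReal.coe_rpow_of_nonneg _ (by norm_num), ENNReal.coe_ofNat]
        ring

/-- The weak type (1,1) inequality for the extension of `B* ∘ B` to `L¹`. -/
lemma exists_volume_lt_iteratedMax_le : ∃ C : ℝ≥0, ∀ f : ℂ → ℂ, Integrable f → ∀ t : ℝ, 0 < t →
    volume {z : ℂ | ENNReal.ofReal t < iteratedMax f z} ≤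
      C / ENNReal.ofReal t * ∫⁻ z, ‖f z‖ₑ := by
  obtain ⟨C, hC⟩ := strongType_beurlingSqKernel.weakType isStandardKernel_beurlingSqKernel
  set a : ℝ := 6 * Real.pi ^ 2 with ha
  have hpi := Real.pi_pos
  have ha0 : 0 < a := by positivity
  refine ⟨C * (2 * a).toNNReal + 16 * (2 * a).toNNReal, fun f hf t ht => ?_⟩
  have hs : 0 < t / (2 * a) := by positivity
  have hsub : {z | ENNReal.ofReal t < iteratedMax f z} ⊆
      {z | ENNReal.ofReal (t / (2 * a)) < maximalSingular beurlingSqKernel f z} ∪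
      {z | ENNReal.ofReal (t / (2 * a)) < maximalFn (fun w => ‖f w‖ₑ) z} := by
    intro z hz
    by_contra hcon
    simp only [Set.mem_union, not_or, Set.mem_ofPred_eq, not_lt] at hcon
    refine absurd hz (not_lt.2 ((iteratedMax_le le_rfl ENNReal.one_ne_top
      (memLp_one_iff_integrable.2 hf) z).trans ?_))
    calc _ ≤ ENNReal.ofReal a * (ENNReal.ofReal (t / (2 * a)) + ENNReal.ofReal (t / (2 * a))) := by
          gcongr
          · exact hcon.1
          · exact (hardyLittlewood_le_maximalFn f z).trans hcon.2
      _ = ENNReal.ofReal t := by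
          rw [← ENNReal.ofReal_add hs.le hs.le, ← ENNReal.ofReal_mul ha0.le]
          congr 1
          field_simp
          ring
  refine (measure_mono hsub).trans ((measure_union_le _ _).trans ((add_le_add (hC f hf _ hs)
    (volume_lt_maximalFn_le _ (by simpa using hs) ENNReal.ofReal_ne_top)).trans_eq ?_))
  rw [div_ofReal_div _ (by positivity), div_ofReal_div _ (by positivity), ← add_mul,
    ← ENNReal.add_div]
  rfl

lemma exists_real_exponent {f : ℂ → ℂ} (hf : InSomeLp f) :
    ∃ p : ℝ, 1 < p ∧ MemLp f (ENNReal.ofReal p) volume := by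
  obtain ⟨p, hp1, hp, hfp⟩ := hf
  refine ⟨p.toReal, ?_, by rwa [ENNReal.ofReal_toReal hp.ne]⟩
  simpa using (ENNReal.toReal_lt_toReal ENNReal.one_ne_top hp.ne).2 hp1

/-- For fixed `ε` the kernel of `B_ε ∘ B` is bounded, which gives the continuous extension to `L¹`. -/
lemma isL1Extension_kernelOp_iteratedKernel {f : ℂ → ℂ} (hf : MemLp f 1 volume) :
    IsL1Extension f fun ε z => (Real.pi : ℂ) * kernelOp (iteratedKernel ε) f z := by
  intro g hg hlim ε hε z
  have h1 : ∀ n, truncation beurlingKernel ε (beurling (g n)) z =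
      (Real.pi : ℂ) * kernelOp (iteratedKernel ε) (g n) z := fun n => by
    obtain ⟨p, hp, hgp⟩ := exists_real_exponent (hg n).2
    exact truncation_beurling_beurling hp hgp hε z
  simp_rw [h1]
  refine Tendsto.const_mul _ (tendsto_kernelOp (isDecaying_iteratedKernel hε) le_rfl
    ENNReal.one_ne_top hf (fun n => (hg n).1) ?_ z)
  simpa only [eLpNorm_one_eq_lintegral_enorm] using hlim

/-! ### The indicator of the unit disc -/

lemma truncation_congr_ae (K : ℂ → ℂ) (ε : ℝ) {f g : ℂ → ℂ} (h : f =ᵐ[volume] g) (z : ℂ) :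
    truncation K ε f z = truncation K ε g z := by
  refine integral_congr_ae (ae_restrict_of_ae ?_)
  filter_upwards [h] with w hw
  rw [hw]

lemma ae_beurling_indicator_unitDisc : beurling ((Metric.ball (0 : ℂ) 1).indicator 1) =ᵐ[volume]
    fun z => (Real.pi : ℂ) * truncKernel beurlingKernel 1 z := by
  obtain ⟨C, hC⟩ := exists_hasWirtinger_discPrimitive one_pos
  have e : discKernel 1 = (Metric.ball (0 : ℂ) 1).indicator 1 := by
    rw [discKernel]; congr 1; ext z; simp
  have h0 : ∀ᵐ z : ℂ, z ≠ 0 := by simp [ae_iff]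
  filter_upwards [h0, ae_norm_ne 1] with z hz hz1
  have h := hC.tendsto_truncation hz hz1
  rw [e] at h
  refine h.limUnder_eq.trans ?_
  ring

lemma ae_beurling_beurling_indicator_unitDisc :
    beurling (beurling ((Metric.ball (0 : ℂ) 1).indicator 1)) =ᵐ[volume]
      fun z => (Real.pi : ℂ) ^ 2 * iteratedKernel 1 z := by
  obtain ⟨C, hC⟩ := exists_hasWirtinger_truncPrimitive one_pos
  have h0 : ∀ᵐ z : ℂ, z ≠ 0 := by simp [ae_iff]
  filter_upwards [h0, ae_norm_ne 1] with z hz hz1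
  have h := (hC.tendsto_truncation hz hz1).const_mul (Real.pi : ℂ)
  have e : ∀ ε, truncation beurlingKernel ε (beurling ((Metric.ball (0 : ℂ) 1).indicator 1)) z =
      (Real.pi : ℂ) * truncation beurlingKernel ε (truncKernel beurlingKernel 1) z := fun ε => by
    rw [truncation_congr_ae _ _ ae_beurling_indicator_unitDisc, truncation, truncation,
      ← integral_const_mul]
    simp_rw [mul_assoc]
  simp_rw [← e] at h
  refine h.limUnder_eq.trans ?_
  ring

/-! ### The maximal Hilbert transform -/

/-- The function `s` on `(0, 1]`, extended by zero. -/
noncomputable def ramp : ℝ → ℝ := (Set.Ioc (0 : ℝ) 1).indicator id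

/-- The Hilbert transform of `ramp` at points off `[0, 1]`, where no principal value is needed. -/
noncomputable def hilbertRamp (y : ℝ) : ℝ := ∫ s in Set.Ioc (0 : ℝ) 1, s * (1 / (s - y))

lemma norm_ramp_le (s : ℝ) : ‖ramp s‖ ≤ (Set.Ioc (0 : ℝ) 1).indicator (fun _ => (1 : ℝ)) s := by
  by_cases h : s ∈ Set.Ioc (0 : ℝ) 1
  · rw [ramp, Set.indicator_of_mem h, Set.indicator_of_mem h, id, Real.norm_of_nonneg h.1.le]
    exact h.2
  · rw [ramp, Set.indicator_of_notMem h, Set.indicator_of_notMem h, norm_zero]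

lemma measurable_ramp : Measurable ramp := measurable_id.indicator measurableSet_Ioc

lemma lintegral_enorm_ramp_le : ∫⁻ s, ‖ramp s‖ₑ ≤ 1 := by
  have : ∫⁻ s, ‖ramp s‖ₑ ≤ ∫⁻ s, (Set.Ioc (0 : ℝ) 1).indicator (fun _ => (1 : ℝ≥0∞)) s := by
    refine lintegral_mono fun s => ?_
    have h := norm_ramp_le s
    by_cases hs : s ∈ Set.Ioc (0 : ℝ) 1
    · rw [Set.indicator_of_mem hs] at h ⊢
      rw [← ofReal_norm]
      exact ENNReal.ofReal_le_one.2 h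
    · rw [Set.indicator_of_notMem hs] at h ⊢
      rw [norm_le_zero_iff.1 h]; simp
  refine this.trans_eq ?_
  rw [lintegral_indicator_const measurableSet_Ioc, Real.volume_Ioc]
  simp

lemma memLp_one_ramp : MemLp ramp 1 volume := by
  refine ⟨measurable_ramp.aestronglyMeasurable, ?_⟩
  rw [eLpNorm_one_eq_lintegral_enorm]
  exact lintegral_enorm_ramp_le.trans_lt ENNReal.one_lt_top

lemma memLp_top_ramp : MemLp ramp ∞ volume :=
  memLp_top_of_bound measurable_ramp.aestronglyMeasurable 1 (Eventually.of_forall fun s =>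
    (norm_ramp_le s).trans (Set.indicator_le_self' (fun _ _ => zero_le_one) s))

lemma truncation_ramp {y ε : ℝ} (h : ∀ s ∈ Set.Ioc (0 : ℝ) 1, ε < ‖s - y‖) :
    truncation (fun x : ℝ => 1 / x) ε ramp y = hilbertRamp y := by
  have hm : MeasurableSet {s : ℝ | ε < ‖s - y‖} := measurableSet_lt measurable_const (by fun_prop)
  rw [truncation, hilbertRamp, ← integral_indicator hm, ← integral_indicator measurableSet_Ioc]
  congr 1; ext s
  by_cases hs : s ∈ Set.Ioc (0 : ℝ) 1
  · rw [Set.indicator_of_mem hs, Set.indicator_of_mem (by exact h s hs), ramp,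
      Set.indicator_of_mem hs, id]
  · rw [Set.indicator_of_notMem hs, Set.indicator_apply, ramp, Set.indicator_of_notMem hs]
    simp

lemma hilbert_ramp {y : ℝ} (hy : y < 0 ∨ 1 < y) : hilbert ramp y = hilbertRamp y := by
  obtain ⟨d, hd, h⟩ : ∃ d : ℝ, 0 < d ∧ ∀ s ∈ Set.Ioc (0 : ℝ) 1, d ≤ ‖s - y‖ := by
    rcases hy with hy | hy
    · refine ⟨-y, by linarith, fun s hs => ?_⟩
      rw [Real.norm_eq_abs]
      exact (by linarith [hs.1] : -y ≤ s - y).trans (le_abs_self _)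
    · refine ⟨y - 1, by linarith, fun s hs => ?_⟩
      rw [Real.norm_eq_abs]
      exact (by linarith [hs.2] : y - 1 ≤ -(s - y)).trans (neg_le_abs _)
  refine Tendsto.limUnder_eq (tendsto_const_nhds.congr' ?_)
  filter_upwards [Ioo_mem_nhdsGT hd] with ε hε
  exact (truncation_ramp fun s hs => hε.2.trans_le (h s hs)).symm

lemma measurable_hilbertRamp : Measurable hilbertRamp := by
  have h : Measurable fun q : ℝ × ℝ => q.2 * (1 / (q.2 - q.1)) := by fun_prop
  exact (h.stronglyMeasurable.integral_prod_right'
    (ν := volume.restrict (Set.Ioc (0 : ℝ) 1))).measurable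

lemma integrableOn_ramp_kernel {y : ℝ} (hy : y < 0 ∨ 1 < y) :
    IntegrableOn (fun s : ℝ => s * (1 / (s - y))) (Set.Ioc 0 1) := by
  refine (ContinuousOn.integrableOn_Icc ?_).mono_set Set.Ioc_subset_Icc_self
  refine continuousOn_id.mul (continuousOn_const.div (by fun_prop) fun s hs => ?_)
  rcases hy with hy | hy
  · have := hs.1; intro h; linarith
  · have := hs.2; intro h; linarith

lemma le_hilbertRamp {y : ℝ} (hy : y < 0) : 1 / 2 * (1 / (1 - y)) ≤ hilbertRamp y := by
  have e : ∫ s in Set.Ioc (0 : ℝ) 1, s * (1 / (1 - y)) = 1 / 2 * (1 / (1 - y)) := by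
    rw [integral_mul_const, ← intervalIntegral.integral_of_le zero_le_one, integral_id]
    norm_num
  rw [← e]
  refine setIntegral_mono_on ?_ (integrableOn_ramp_kernel (Or.inl hy)) measurableSet_Ioc
    fun s hs => ?_
  · exact (Continuous.integrableOn_Icc (by fun_prop)).mono_set Set.Ioc_subset_Icc_self
  · have h1 := hs.1
    have h2 := hs.2
    gcongr
    linarith

lemma hilbertRamp_nonpos {y : ℝ} (hy : 1 < y) : hilbertRamp y ≤ 0 := by
  refine setIntegral_nonpos measurableSet_Ioc fun s hs => ?_
  exact mul_nonpos_of_nonneg_of_nonpos hs.1.le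
    (one_div_nonpos.2 (by linarith [hs.2]))

lemma norm_hilbertRamp_le {y : ℝ} (hy : y < 0 ∨ 2 < y) : ‖hilbertRamp y‖ ≤ 3 / (1 + |y|) := by
  have h : ∀ s ∈ Set.Ioc (0 : ℝ) 1, ‖s * (1 / (s - y))‖ ≤ 3 / (1 + |y|) := fun s hs => by
    have h1 := hs.1
    have h2 := hs.2
    rw [mul_one_div, norm_div, Real.norm_of_nonneg h1.le, Real.norm_eq_abs]
    rcases hy with hy | hy
    · rw [abs_of_neg hy, abs_of_pos (by linarith : 0 < s - y),
        div_le_div_iff₀ (by linarith) (by linarith)]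
      nlinarith
    · rw [abs_of_pos (by linarith : 0 < y), abs_of_neg (by linarith : s - y < 0),
        div_le_div_iff₀ (by linarith) (by linarith)]
      nlinarith
  have := norm_setIntegral_le_of_norm_le_const (μ := volume) (by simp) h
  simpa [hilbertRamp, measureReal_def] using this

/-- The truncation at level `x` of the Hilbert transform, applied to `H ramp` at `x`, sees only the
half lines `y < 0` and `y > 2 x`, where both contributions are negative; the first one alone is of
size `log x / x`. -/
lemma le_norm_truncation_hilbert_ramp {x : ℝ} (hx : 1 ≤ x) :
    Real.log (1 + x) / (4 * x) ≤ ‖truncation (fun x : ℝ => 1 / x) x (hilbert ramp) x‖ := by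
  set S : Set ℝ := {y : ℝ | x < ‖y - x‖} with hS
  have hSm : MeasurableSet S := measurableSet_lt measurable_const (by fun_prop)
  have hSy : ∀ y ∈ S, y < 0 ∨ 2 * x < y := fun y hy => by
    rw [hS, Set.mem_ofPred_eq, Real.norm_eq_abs, lt_abs] at hy
    rcases hy with hy | hy
    · right; linarith
    · left; linarith
  set I : ℝ → ℝ := fun y => hilbertRamp y * (1 / (y - x)) with hI
  have e : truncation (fun x : ℝ => 1 / x) x (hilbert ramp) x = ∫ y in S, I y := by
    refine setIntegral_congr_fun hSm fun y hy => ?_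
    simp only [hI]
    rw [hilbert_ramp ((hSy y hy).imp_right fun h => by linarith)]
  have hneg : ∀ y ∈ S, 0 ≤ -I y := fun y hy => by
    rw [hI, neg_nonneg]
    rcases hSy y hy with h | h
    · refine mul_nonpos_of_nonneg_of_nonpos (le_trans ?_ (le_hilbertRamp h))
        (one_div_nonpos.2 (by linarith))
      have : 0 < 1 - y := by linarith
      positivity
    · exact mul_nonpos_of_nonpos_of_nonneg (hilbertRamp_nonpos (by linarith))
        (one_div_nonneg.2 (by linarith))
  -- integrability matters here: the Bochner integral of a non-integrable function would be zero
  have hint : IntegrableOn I S := by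
    refine Integrable.mono' (integrable_inv_one_add_sq.const_mul 9).integrableOn
      (measurable_hilbertRamp.mul (by fun_prop)).aestronglyMeasurable
      ((ae_restrict_iff' hSm).2 (Eventually.of_forall fun y hy => ?_))
    have h1 := norm_hilbertRamp_le ((hSy y hy).imp_right fun h => by linarith : y < 0 ∨ 2 < y)
    have h2 : ‖1 / (y - x)‖ ≤ 3 / (1 + |y|) := by
      rw [norm_div, norm_one, Real.norm_eq_abs]
      rcases hSy y hy with h | h
      · rw [abs_of_neg h, abs_of_neg (by linarith : y - x < 0),
          div_le_div_iff₀ (by linarith) (by linarith)]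
        linarith
      · rw [abs_of_pos (by linarith : 0 < y), abs_of_pos (by linarith : 0 < y - x),
          div_le_div_iff₀ (by linarith) (by linarith)]
        linarith
    rw [hI, norm_mul]
    calc _ ≤ 3 / (1 + |y|) * (3 / (1 + |y|)) := by gcongr
      _ = 9 * ((1 + |y|) ^ 2)⁻¹ := by field_simp; norm_num
      _ ≤ 9 * (1 + y ^ 2)⁻¹ := by
          gcongr
          nlinarith [abs_nonneg y, sq_abs y]
  have hsub : Set.Ioo (-x) 0 ⊆ S := fun y hy => by
    rw [hS, Set.mem_ofPred_eq, Real.norm_eq_abs, lt_abs]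
    right; linarith [hy.2]
  have hlog : ∫ y in Set.Ioo (-x) 0, 1 / (4 * x) * (1 - y)⁻¹ = Real.log (1 + x) / (4 * x) := by
    rw [← integral_Ioc_eq_integral_Ioo, ← intervalIntegral.integral_of_le (by linarith),
      intervalIntegral.integral_const_mul, intervalIntegral.integral_comp_sub_left (fun y => y⁻¹) 1,
      sub_zero, sub_neg_eq_add, integral_inv_of_pos one_pos (by linarith), div_one]
    ring
  rw [e, Real.norm_eq_abs, ← hlog]
  refine le_trans ?_ (neg_le_abs _)
  rw [← integral_neg]
  refine le_trans ?_ (setIntegral_mono_set hint.neg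
    ((ae_restrict_iff' hSm).2 (Eventually.of_forall hneg)) hsub.eventuallyLE)
  refine setIntegral_mono_on ?_ (hint.neg.mono_set hsub) measurableSet_Ioo fun y hy => ?_
  · refine (ContinuousOn.integrableOn_Icc ?_).mono_set Set.Ioo_subset_Icc_self
    refine continuousOn_const.mul (ContinuousOn.inv₀ (by fun_prop) fun y hy => ?_)
    have := hy.2; intro h; linarith
  · have h1 := hy.1
    have h2 := hy.2
    have h3 : 0 < 1 - y := by linarith
    have h4 : 0 < x - y := by linarith
    have h5 : 1 / (2 * x) ≤ 1 / (x - y) := by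
      apply one_div_le_one_div_of_le h4; linarith
    calc 1 / (4 * x) * (1 - y)⁻¹ = 1 / 2 * (1 / (1 - y)) * (1 / (2 * x)) := by
          field_simp; norm_num
      _ ≤ hilbertRamp y * (1 / (x - y)) := by
          have := le_hilbertRamp h2
          have h6 : 0 < 1 / 2 * (1 / (1 - y)) := by positivity
          exact mul_le_mul this h5 (by positivity) (h6.le.trans this)
      _ = -I y := by
          simp only [hI]
          rw [← neg_sub x y, one_div_neg_eq_neg_one_div, mul_neg, neg_neg]

/-- `H* ∘ H` is not of weak type (1,1): on `[R, 2R]` the function `H* (H ramp)` is at least of size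
`log R / R`. -/
lemma not_weakType_hilbertMax_hilbert :
    ¬ ∃ C : ℝ≥0, ∀ f : ℝ → ℝ, MemLp f 1 volume → MemLp f ∞ volume → ∀ t : ℝ, 0 < t →
      volume {x : ℝ | ENNReal.ofReal t < hilbertMax (hilbert f) x} ≤
        C / ENNReal.ofReal t * ∫⁻ x, ‖f x‖ₑ := by
  rintro ⟨C, hC⟩
  -- chosen so that `R t = log R / 8 > C` for `t = log R / (8 R)`
  set R : ℝ := Real.exp (8 * C + 1) with hR
  have hlogR : Real.log R = 8 * C + 1 := Real.log_exp _
  have hC0 : (0 : ℝ) ≤ C := C.2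
  have hR1 : 1 ≤ R := Real.one_le_exp (by linarith)
  have hR0 : 0 < R := by linarith
  set t : ℝ := (8 * C + 1) / (8 * R) with ht
  have ht0 : 0 < t := by positivity
  have hsub : Set.Icc R (2 * R) ⊆ {x : ℝ | ENNReal.ofReal t < hilbertMax (hilbert ramp) x} := by
    intro x hx
    have hx0 : 0 < x := by linarith [hx.1]
    have h1 := le_norm_truncation_hilbert_ramp (hR1.trans hx.1)
    have h2 : t < Real.log (1 + x) / (4 * x) := by
      have h3 : 8 * (C : ℝ) + 1 < Real.log (1 + x) := by
        rw [← hlogR]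
        exact Real.log_lt_log hR0 (by linarith [hx.1])
      calc t < Real.log (1 + x) / (8 * R) := by rw [ht]; gcongr
        _ ≤ Real.log (1 + x) / (4 * x) := by
            exact div_le_div_of_nonneg_left (by linarith) (by positivity) (by linarith [hx.2])
    refine lt_of_lt_of_le ?_ (le_iSup₂ (f := fun ε (_ : 0 < ε) =>
      ‖truncation (fun x : ℝ => 1 / x) ε (hilbert ramp) x‖ₑ) x hx0)
    rw [← ofReal_norm]
    exact (ENNReal.ofReal_lt_ofReal_iff (ht0.trans (h2.trans_le h1))).2 (h2.trans_le h1)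
  have h1 : ENNReal.ofReal R ≤ C / ENNReal.ofReal t := by
    calc ENNReal.ofReal R = volume (Set.Icc R (2 * R)) := by rw [Real.volume_Icc]; ring_nf
      _ ≤ C / ENNReal.ofReal t * ∫⁻ x, ‖ramp x‖ₑ :=
          (measure_mono hsub).trans (hC ramp memLp_one_ramp memLp_top_ramp t ht0)
      _ ≤ C / ENNReal.ofReal t * 1 := by gcongr; exact lintegral_enorm_ramp_le
      _ = _ := mul_one _
  rw [ENNReal.le_div_iff_mul_le (Or.inl (by simpa using ht0)) (Or.inl ENNReal.ofReal_ne_top),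
    ← ENNReal.ofReal_mul hR0.le, ← ENNReal.ofReal_coe_nnreal, ENNReal.ofReal_le_ofReal_iff hC0] at h1
  have h2 : R * t = (8 * C + 1) / 8 := by rw [ht]; field_simp
  linarith

end MaxBeurling

theorem mainTheorem5 :
    -- on `L^p`, `1 < p < ∞`, the transform `B f` exists a.e. and lies in `L^p`, and `B ∘ B` is the
    -- principal value operator whose maximal operator is `(B²)*`
    (∀ p : ℝ≥0∞, 1 < p → p < ∞ → ∀ f : ℂ → ℂ, MemLp f p volume →
      (∀ᵐ z : ℂ, Tendsto (fun ε => truncation beurlingKernel ε f z) (𝓝[>] 0)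
        (𝓝 (beurling f z))) ∧
      MemLp (beurling f) p volume ∧
      (∀ᵐ z : ℂ, Tendsto (fun ε => truncation beurlingSqKernel ε f z) (𝓝[>] 0)
        (𝓝 (beurling (beurling f) z)))) ∧
    -- the value of `B²` at the characteristic function of the unit disc
    (∀ᵐ z : ℂ, beurling (beurling ((Metric.ball (0 : ℂ) 1).indicator 1)) z =
      {w : ℂ | 1 < ‖w‖}.indicator
        (fun w => (Real.pi : ℂ) ^ 2 * (2 * (starRingEnd ℂ w) / w ^ 3 - 3 / w ^ 4)) z) ∧
    (∃ C : ℝ≥0,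
      -- the pointwise inequality
      (∀ f : ℂ → ℂ, InSomeLp f → ∀ z : ℂ,
        beurlingMax (beurling f) z ≤ C * (beurlingSqMax f z + hardyLittlewood f z)) ∧
      -- the weak type (1,1) inequality for `B* ∘ B`
      (∀ f : ℂ → ℂ, MemLp f 1 volume → InSomeLp f → ∀ t : ℝ, 0 < t →
        volume {z : ℂ | ENNReal.ofReal t < beurlingMax (beurling f) z} ≤
          C / ENNReal.ofReal t * ∫⁻ z, ‖f z‖ₑ) ∧
      -- both inequalities on all of `L¹`, for the extension of the truncations `B_ε ∘ B` to `L¹`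
      (∀ f : ℂ → ℂ, MemLp f 1 volume →
        ∃ T : ℝ → ℂ → ℂ, IsL1Extension f T ∧
          (∀ z : ℂ, (⨆ (ε : ℝ) (_ : 0 < ε), ‖T ε z‖ₑ) ≤
            C * (beurlingSqMax f z + hardyLittlewood f z)) ∧
          (∀ t : ℝ, 0 < t →
            volume {z : ℂ | ENNReal.ofReal t < ⨆ (ε : ℝ) (_ : 0 < ε), ‖T ε z‖ₑ} ≤
              C / ENNReal.ofReal t * ∫⁻ z, ‖f z‖ₑ))) ∧
    -- `H* ∘ H` is not of weak type (1,1), not even on bounded integrable functions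
    (¬ ∃ C : ℝ≥0, ∀ f : ℝ → ℝ, MemLp f 1 volume → MemLp f ∞ volume → ∀ t : ℝ, 0 < t →
      volume {x : ℝ | ENNReal.ofReal t < hilbertMax (hilbert f) x} ≤
        C / ENNReal.ofReal t * ∫⁻ x, ‖f x‖ₑ) := by
  refine ⟨fun p hp1 hp f hf => ?_, ?_, ?_, MaxBeurling.not_weakType_hilbertMax_hilbert⟩
  · obtain ⟨q, rfl⟩ : ∃ q : ℝ, ENNReal.ofReal q = p := ⟨p.toReal, ENNReal.ofReal_toReal hp.ne⟩
    have hq : 1 < q := ENNReal.one_lt_ofReal.1 hp1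
    exact ⟨MaxBeurling.ae_tendsto_truncation_beurling hq hf, MaxBeurling.memLp_beurling hq hf,
      MaxBeurling.ae_tendsto_truncation_beurlingSqKernel hq hf⟩
  · filter_upwards [MaxBeurling.ae_beurling_beurling_indicator_unitDisc] with z hz
    rw [hz, MaxBeurling.iteratedKernel, MaxBeurling.truncKernel]
    by_cases h : 1 < ‖z‖
    · rw [Set.indicator_of_mem (by exact h), Set.indicator_of_mem (by exact h)]
      norm_num
    · rw [Set.indicator_of_notMem (by exact h), Set.indicator_of_notMem (by exact h), mul_zero]
  · obtain ⟨C, hC⟩ := MaxBeurling.exists_volume_lt_iteratedMax_le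
    set a : ℝ≥0 := (6 * Real.pi ^ 2).toNNReal
    -- one constant for all four inequalities
    have hle : ∀ {p : ℝ≥0∞}, 1 ≤ p → p ≠ ∞ → ∀ {f : ℂ → ℂ}, MemLp f p volume → ∀ z,
        MaxBeurling.iteratedMax f z ≤
          (max C a : ℝ≥0) * (beurlingSqMax f z + hardyLittlewood f z) := by
      intro p hp1 hp f hf z
      refine (MaxBeurling.iteratedMax_le hp1 hp hf z).trans (mul_le_mul_left ?_ _)
      exact ENNReal.coe_le_coe.2 (le_max_right C a)
    have hweak : ∀ f : ℂ → ℂ, MemLp f 1 volume → ∀ t : ℝ, 0 < t →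
        volume {z : ℂ | ENNReal.ofReal t < MaxBeurling.iteratedMax f z} ≤
          (max C a : ℝ≥0) / ENNReal.ofReal t * ∫⁻ z, ‖f z‖ₑ := by
      intro f hf t ht
      refine (hC f (memLp_one_iff_integrable.1 hf) t ht).trans (mul_le_mul_left ?_ _)
      exact ENNReal.div_le_div_right (ENNReal.coe_le_coe.2 (le_max_left C a)) _
    refine ⟨max C a, fun f hf z => ?_, fun f hf1 hf t ht => ?_, fun f hf => ⟨_,
      MaxBeurling.isL1Extension_kernelOp_iteratedKernel hf, hle le_rfl ENNReal.one_ne_top hf,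
      hweak f hf⟩⟩
    · obtain ⟨p, hp, hfp⟩ := MaxBeurling.exists_real_exponent hf
      rw [MaxBeurling.beurlingMax_beurling_eq hp hfp]
      exact hle (MaxBeurling.one_le_ofReal' hp) ENNReal.ofReal_ne_top hfp z
    · obtain ⟨p, hp, hfp⟩ := MaxBeurling.exists_real_exponent hf
      simp_rw [MaxBeurling.beurlingMax_beurling_eq hp hfp]
      exact hweak f hf1 t ht
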